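/- **Setting.** Let $G$ be a compact Lie group, $K\subset G$ a subgroup such that $P=G/K$ is a connected homogeneous space of dimension $n$, $I\subset\mathbb R$ a nonempty open interval and $\epsilon\in\mathbb R$. For a Riemannian metric $g$ and a $1$-form $\omega$ on a manifold, the *Ricci soliton equation* for $g$ and the vector field $X$ that is $g$-dual to $\omega$ is $$\mathrm{Ric}(g)+\tfrac12\mathscr L_Xg+\tfrac{\epsilon}{2}\,g=0 .$$ For a metric $g$ on $P$, $\delta^*$ is the symmetrized covariant derivative of $1$-forms, $(\delta^*\omega)(X,Y)=\frac12\big((\nabla_X\omega)(Y)+(\nabla_Y\omega)(X)\big)$, and $\delta^{\nabla}L=-\sum_i(\nabla_{e_i}L)(e_i)$ ($e_i$ a local orthonormal frame) is the codifferential of an endomorphism field $L$ of $TP$. A superscript or subscript $t$ refers to the metric $g_t$, $\flat$ is the duality from vectors to $1$-forms given by $g_t$, and a dot is $d/dt$. Given a family $g_t$ of metrics, a family $L_t$ of endomorphism fields and a family $\omega_t$ of $1$-forms on $P$, and a function $\xi(t)$, $t\in I$, consider the system $$-(\delta^{\nabla^t}L_t)^\flat-d(\mathrm{tr}\,L_t)+\tfrac12\dot\omega_t-\omega_t\circ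 L_t=0,\tag{XN}$$ $$-\mathrm{tr}(\dot L_t)-\mathrm{tr}(L_t^2)+\dot\xi+\tfrac{\epsilon}{2}=0,\tag{NN}$$ $$\mathrm{Ric}_t(X,Y)-\mathrm{tr}(L_t)\,g_t(L_tX,Y)-g_t(\dot L_tX,Y)+\xi\,g_t(L_tX,Y)+(\delta^*\omega_t)(X,Y)+\tfrac{\epsilon}{2}\,g_t(X,Y)=0\tag{XY}$$ for all $X,Y\in TP$ and all $t\in I$. **(1)** Let $(\overline M^{\,n+1},\bar g)$ be a connected Riemannian manifold on which $G$ acts smoothly by isometries, and let $M_0$ be the set of points on principal orbits (the points whose isotropy group is, up to conjugation, contained in every isotropy group). Let $\gamma:I\to\overline M$ be a unit speed geodesic that is orthogonal to the orbits through its points and has isotropy group $K$ at each of them, such that $\Phi(t,aK)=a\cdot\gamma(t)$ is a diffeomorphism $\Phi:I\times P\to M_0$ (so the action is of cohomogeneity one, $\gamma$ meets every principal orbit and $M_0$ is open). Let $\bar\omega$ be a smooth $G$-invariant $1$-form on $\overline M$. Then $$\Phi^*\bar g=dt^2+g_t,\qquad \Phi^*\bar\omega=\xi(t)\,dt+\omega_t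 ,$$ where $g_t$ and $\omega_t$ are the smooth families of $G$-invariant metrics and $1$-forms on $P$ induced by $\Phi(t,\cdot)$ and $\xi(t)=\bar\omega(\gamma'(t))$ is smooth. Let $L_t$ be the shape operator $L_t(X)=\overline\nabla_XN$ of the orbits, $N=\Phi_*\partial_t$, regarded through $\Phi$ as a family of endomorphism fields of $TP$. Then the Ricci soliton equation for $\bar g$ and the vector field dual to $\bar\omega$ holds on $M_0$ if and only if (XN), (NN), (XY) hold; and, $M_0$ being dense in $\overline M$, the same equivalence is true for the equation on all of $\overline M$. **(2)** Conversely, let $g_t$ (resp. $\omega_t$) be a smooth one-parameter family of $G$-invariant metrics (resp. $1$-forms) on $P=G/K$ and $\xi$ a smooth function of $t\in I$ such that, with $L_t$ defined by $\dot g_t(X,Y)=2g_t(L_tX,Y)$, the system (XN), (NN), (XY) holds. Then $\bar g=dt^2+g_t$ is a smooth Riemannian metric and $\bar\omega=\xi\,dt+\omega_t$ a smooth $1$-form on $I\times P$, and $\bar g$ and the vector field dual to $\bar\omega$ satisfy the Ricci soliton equation on $I\times P$ (a local Ricci soliton). -/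

import Mathlib

open Set Function Filter Bundle
open scoped Topology Manifold ContDiff

set_option maxSynthPendingDepth 3

noncomputable section

namespace CohomOne

/-! ### Local Riemannian geometry: a metric `h` on (an open subset of) a vector space `E` -/

section Local

variable {E : Type*} [NormedAddCommGroup E] [NormedSpace ℝ E]

/-- Christoffel symbols of the first kind (the Koszul formula for constant vector fields):
`koszul h y u v w = (D_u h(v, w) + D_v h(u, w) - D_w h(u, v)) / 2` at `y`. -/
def koszul (h : E → E →L[ℝ] E →L[ℝ] ℝ) (y : E) : E →L[ℝ] E →L[ℝ] E →L[ℝ] ℝ :=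
  let D : E →L[ℝ] E →L[ℝ] E →L[ℝ] ℝ := fderiv ℝ h y
  let C : E →L[ℝ] E →L[ℝ] E →L[ℝ] ℝ :=
    (ContinuousLinearMap.flipₗᵢ ℝ E E ℝ).toContinuousLinearEquiv.toContinuousLinearMap ∘L D.flip
  (1 / 2 : ℝ) • (D + D.flip - C)

theorem koszul_apply (h : E → E →L[ℝ] E →L[ℝ] ℝ) (y u v w : E) :
    koszul h y u v w
      = (1 / 2 : ℝ) * (fderiv ℝ h y u v w + fderiv ℝ h y v u w - fderiv ℝ h y w u v) := by
  simp [koszul]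

/-- Christoffel symbols of the second kind, `Γ(u, v) = h⁻¹ (koszul h u v)`. The Levi-Civita
connection of `h` is `∇_u V = D_u V + Γ(u, V)`. -/
def christoffel (h : E → E →L[ℝ] E →L[ℝ] ℝ) (y : E) : E →L[ℝ] E →L[ℝ] E :=
  (ContinuousLinearMap.compL ℝ E (E →L[ℝ] ℝ) E (h y).inverse) ∘L koszul h y

theorem christoffel_apply (h : E → E →L[ℝ] E →L[ℝ] ℝ) (y u v : E) :
    christoffel h y u v = (h y).inverse (koszul h y u v) := rfl

/-- The curvature operator `u ↦ R(u, v) w`, where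
`R(u, v) w = (D_u Γ)(v, w) - (D_v Γ)(u, w) + Γ(u, Γ(v, w)) - Γ(v, Γ(u, w))`,
i.e. `R(u, v) = [∇_u, ∇_v] - ∇_[u, v]`. -/
def curvatureOp (h : E → E →L[ℝ] E →L[ℝ] ℝ) (y v w : E) : E →L[ℝ] E :=
  ((fderiv ℝ (christoffel h) y).flip v).flip w - (fderiv ℝ (christoffel h) y v).flip w
    + (christoffel h y).flip (christoffel h y v w)
    - (christoffel h y v) ∘L ((christoffel h y).flip w)

theorem curvatureOp_apply (h : E → E →L[ℝ] E →L[ℝ] ℝ) (y u v w : E) :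
    curvatureOp h y v w u
      = fderiv ℝ (christoffel h) y u v w - fderiv ℝ (christoffel h) y v u w
        + christoffel h y u (christoffel h y v w) - christoffel h y v (christoffel h y u w) := by
  simp [curvatureOp]

/-- The Ricci tensor `Ric(v, w) = tr (u ↦ R(u, v) w)`. -/
def localRicci (h : E → E →L[ℝ] E →L[ℝ] ℝ) (y v w : E) : ℝ :=
  LinearMap.trace ℝ E (curvatureOp h y v w : E →ₗ[ℝ] E)

/-- The covariant derivative `u ↦ ∇_u V` of a vector field. -/
def localCovDeriv (h : E → E →L[ℝ] E →L[ℝ] ℝ) (V : E → E) (y : E) : E →L[ℝ] E :=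
  fderiv ℝ V y + (christoffel h y).flip (V y)

/-- The Lie derivative `(ℒ_V h)(u, v)`. -/
def localLieDeriv (h : E → E →L[ℝ] E →L[ℝ] ℝ) (V : E → E) (y u v : E) : ℝ :=
  fderiv ℝ h y (V y) u v + h y (fderiv ℝ V y u) v + h y u (fderiv ℝ V y v)

/-- The symmetrized covariant derivative of a `1`-form,
`(δ*α)(u, v) = ((∇_u α)(v) + (∇_v α)(u)) / 2`, where `(∇_u α)(v) = (D_u α)(v) - α(Γ(u, v))`. -/
def localSymCovDeriv (h : E → E →L[ℝ] E →L[ℝ] ℝ) (α : E → E →L[ℝ] ℝ) (y u v : E) : ℝ :=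
  (1 / 2 : ℝ) * ((fderiv ℝ α y u v - α y (christoffel h y u v))
    + (fderiv ℝ α y v u - α y (christoffel h y v u)))

/-- The codifferential of a field of endomorphisms `A` (a vector-valued `1`-form),
`δ A = - ∑ h^{ij} (∇_{e_i} A)(e_j)`, where
`(∇_u A)(v) = (D_u A)(v) + Γ(u, A v) - A (Γ(u, v))`; here `∑_j h^{ij} e_j = h⁻¹(e^i)`. -/
def localCodiff [FiniteDimensional ℝ E] (h : E → E →L[ℝ] E →L[ℝ] ℝ) (A : E → E →L[ℝ] E)
    (y : E) : E :=
  - ∑ i, (fun u v : E => fderiv ℝ A y u v + christoffel h y u (A y v) - A y (christoffel h y u v))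
      (Module.finBasis ℝ E i)
      ((h y).inverse (LinearMap.toContinuousLinearMap ((Module.finBasis ℝ E).coord i)))

end Local

/-! ### Tensor fields on manifolds, and their expressions in charts -/

section Tensor

variable {E : Type*} [NormedAddCommGroup E] [NormedSpace ℝ E] {H : Type*} [TopologicalSpace H]
  (I : ModelWithCorners ℝ E H) (M : Type*) [TopologicalSpace M] [ChartedSpace H M]

/-- Fields of bilinear forms on the tangent spaces of `M`. -/
abbrev BilinField := (x : M) → TangentSpace I x →L[ℝ] TangentSpace I x →L[ℝ] ℝ

/-- Fields of linear forms on the tangent spaces of `M`. -/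
abbrev OneForm := (x : M) → TangentSpace I x →L[ℝ] ℝ

/-- Fields of endomorphisms of the tangent spaces of `M`. -/
abbrev EndField := (x : M) → TangentSpace I x →L[ℝ] TangentSpace I x

end Tensor

section Pull

variable {V W : Type*} [TopologicalSpace V] [AddCommGroup V] [Module ℝ V]
  [TopologicalSpace W] [AddCommGroup W] [Module ℝ W]

/-- The bilinear form `(u, v) ↦ B (A u) (A v)`. -/
def pullBilin (A : V →L[ℝ] W) (B : W →L[ℝ] W →L[ℝ] ℝ) : V →L[ℝ] V →L[ℝ] ℝ :=
  (ContinuousLinearMap.precomp ℝ A) ∘L B ∘L A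

theorem pullBilin_apply (A : V →L[ℝ] W) (B : W →L[ℝ] W →L[ℝ] ℝ) (u v : V) :
    pullBilin A B u v = B (A u) (A v) := rfl

end Pull

section Manifold

variable {E : Type*} [NormedAddCommGroup E] [NormedSpace ℝ E] {H : Type*} [TopologicalSpace H]
  (I : ModelWithCorners ℝ E H) {M : Type*} [TopologicalSpace M] [ChartedSpace H M]

/-- The expression of a field of bilinear forms in the preferred chart at `x`. -/
def chartBilin (g : BilinField I M) (x : M) (y : E) : E →L[ℝ] E →L[ℝ] ℝ :=
  pullBilin (V := E) (mfderiv 𝓘(ℝ, E) I (extChartAt I x).symm y) (g ((extChartAt I x).symm y))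

/-- The expression of a `1`-form in the preferred chart at `x`. -/
def chartOneForm (α : OneForm I M) (x : M) (y : E) : E →L[ℝ] ℝ :=
  (α ((extChartAt I x).symm y)) ∘L (mfderiv 𝓘(ℝ, E) I (extChartAt I x).symm y)

/-- The expression of a vector field in the preferred chart at `x`. -/
def chartVec (V : (x : M) → TangentSpace I x) (x : M) (y : E) : E :=
  VectorField.mpullback 𝓘(ℝ, E) I (extChartAt I x).symm V y

/-- The expression of a field of endomorphisms in the preferred chart at `x`. -/
def chartEnd (A : EndField I M) (x : M) (y : E) : E →L[ℝ] E :=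
  (mfderiv 𝓘(ℝ, E) I (extChartAt I x).symm y).inverse ∘L (A ((extChartAt I x).symm y)) ∘L
    (mfderiv 𝓘(ℝ, E) I (extChartAt I x).symm y)

/-- The differential at `x` of the preferred chart at `x`. -/
def dChart (x : M) : TangentSpace I x →L[ℝ] E :=
  mfderiv I 𝓘(ℝ, E) (extChartAt I x) x

/-- The Ricci tensor of the metric `g`. -/
def ricci (g : BilinField I M) (x : M) (u v : TangentSpace I x) : ℝ :=
  localRicci (chartBilin I g x) (extChartAt I x x) (dChart I x u) (dChart I x v)

/-- The Lie derivative `ℒ_V g`. -/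
def lieDeriv (g : BilinField I M) (V : (x : M) → TangentSpace I x) (x : M)
    (u v : TangentSpace I x) : ℝ :=
  localLieDeriv (chartBilin I g x) (chartVec I V x) (extChartAt I x x)
    (dChart I x u) (dChart I x v)

/-- The symmetrized covariant derivative `δ*α` of a `1`-form, for the Levi-Civita connection
of `g`. -/
def symCovDeriv (g : BilinField I M) (α : OneForm I M) (x : M) (u v : TangentSpace I x) : ℝ :=
  localSymCovDeriv (chartBilin I g x) (chartOneForm I α x) (extChartAt I x x)
    (dChart I x u) (dChart I x v)

/-- The covariant derivative `u ↦ ∇_u V` of a vector field, for the Levi-Civita connection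
of `g`. -/
def covDeriv (g : BilinField I M) (V : (x : M) → TangentSpace I x) : EndField I M := fun x =>
  (dChart I x).inverse ∘L (localCovDeriv (chartBilin I g x) (chartVec I V x) (extChartAt I x x))
    ∘L (dChart I x)

/-- The codifferential `δ^∇ A` of a field of endomorphisms, a vector field. -/
def codiff [FiniteDimensional ℝ E] (g : BilinField I M) (A : EndField I M) (x : M) :
    TangentSpace I x :=
  (dChart I x).inverse (localCodiff (chartBilin I g x) (chartEnd I A x) (extChartAt I x x))

/-- The vector field dual to a `1`-form with respect to `g`. -/
def dualField (g : BilinField I M) (α : OneForm I M) (x : M) : TangentSpace I x :=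
  (g x).inverse (α x)

/-- `g` is a smooth Riemannian metric on the (open) set `U`. -/
structure IsRiemannianMetricOn [IsManifold I ∞ M] (U : Set M) (g : BilinField I M) : Prop where
  symm : ∀ x ∈ U, ∀ u v : TangentSpace I x, g x u v = g x v u
  pos : ∀ x ∈ U, ∀ u : TangentSpace I x, u ≠ 0 → 0 < g x u u
  smooth : ContMDiffOn I (I.prod 𝓘(ℝ, E →L[ℝ] E →L[ℝ] ℝ)) ∞
    (fun x ↦ TotalSpace.mk' (E →L[ℝ] E →L[ℝ] ℝ)
      (E := fun x : M => TangentSpace I x →L[ℝ] TangentSpace I x →L[ℝ] ℝ) x (g x)) U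

/-- `α` is a smooth `1`-form on the (open) set `U`. -/
def IsSmoothOneFormOn [IsManifold I ∞ M] (U : Set M) (α : OneForm I M) : Prop :=
  ContMDiffOn I (I.prod 𝓘(ℝ, E →L[ℝ] ℝ)) ∞
    (fun x ↦ TotalSpace.mk' (E →L[ℝ] ℝ)
      (E := fun x : M => TangentSpace I x →L[ℝ] ℝ) x (α x)) U

/-- The Ricci soliton equation `Ric(g) + (1/2) ℒ_V g + (ε/2) g = 0` on the (open) set `U`. -/
def RicciSolitonEqOn (U : Set M) (g : BilinField I M) (V : (x : M) → TangentSpace I x)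
    (ε : ℝ) : Prop :=
  ∀ x ∈ U, ∀ u v : TangentSpace I x,
    ricci I g x u v + (1 / 2) * lieDeriv I g V x u v + (ε / 2) * g x u v = 0

variable (G : Type*) [Group G] [MulAction G M]

/-- Invariance of a field of bilinear forms under the action of `G`. -/
def IsInvariantBilin (g : BilinField I M) : Prop :=
  ∀ (a : G) (x : M) (u v : TangentSpace I x),
    g (a • x) (mfderiv I I (fun z : M => a • z) x u) (mfderiv I I (fun z : M => a • z) x v)
      = g x u v

/-- Invariance of a `1`-form under the action of `G`. -/
def IsInvariantOneForm (α : OneForm I M) : Prop :=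
  ∀ (a : G) (x : M) (u : TangentSpace I x),
    α (a • x) (mfderiv I I (fun z : M => a • z) x u) = α x u

/-- The velocity of a curve. -/
def velocity (c : ℝ → M) (t : ℝ) : TangentSpace I (c t) :=
  mfderiv 𝓘(ℝ, ℝ) I c t (1 : ℝ)

/-- The curve `c` is a geodesic of `g` on the open set `J` of parameters:
`c'' + Γ(c', c') = 0` in charts. -/
def IsGeodesicOn (g : BilinField I M) (J : Set ℝ) (c : ℝ → M) : Prop :=
  ContMDiffOn 𝓘(ℝ, ℝ) I ∞ c J ∧ ∀ t ∈ J,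
    let φ : ℝ → E := fun s => extChartAt I (c t) (c s)
    deriv (deriv φ) t + christoffel (chartBilin I g (c t)) (φ t) (deriv φ t) (deriv φ t) = 0

/-- `u` is tangent to the subset `S` at `x`: it is the velocity at `x` of a smooth curve
in `S`. -/
def IsTangentTo (S : Set M) (x : M) (u : TangentSpace I x) : Prop :=
  ∃ c : ℝ → M, ContMDiffAt 𝓘(ℝ, ℝ) I ∞ c 0 ∧ (∀ᶠ s in 𝓝 0, c s ∈ S) ∧
    (⟨c 0, velocity I c 0⟩ : TangentBundle I M) = ⟨x, u⟩

/-- The set of points of `M` on principal orbits: the isotropy group of such a point is, up to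
conjugation, contained in every other isotropy group. -/
def principalPoints (M : Type*) [MulAction G M] : Set M :=
  {x | ∀ y : M, ∃ a : G, MulAction.stabilizer G x ≤ MulAction.stabilizer G (a • y)}

end Manifold

/-! ### One-parameter families on `P` -/

section Family

variable {E : Type*} [NormedAddCommGroup E] [NormedSpace ℝ E] {H : Type*} [TopologicalSpace H]
  (I : ModelWithCorners ℝ E H) {P : Type*} [TopologicalSpace P] [ChartedSpace H P]
  (G : Type*) [Group G] [MulAction G P]

/-- `g t`, `t ∈ J`, is a smooth one-parameter family of `G`-invariant Riemannian metrics. -/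
structure IsInvariantMetricFamily [IsManifold I ∞ P] (J : Set ℝ) (g : ℝ → BilinField I P) :
    Prop where
  symm : ∀ t ∈ J, ∀ (p : P) (u v : TangentSpace I p), g t p u v = g t p v u
  pos : ∀ t ∈ J, ∀ (p : P) (u : TangentSpace I p), u ≠ 0 → 0 < g t p u u
  smooth : ContMDiffOn (𝓘(ℝ, ℝ).prod I) (I.prod 𝓘(ℝ, E →L[ℝ] E →L[ℝ] ℝ)) ∞
    (fun q : ℝ × P ↦ TotalSpace.mk' (E →L[ℝ] E →L[ℝ] ℝ)
      (E := fun p : P => TangentSpace I p →L[ℝ] TangentSpace I p →L[ℝ] ℝ) q.2 (g q.1 q.2))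
    (J ×ˢ univ)
  invariant : ∀ t ∈ J, IsInvariantBilin I G (g t)

/-- `α t`, `t ∈ J`, is a smooth one-parameter family of `G`-invariant `1`-forms. -/
structure IsInvariantOneFormFamily [IsManifold I ∞ P] (J : Set ℝ) (α : ℝ → OneForm I P) :
    Prop where
  smooth : ContMDiffOn (𝓘(ℝ, ℝ).prod I) (I.prod 𝓘(ℝ, E →L[ℝ] ℝ)) ∞
    (fun q : ℝ × P ↦ TotalSpace.mk' (E →L[ℝ] ℝ)
      (E := fun p : P => TangentSpace I p →L[ℝ] ℝ) q.2 (α q.1 q.2))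
    (J ×ˢ univ)
  invariant : ∀ t ∈ J, IsInvariantOneForm I G (α t)

/-- The symmetric bilinear form `dt² + g_t` on `ℝ × P`. -/
def productMetric (g : ℝ → BilinField I P) : BilinField (𝓘(ℝ, ℝ).prod I) (ℝ × P) := fun q =>
  pullBilin (W := ℝ) (mvfderiv (𝓘(ℝ, ℝ).prod I) (Prod.fst : ℝ × P → ℝ) q) (ContinuousLinearMap.mul ℝ ℝ)
    + pullBilin (mfderiv (𝓘(ℝ, ℝ).prod I) I Prod.snd q) (g q.1 q.2)

/-- The `1`-form `ξ(t) dt + α_t` on `ℝ × P`. -/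
def productOneForm (ξ : ℝ → ℝ) (α : ℝ → OneForm I P) : OneForm (𝓘(ℝ, ℝ).prod I) (ℝ × P) :=
  fun q => ξ q.1 • mvfderiv (𝓘(ℝ, ℝ).prod I) (Prod.fst : ℝ × P → ℝ) q
    + (α q.1 q.2) ∘L (mfderiv (𝓘(ℝ, ℝ).prod I) I Prod.snd q)

/-- The trace of an endomorphism of a tangent space. -/
def tr {p : P} (A : TangentSpace I p →L[ℝ] TangentSpace I p) : ℝ :=
  LinearMap.trace ℝ (TangentSpace I p) (A : TangentSpace I p →ₗ[ℝ] TangentSpace I p)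

/-- The `t`-derivative of a family of endomorphism fields. -/
def dotEnd (L : ℝ → EndField I P) (t : ℝ) : EndField I P := fun p => deriv (fun s => L s p) t

/-- The cohomogeneity one Ricci soliton system for `(g_t, L_t, α_t, ξ)`, `t ∈ J`. -/
structure SolitonSystem [FiniteDimensional ℝ E] (J : Set ℝ) (g : ℝ → BilinField I P)
    (L : ℝ → EndField I P) (α : ℝ → OneForm I P) (ξ : ℝ → ℝ) (ε : ℝ) : Prop where
  /-- `-(δ^∇ L_t)^♭ - d(tr L_t) + (1/2) α̇_t - α_t ∘ L_t = 0` -/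
  mixed : ∀ t ∈ J, ∀ (p : P) (X : TangentSpace I p),
    - g t p (codiff I (g t) (L t) p) X
      - mvfderiv I (fun q : P => tr I (L t q)) p X
      + (1 / 2) * deriv (fun s => α s p X) t - α t p (L t p X) = 0
  /-- `-tr(L̇) - tr(L_t²) + ξ̇ + ε/2 = 0` -/
  normal : ∀ t ∈ J, ∀ p : P,
    - tr I (dotEnd I L t p) - tr I (L t p ∘L L t p) + deriv ξ t + ε / 2 = 0
  /-- `Ric_t(X, Y) - tr(L_t) g_t(L_t X, Y) - g_t(L̇ X, Y) + ξ g_t(L_t X, Y) + (δ*α_t)(X, Y)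
  + (ε/2) g_t(X, Y) = 0` -/
  orbit : ∀ t ∈ J, ∀ (p : P) (X Y : TangentSpace I p),
    ricci I (g t) p X Y - tr I (L t p) * g t p (L t p X) Y - g t p (dotEnd I L t p X) Y
      + ξ t * g t p (L t p X) Y + symCovDeriv I (g t) (α t) p X Y + (ε / 2) * g t p X Y = 0

end Family

/-! ### Cohomogeneity one manifolds -/

section CohomogeneityOne

variable {E : Type*} [NormedAddCommGroup E] [NormedSpace ℝ E] {H : Type*} [TopologicalSpace H]
  (I : ModelWithCorners ℝ E H) {M : Type*} [TopologicalSpace M] [ChartedSpace H M]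
  {E' : Type*} [NormedAddCommGroup E'] [NormedSpace ℝ E'] {H' : Type*} [TopologicalSpace H']
  (I' : ModelWithCorners ℝ E' H')

/-- `Φ : J × (G ⧸ K) → M₀`, `Φ(t, aK) = a • γ(t)`, is the diffeomorphism induced by a unit speed
geodesic `γ` of the metric `g` that meets all principal orbits orthogonally; here `M₀` is the
set of points on principal orbits, and `K` is the isotropy group along `γ`. -/
structure IsCohomOneDiffeo {G : Type*} [Group G] [MulAction G M] (K : Subgroup G)
    [TopologicalSpace (G ⧸ K)] [ChartedSpace H' (G ⧸ K)]
    (g : BilinField I M) (J : Set ℝ) (γ : ℝ → M)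
    (Φ : OpenPartialHomeomorph (ℝ × (G ⧸ K)) M) : Prop where
  isometric : IsInvariantBilin I G g
  geodesic : IsGeodesicOn I g J γ
  unit_speed : ∀ t ∈ J, g (γ t) (velocity I γ t) (velocity I γ t) = 1
  orthogonal : ∀ t ∈ J, ∀ u : TangentSpace I (γ t),
    IsTangentTo I (MulAction.orbit G (γ t)) (γ t) u → g (γ t) (velocity I γ t) u = 0
  isotropy : ∀ t ∈ J, MulAction.stabilizer G (γ t) = K
  source_eq : Φ.source = J ×ˢ univ
  target_eq : Φ.target = principalPoints G M
  apply_eq : ∀ t ∈ J, ∀ a : G, Φ (t, (a : G ⧸ K)) = a • γ t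
  smooth : ContMDiffOn (𝓘(ℝ, ℝ).prod I') I ∞ Φ Φ.source
  smooth_symm : ContMDiffOn I (𝓘(ℝ, ℝ).prod I') ∞ Φ.symm Φ.target

variable {P : Type*} [TopologicalSpace P] [ChartedSpace H' P] (Φ : OpenPartialHomeomorph (ℝ × P) M)

/-- The metric `g_t` induced on `P` by `Φ(t, ·)`. -/
def inducedMetric (g : BilinField I M) (t : ℝ) : BilinField I' P := fun p =>
  pullBilin (mfderiv I' I (fun q => Φ (t, q)) p) (g (Φ (t, p)))

/-- The `1`-form `α_t` induced on `P` by `Φ(t, ·)`. -/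
def inducedOneForm (α : OneForm I M) (t : ℝ) : OneForm I' P := fun p =>
  (α (Φ (t, p))) ∘L (mfderiv I' I (fun q => Φ (t, q)) p)

/-- The function `ξ(t) = α(γ'(t))`. -/
def normalComponent (α : OneForm I M) (γ : ℝ → M) (t : ℝ) : ℝ := α (γ t) (velocity I γ t)

/-- The field `N = Φ_* (∂/∂t)`, defined on the target of `Φ`. -/
def normalField (x : M) : TangentSpace I x :=
  VectorField.mpullback I (𝓘(ℝ, ℝ).prod I') Φ.symm
    (fun q => mfderiv 𝓘(ℝ, ℝ) (𝓘(ℝ, ℝ).prod I') (fun s : ℝ => (s, q.2)) q.1 (1 : ℝ)) x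

/-- The shape operator `X ↦ ∇_X N` of the orbits (`∇` the Levi-Civita connection of `g`), seen
through `Φ` as a family of endomorphisms `L_t` of `TP`. -/
def shapeOperator (g : BilinField I M) (t : ℝ) : EndField I' P := fun p =>
  (mfderiv (𝓘(ℝ, ℝ).prod I') I' Prod.snd (t, p)) ∘L
    (mfderiv (𝓘(ℝ, ℝ).prod I') I Φ (t, p)).inverse ∘L
    (covDeriv I g (normalField I I' Φ) (Φ (t, p))) ∘L
    (mfderiv I' I (fun q => Φ (t, q)) p)

end CohomogeneityOne

end CohomOne

end

set_option linter.unusedSectionVars false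
set_option synthInstance.maxHeartbeats 200000

noncomputable section

namespace CohomOne

section LocalGeometry

variable {E : Type*} [NormedAddCommGroup E] [NormedSpace ℝ E] [FiniteDimensional ℝ E]
  {E' : Type*} [NormedAddCommGroup E'] [NormedSpace ℝ E'] [FiniteDimensional ℝ E']

theorem _root_.HasFDerivAt.clm_apply_const {F F₁ F₂ : Type*} [NormedAddCommGroup F]
    [NormedSpace ℝ F] [NormedAddCommGroup F₁] [NormedSpace ℝ F₁] [NormedAddCommGroup F₂]
    [NormedSpace ℝ F₂] {c : F → F₁ →L[ℝ] F₂} {c' : F →L[ℝ] F₁ →L[ℝ] F₂} {x : F}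
    (hc : HasFDerivAt c c' x) (u : F₁) : HasFDerivAt (fun z => c z u) (c'.flip u) x := by
  have := hc.clm_apply (hasFDerivAt_const u x)
  convert this using 1; ext; simp

theorem eventually_isInvertible {X : Type*} [TopologicalSpace X] {F F' : Type*}
    [NormedAddCommGroup F] [NormedSpace ℝ F] [CompleteSpace F] [NormedAddCommGroup F']
    [NormedSpace ℝ F'] {A : X → F →L[ℝ] F'} {x : X} (hA : ContinuousAt A x)
    (hx : (A x).IsInvertible) : ∀ᶠ z in 𝓝 x, (A z).IsInvertible := by
  obtain ⟨e, he⟩ := hx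
  have : Set.range ((↑) : (F ≃L[ℝ] F') → F →L[ℝ] F') ∈ 𝓝 (A x) := by
    rw [← he]; exact ContinuousLinearEquiv.nhds e
  exact (hA.eventually this).mono fun z hz => hz

/-- `h` is a nondegenerate symmetric bilinear form near `y`, of class `C²`. -/
structure IsLocalMetric (h : E → E →L[ℝ] E →L[ℝ] ℝ) (y : E) : Prop where
  contDiffAt : ContDiffAt ℝ 2 h y
  symm : ∀ᶠ z in 𝓝 y, ∀ u v, h z u v = h z v u
  inv : (h y).IsInvertible

namespace IsLocalMetric

variable {h : E → E →L[ℝ] E →L[ℝ] ℝ} {y : E}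

theorem eventually (H : IsLocalMetric h y) : ∀ᶠ z in 𝓝 y, IsLocalMetric h z := by
  filter_upwards [H.contDiffAt.eventually (by simp), H.symm.eventually_nhds,
    eventually_isInvertible H.contDiffAt.continuousAt H.inv] with z h1 h2 h3
  exact ⟨h1, h2, h3⟩

theorem differentiableAt (H : IsLocalMetric h y) : DifferentiableAt ℝ h y :=
  H.contDiffAt.differentiableAt (by simp)

theorem fderiv_symm (H : IsLocalMetric h y) (w u v : E) :
    fderiv ℝ h y w u v = fderiv ℝ h y w v u := by
  have h1 := (H.differentiableAt.hasFDerivAt.clm_apply_const u).clm_apply_const v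
  have h2 := (H.differentiableAt.hasFDerivAt.clm_apply_const v).clm_apply_const u
  have h3 : (fun z => h z u v) =ᶠ[𝓝 y] fun z => h z v u := H.symm.mono fun z hz => hz u v
  have := (h2.congr_of_eventuallyEq h3).unique h1
  simpa using congrArg (fun T => T w) this.symm

theorem apply_christoffel (H : IsLocalMetric h y) (u v w : E) :
    h y (christoffel h y u v) w
      = (1 / 2 : ℝ) * (fderiv ℝ h y u v w + fderiv ℝ h y v u w - fderiv ℝ h y w u v) := by
  rw [christoffel_apply, H.inv.self_apply_inverse, koszul_apply]

theorem christoffel_symm (H : IsLocalMetric h y) (u v : E) :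
    christoffel h y u v = christoffel h y v u := by
  apply H.inv.injective
  ext w
  rw [H.apply_christoffel, H.apply_christoffel, H.fderiv_symm w u v]
  ring

theorem compat (H : IsLocalMetric h y) (w u v : E) :
    h y (christoffel h y w u) v + h y u (christoffel h y w v) = fderiv ℝ h y w u v := by
  rw [H.symm.self_of_nhds u, H.apply_christoffel, H.apply_christoffel, H.fderiv_symm u w v,
    H.fderiv_symm w v u, H.fderiv_symm v w u]
  ring

theorem eq_christoffel (H : IsLocalMetric h y) {u v x : E}
    (hx : ∀ w, h y x w
      = (1 / 2 : ℝ) * (fderiv ℝ h y u v w + fderiv ℝ h y v u w - fderiv ℝ h y w u v)) :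
    christoffel h y u v = x := by
  apply H.inv.injective
  ext w
  rw [H.apply_christoffel, hx]

theorem contDiffAt_koszul (H : IsLocalMetric h y) : ContDiffAt ℝ 1 (koszul h) y := by
  have h1 : ContDiffAt ℝ 1 (fderiv ℝ h) y := H.contDiffAt.fderiv_right (by norm_num)
  unfold koszul
  have hf : ContDiffAt ℝ 1 (fun z => (fderiv ℝ h z).flip) y :=
    (ContinuousLinearMap.flipₗᵢ ℝ E E (E →L[ℝ] ℝ)).toContinuousLinearEquiv.contDiff.contDiffAt.comp
      y h1
  refine ContDiffAt.const_smul _ ((h1.add hf).sub ?_)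
  exact contDiffAt_const.clm_comp hf

theorem contDiffAt_inverse (H : IsLocalMetric h y) {n : WithTop ℕ∞} (hn : n ≤ 2) :
    ContDiffAt ℝ n (fun z => (h z).inverse) y :=
  H.inv.contDiffAt_map_inverse.comp y (H.contDiffAt.of_le hn)

theorem contDiffAt_christoffel (H : IsLocalMetric h y) : ContDiffAt ℝ 1 (christoffel h) y := by
  unfold christoffel
  refine ContDiffAt.clm_comp ?_ H.contDiffAt_koszul
  exact ContDiffAt.clm_apply (f := fun _ => ContinuousLinearMap.compL ℝ E (E →L[ℝ] ℝ) E)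
    contDiffAt_const (H.contDiffAt_inverse (by norm_num))

theorem differentiableAt_christoffel (H : IsLocalMetric h y) :
    DifferentiableAt ℝ (christoffel h) y :=
  H.contDiffAt_christoffel.differentiableAt (by simp)

end IsLocalMetric

theorem IsLocalMetric.hasFDerivAt_christoffel_apply {h : E → E →L[ℝ] E →L[ℝ] ℝ} {y : E}
    (H : IsLocalMetric h y) (u v : E) :
    HasFDerivAt (fun z => christoffel h z u v)
      (((fderiv ℝ (christoffel h) y).flip u).flip v) y :=
  (H.differentiableAt_christoffel.hasFDerivAt.clm_apply_const u).clm_apply_const v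

/-! ### Symmetries of the curvature -/

namespace IsLocalMetric

variable {h : E → E →L[ℝ] E →L[ℝ] ℝ} {y : E}

theorem fderiv_christoffel_symm (H : IsLocalMetric h y) (w u v : E) :
    fderiv ℝ (christoffel h) y w u v = fderiv ℝ (christoffel h) y w v u := by
  have h3 : (fun z => christoffel h z u v) =ᶠ[𝓝 y] fun z => christoffel h z v u :=
    H.eventually.mono fun z hz => hz.christoffel_symm u v
  have := ((H.hasFDerivAt_christoffel_apply v u).congr_of_eventuallyEq h3).unique
    (H.hasFDerivAt_christoffel_apply u v)
  simpa using congrArg (fun T => T w) this.symm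

theorem second_compat (H : IsLocalMetric h y) (v w a b : E) :
    h y (fderiv ℝ (christoffel h) y v w a + christoffel h y v (christoffel h y w a)) b
      + h y a (fderiv ℝ (christoffel h) y v w b + christoffel h y v (christoffel h y w b))
      + h y (christoffel h y w a) (christoffel h y v b)
      + h y (christoffel h y v a) (christoffel h y w b)
      = fderiv ℝ (fderiv ℝ h) y v w a b := by
  have e : (fun z => h z (christoffel h z w a) b + h z a (christoffel h z w b))
      =ᶠ[𝓝 y] fun z => fderiv ℝ h z w a b := H.eventually.mono fun z hz => hz.compat w a b
  have hh := H.differentiableAt.hasFDerivAt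
  have d1 := (hh.clm_apply (H.hasFDerivAt_christoffel_apply w a)).clm_apply_const b
  have d2 := (hh.clm_apply_const a).clm_apply (H.hasFDerivAt_christoffel_apply w b)
  have hd : HasFDerivAt (fderiv ℝ h) (fderiv ℝ (fderiv ℝ h) y) y :=
    ((H.contDiffAt.fderiv_right (m := 1) (by norm_num)).differentiableAt (by simp)).hasFDerivAt
  have d3 := ((hd.clm_apply_const w).clm_apply_const a).clm_apply_const b
  have := congrArg (fun T => T v) ((d1.add d2).unique (d3.congr_of_eventuallyEq e))
  simp only [add_apply, ContinuousLinearMap.comp_apply,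
    ContinuousLinearMap.flip_apply] at this
  rw [← this, map_add, map_add, add_apply, ← H.compat v (christoffel h y w a) b,
    ← H.compat v a (christoffel h y w b)]
  ring

theorem curvature_skew (H : IsLocalMetric h y) (v w a b : E) :
    h y (curvatureOp h y w a v) b + h y a (curvatureOp h y w b v) = 0 := by
  have h1 := H.second_compat v w a b
  have h2 := H.second_compat w v a b
  have h3 := (H.contDiffAt.isSymmSndFDerivAt (by simp)) v w
  rw [← h3, ← h1] at h2
  simp only [curvatureOp_apply, map_add, map_sub, add_apply, sub_apply] at h2 ⊢
  linarith

theorem bianchi (H : IsLocalMetric h y) (u v w : E) :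
    curvatureOp h y v w u - curvatureOp h y w v u
      = - (curvatureOp h y w u v) := by
  simp only [curvatureOp_apply]
  rw [H.fderiv_christoffel_symm u w v, H.fderiv_christoffel_symm v u w,
    H.fderiv_christoffel_symm w u v, H.christoffel_symm w v, H.christoffel_symm u w,
    H.christoffel_symm u v]
  abel

theorem trace_eq_zero_of_skew (H : IsLocalMetric h y) (T : E →L[ℝ] E)
    (hT : ∀ a b, h y (T a) b + h y a (T b) = 0) :
    LinearMap.trace ℝ E (T : E →ₗ[ℝ] E) = 0 := by
  obtain ⟨e, he⟩ := H.inv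
  let f : E ≃ₗ[ℝ] Module.Dual ℝ E :=
    e.toLinearEquiv.trans (LinearMap.toContinuousLinearMap (𝕜 := ℝ) (E := E) (F' := ℝ)).symm
  have hf : ∀ a b, f a b = h y a b := fun a b => by rw [← he]; rfl
  have key : f.conj (T : E →ₗ[ℝ] E) = - Module.Dual.transpose (R := ℝ) (T : E →ₗ[ℝ] E) := by
    refine LinearMap.ext fun φ => LinearMap.ext fun b => ?_
    obtain ⟨a, rfl⟩ := f.surjective φ
    have := hT a b
    simp only [LinearEquiv.conj_apply_apply, LinearEquiv.symm_apply_apply, LinearMap.neg_apply,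
      Module.Dual.transpose_apply, LinearMap.comp_apply, hf, ContinuousLinearMap.coe_coe]
    linarith
  have h1 := LinearMap.trace_conj' (T : E →ₗ[ℝ] E) f
  rw [key, map_neg, LinearMap.trace_transpose'] at h1
  linarith

theorem localRicci_symm (H : IsLocalMetric h y) (v w : E) :
    localRicci h y v w = localRicci h y w v := by
  rw [← sub_eq_zero]
  unfold localRicci
  rw [← map_sub]
  let T : E →L[ℝ] E := curvatureOp h y v w - curvatureOp h y w v
  refine H.trace_eq_zero_of_skew T fun a b => ?_
  have := H.curvature_skew v w a b
  simp only [T, sub_apply, H.bianchi, map_neg, neg_apply]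
  linarith

end IsLocalMetric
end LocalGeometry

section Naturality

variable {E : Type*} [NormedAddCommGroup E] [NormedSpace ℝ E] [FiniteDimensional ℝ E]
  {E' : Type*} [NormedAddCommGroup E'] [NormedSpace ℝ E'] [FiniteDimensional ℝ E']

theorem contDiffAt_clm_of_apply {D F F₂ : Type*} [NormedAddCommGroup D] [NormedSpace ℝ D]
    [NormedAddCommGroup F] [NormedSpace ℝ F] [FiniteDimensional ℝ F] [NormedAddCommGroup F₂]
    [NormedSpace ℝ F₂] {n : WithTop ℕ∞} {f : D → F →L[ℝ] F₂} {x : D}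
    (hf : ∀ v, ContDiffAt ℝ n (fun z => f z v) x) : ContDiffAt ℝ n f x := by
  let d := Module.finrank ℝ F
  have hd : d = Module.finrank ℝ (Fin d → ℝ) := (Module.finrank_fin_fun ℝ).symm
  let e₁ := ContinuousLinearEquiv.ofFinrankEq hd
  let e₂ := (e₁.arrowCongr (1 : F₂ ≃L[ℝ] F₂)).trans (ContinuousLinearEquiv.piRing (Fin d))
  rw [← id_comp f, ← e₂.symm_comp_self]
  exact e₂.symm.contDiff.contDiffAt.comp x (contDiffAt_pi.mpr fun i => hf _)

/-- Near `y`, the map `f` is a diffeomorphism of class `C³` that pulls `h` back to `h'`. -/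
structure IsLocalIsometry (f : E' → E) (h' : E' → E' →L[ℝ] E' →L[ℝ] ℝ)
    (h : E → E →L[ℝ] E →L[ℝ] ℝ) (y : E') : Prop where
  contDiffAt : ContDiffAt ℝ 3 f y
  inv : (fderiv ℝ f y).IsInvertible
  metric : IsLocalMetric h (f y)
  eq : ∀ᶠ z in 𝓝 y, ∀ u v, h' z u v = h (f z) (fderiv ℝ f z u) (fderiv ℝ f z v)

namespace IsLocalIsometry

variable {f : E' → E} {h' : E' → E' →L[ℝ] E' →L[ℝ] ℝ} {h : E → E →L[ℝ] E →L[ℝ] ℝ} {y : E'}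

theorem contDiffAt_fderiv (H : IsLocalIsometry f h' h y) : ContDiffAt ℝ 2 (fderiv ℝ f) y :=
  H.contDiffAt.fderiv_right (by norm_num)

theorem eventually (H : IsLocalIsometry f h' h y) :
    ∀ᶠ z in 𝓝 y, IsLocalIsometry f h' h z := by
  filter_upwards [H.contDiffAt.eventually (by simp), H.eq.eventually_nhds,
    eventually_isInvertible H.contDiffAt_fderiv.continuousAt H.inv,
    H.contDiffAt.continuousAt.eventually H.metric.eventually] with z h1 h2 h3 h4
  exact ⟨h1, h3, h4, h2⟩

theorem metric' (H : IsLocalIsometry f h' h y) : IsLocalMetric h' y := by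
  have h1 := H.contDiffAt_fderiv
  have h2 : ContDiffAt ℝ 2 (fun z => h (f z)) y :=
    H.metric.contDiffAt.comp y (H.contDiffAt.of_le (by norm_num))
  refine ⟨?_, ?_, ?_⟩
  · refine contDiffAt_clm_of_apply fun u => contDiffAt_clm_of_apply fun v => ?_
    refine ContDiffAt.congr_of_eventuallyEq ?_ (H.eq.mono fun z hz => hz u v)
    exact (h2.clm_apply (h1.clm_apply contDiffAt_const)).clm_apply (h1.clm_apply contDiffAt_const)
  · filter_upwards [H.eventually] with z hz u v
    rw [hz.eq.self_of_nhds, hz.eq.self_of_nhds, hz.metric.symm.self_of_nhds]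
  · have : h' y = ((ContinuousLinearMap.precomp ℝ (fderiv ℝ f y)) ∘L h (f y)) ∘L fderiv ℝ f y := by
      ext u v
      exact H.eq.self_of_nhds u v
    rw [this]
    refine ContinuousLinearMap.IsInvertible.comp ?_ H.inv
    refine ContinuousLinearMap.IsInvertible.comp ?_ H.metric.inv
    obtain ⟨e, he⟩ := H.inv
    rw [← he]
    exact ⟨e.symm.arrowCongr (ContinuousLinearEquiv.refl ℝ ℝ), by ext; simp⟩

theorem hasFDerivAt (H : IsLocalIsometry f h' h y) : HasFDerivAt f (fderiv ℝ f y) y :=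
  (H.contDiffAt.differentiableAt (by simp)).hasFDerivAt

theorem hasFDerivAt₂ (H : IsLocalIsometry f h' h y) :
    HasFDerivAt (fderiv ℝ f) (fderiv ℝ (fderiv ℝ f) y) y :=
  (H.contDiffAt_fderiv.differentiableAt (by simp)).hasFDerivAt

theorem hasFDerivAt₃ (H : IsLocalIsometry f h' h y) :
    HasFDerivAt (fderiv ℝ (fderiv ℝ f)) (fderiv ℝ (fderiv ℝ (fderiv ℝ f)) y) y :=
  ((H.contDiffAt_fderiv.fderiv_right (m := 1) (by norm_num)).differentiableAt
    (by simp)).hasFDerivAt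

theorem fderiv_fderiv_symm (H : IsLocalIsometry f h' h y) (u v : E') :
    fderiv ℝ (fderiv ℝ f) y u v = fderiv ℝ (fderiv ℝ f) y v u :=
  (H.contDiffAt.isSymmSndFDerivAt (by simp; norm_num)) u v

theorem fderiv_metric (H : IsLocalIsometry f h' h y) (w u v : E') :
    fderiv ℝ h' y w u v
      = fderiv ℝ h (f y) (fderiv ℝ f y w) (fderiv ℝ f y u) (fderiv ℝ f y v)
        + h (f y) (fderiv ℝ (fderiv ℝ f) y w u) (fderiv ℝ f y v)
        + h (f y) (fderiv ℝ f y u) (fderiv ℝ (fderiv ℝ f) y w v) := by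
  have d1 := (H.metric'.differentiableAt.hasFDerivAt.clm_apply_const u).clm_apply_const v
  have hc : HasFDerivAt (fun z => h (f z)) _ y :=
    H.metric.differentiableAt.hasFDerivAt.comp y H.hasFDerivAt
  have d2 := (hc.clm_apply (H.hasFDerivAt₂.clm_apply_const u)).clm_apply
    (H.hasFDerivAt₂.clm_apply_const v)
  have := congrArg (fun T => T w)
    (d1.unique (d2.congr_of_eventuallyEq (H.eq.mono fun z hz => hz u v)))
  simp only [add_apply, ContinuousLinearMap.comp_apply, ContinuousLinearMap.flip_apply] at this
  rw [this]
  ring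

theorem christoffel_map (H : IsLocalIsometry f h' h y) (u v : E') :
    fderiv ℝ f y (christoffel h' y u v)
      = christoffel h (f y) (fderiv ℝ f y u) (fderiv ℝ f y v) + fderiv ℝ (fderiv ℝ f) y u v := by
  set X := christoffel h (f y) (fderiv ℝ f y u) (fderiv ℝ f y v) + fderiv ℝ (fderiv ℝ f) y u v
    with hX
  have : christoffel h' y u v = (fderiv ℝ f y).inverse X := by
    refine H.metric'.eq_christoffel fun w => ?_
    rw [H.eq.self_of_nhds, H.inv.self_apply_inverse, hX, map_add, add_apply,
      H.metric.apply_christoffel, H.fderiv_metric, H.fderiv_metric, H.fderiv_metric,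
      H.fderiv_fderiv_symm v u, H.fderiv_fderiv_symm w u, H.fderiv_fderiv_symm w v,
      H.metric.symm.self_of_nhds (fderiv ℝ f y v) (fderiv ℝ (fderiv ℝ f) y u w)]
    ring
  rw [this, H.inv.self_apply_inverse]

theorem fderiv_christoffel_map (H : IsLocalIsometry f h' h y) (w u v : E') :
    fderiv ℝ f y (fderiv ℝ (christoffel h') y w u v)
        + fderiv ℝ (fderiv ℝ f) y w (christoffel h' y u v)
      = fderiv ℝ (christoffel h) (f y) (fderiv ℝ f y w) (fderiv ℝ f y u) (fderiv ℝ f y v)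
        + christoffel h (f y) (fderiv ℝ (fderiv ℝ f) y w u) (fderiv ℝ f y v)
        + christoffel h (f y) (fderiv ℝ f y u) (fderiv ℝ (fderiv ℝ f) y w v)
        + fderiv ℝ (fderiv ℝ (fderiv ℝ f)) y w u v := by
  have d1 := H.hasFDerivAt₂.clm_apply (H.metric'.hasFDerivAt_christoffel_apply u v)
  have hc : HasFDerivAt (fun z => christoffel h (f z)) _ y :=
    H.metric.differentiableAt_christoffel.hasFDerivAt.comp y H.hasFDerivAt
  have d2 := ((hc.clm_apply (H.hasFDerivAt₂.clm_apply_const u)).clm_apply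
    (H.hasFDerivAt₂.clm_apply_const v)).add
      ((H.hasFDerivAt₃.clm_apply_const u).clm_apply_const v)
  have := congrArg (fun T => T w)
    (d1.unique (d2.congr_of_eventuallyEq (H.eventually.mono fun z hz => hz.christoffel_map u v)))
  simp only [add_apply, ContinuousLinearMap.comp_apply, ContinuousLinearMap.flip_apply] at this
  rw [this]
  abel

theorem curvatureOp_map (H : IsLocalIsometry f h' h y) (u v w : E') :
    fderiv ℝ f y (curvatureOp h' y v w u)
      = curvatureOp h (f y) (fderiv ℝ f y v) (fderiv ℝ f y w) (fderiv ℝ f y u) := by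
  have h1 := H.fderiv_christoffel_map u v w
  have h2 := H.fderiv_christoffel_map v u w
  have h3 : fderiv ℝ (fderiv ℝ (fderiv ℝ f)) y u v w = fderiv ℝ (fderiv ℝ (fderiv ℝ f)) y v u w :=
    congrArg (fun T => T w) ((H.contDiffAt_fderiv.isSymmSndFDerivAt (by simp)) u v)
  rw [← eq_sub_iff_add_eq] at h1 h2
  simp only [curvatureOp_apply, map_add, map_sub, h1, h2, h3, H.christoffel_map,
    H.fderiv_fderiv_symm v u]
  abel

theorem localRicci_map (H : IsLocalIsometry f h' h y) (v w : E') :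
    localRicci h' y v w = localRicci h (f y) (fderiv ℝ f y v) (fderiv ℝ f y w) := by
  obtain ⟨e, he⟩ := H.inv
  unfold localRicci
  rw [← LinearMap.trace_conj' _ e.toLinearEquiv]
  congr 1
  ext x
  obtain ⟨u, rfl⟩ := e.surjective x
  have h1 : ∀ u, e u = fderiv ℝ f y u := fun u => by rw [← he]; rfl
  have h2 : e.toLinearEquiv.symm (e u) = u := e.symm_apply_apply u
  rw [LinearEquiv.conj_apply_apply, h2]
  change e _ = curvatureOp h (f y) _ _ (e u)
  rw [h1, h1, ← H.curvatureOp_map]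
  rfl

theorem localSymCovDeriv_map (H : IsLocalIsometry f h' h y) {α : E → E →L[ℝ] ℝ}
    {α' : E' → E' →L[ℝ] ℝ} (hα : DifferentiableAt ℝ α (f y))
    (hα' : ∀ᶠ z in 𝓝 y, ∀ u, α' z u = α (f z) (fderiv ℝ f z u)) (u v : E') :
    localSymCovDeriv h' α' y u v
      = localSymCovDeriv h α (f y) (fderiv ℝ f y u) (fderiv ℝ f y v) := by
  have hc : HasFDerivAt (fun z => α (f z)) _ y := hα.hasFDerivAt.comp y H.hasFDerivAt
  have hd : DifferentiableAt ℝ α' y := by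
    have : α' =ᶠ[𝓝 y] fun z => (α (f z)) ∘L (fderiv ℝ f z) :=
      hα'.mono fun z hz => by ext u; exact hz u
    exact ((hc.clm_comp H.hasFDerivAt₂).congr_of_eventuallyEq this).differentiableAt
  have key : ∀ u v, fderiv ℝ α' y u v = fderiv ℝ α (f y) (fderiv ℝ f y u) (fderiv ℝ f y v)
      + α (f y) (fderiv ℝ (fderiv ℝ f) y u v) := fun u v => by
    have d2 := hc.clm_apply (H.hasFDerivAt₂.clm_apply_const v)
    have := congrArg (fun T => T u) ((hd.hasFDerivAt.clm_apply_const v).unique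
      (d2.congr_of_eventuallyEq (hα'.mono fun z hz => hz v)))
    simp only [add_apply, ContinuousLinearMap.comp_apply, ContinuousLinearMap.flip_apply] at this
    rw [this, add_comm]
  simp only [localSymCovDeriv, key, hα'.self_of_nhds, H.christoffel_map, map_add]
  ring

theorem localCovDeriv_map (H : IsLocalIsometry f h' h y) {V : E → E} {V' : E' → E'}
    (hV : DifferentiableAt ℝ V (f y)) (hV' : DifferentiableAt ℝ V' y)
    (hVV : ∀ᶠ z in 𝓝 y, V (f z) = fderiv ℝ f z (V' z)) (u : E') :
    fderiv ℝ f y (localCovDeriv h' V' y u) = localCovDeriv h V (f y) (fderiv ℝ f y u) := by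
  have d1 := hV.hasFDerivAt.comp y H.hasFDerivAt
  have d2 := H.hasFDerivAt₂.clm_apply hV'.hasFDerivAt
  have := congrArg (fun T => T u) (d1.unique (d2.congr_of_eventuallyEq hVV))
  simp only [add_apply, ContinuousLinearMap.comp_apply, ContinuousLinearMap.flip_apply] at this
  simp only [localCovDeriv, add_apply, ContinuousLinearMap.flip_apply, map_add, this,
    H.christoffel_map, hVV.self_of_nhds]
  abel

end IsLocalIsometry

theorem IsLocalMetric.localLieDeriv_eq {h : E → E →L[ℝ] E →L[ℝ] ℝ} {y : E}
    (H : IsLocalMetric h y) {V : E → E} {α : E → E →L[ℝ] ℝ} (hα : DifferentiableAt ℝ α y)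
    (hV : ∀ᶠ z in 𝓝 y, V z = (h z).inverse (α z)) (u v : E) :
    (1 / 2) * localLieDeriv h V y u v = localSymCovDeriv h α y u v := by
  have hV' : DifferentiableAt ℝ V y :=
    (((H.contDiffAt_inverse (n := 1) (by norm_num)).differentiableAt (by simp)).clm_apply
      hα).congr_of_eventuallyEq hV
  have e : α =ᶠ[𝓝 y] fun z => h z (V z) := by
    filter_upwards [hV, H.eventually] with z h1 h2
    rw [h1, h2.inv.self_apply_inverse]
  have key : ∀ u v, fderiv ℝ α y u v = fderiv ℝ h y u (V y) v + h y (fderiv ℝ V y u) v := by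
    intro u v
    have d := (H.differentiableAt.hasFDerivAt.clm_apply hV'.hasFDerivAt).congr_of_eventuallyEq e
    have := congrArg (fun T => T u v) (hα.hasFDerivAt.unique d)
    simp only [add_apply, ContinuousLinearMap.comp_apply, ContinuousLinearMap.flip_apply] at this
    rw [this, add_comm]
  simp only [localLieDeriv, localSymCovDeriv, key, e.self_of_nhds]
  rw [H.symm.self_of_nhds (V y) (christoffel h y u v), H.symm.self_of_nhds (V y) (christoffel h y v u),
    H.apply_christoffel, H.apply_christoffel, H.symm.self_of_nhds u, H.fderiv_symm u v,
    H.fderiv_symm v u, H.fderiv_symm (V y) v u]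
  ring

end Naturality

section LocalProduct

variable {E : Type*} [NormedAddCommGroup E] [NormedSpace ℝ E] [FiniteDimensional ℝ E]

/-- The trace, as a continuous linear map. -/
def traceCLM (E : Type*) [NormedAddCommGroup E] [NormedSpace ℝ E] [FiniteDimensional ℝ E] :
    (E →L[ℝ] E) →L[ℝ] ℝ :=
  LinearMap.toContinuousLinearMap ((LinearMap.trace ℝ E) ∘ₗ ContinuousLinearMap.coeLM ℝ)

theorem traceCLM_apply (A : E →L[ℝ] E) : traceCLM E A = LinearMap.trace ℝ E (A : E →ₗ[ℝ] E) := rfl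

theorem traceCLM_comp_comm (A B : E →L[ℝ] E) : traceCLM E (A ∘L B) = traceCLM E (B ∘L A) :=
  LinearMap.trace_comp_comm' (B : E →ₗ[ℝ] E) (A : E →ₗ[ℝ] E)

theorem traceCLM_smulRight (φ : E →L[ℝ] ℝ) (x : E) : traceCLM E (φ.smulRight x) = φ x :=
  LinearMap.trace_smulRight (φ : E →ₗ[ℝ] ℝ) x

theorem traceCLM_prod (T : ℝ × E →L[ℝ] ℝ × E) :
    LinearMap.trace ℝ (ℝ × E) (T : ℝ × E →ₗ[ℝ] ℝ × E) = (T (1, 0)).1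
      + traceCLM E (ContinuousLinearMap.snd ℝ ℝ E ∘L T ∘L ContinuousLinearMap.inr ℝ ℝ E) := by
  have h1 : (T : ℝ × E →ₗ[ℝ] ℝ × E)
      = ((T : ℝ × E →ₗ[ℝ] ℝ × E) ∘ₗ LinearMap.inl ℝ ℝ E) ∘ₗ LinearMap.fst ℝ ℝ E
        + ((T : ℝ × E →ₗ[ℝ] ℝ × E) ∘ₗ LinearMap.inr ℝ ℝ E) ∘ₗ LinearMap.snd ℝ ℝ E := by
    refine LinearMap.ext fun q => ?_
    simp [← map_add]
  rw [h1, map_add, LinearMap.trace_comp_comm', LinearMap.trace_comp_comm' (LinearMap.snd ℝ ℝ E)]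
  congr 1
  have h2 : LinearMap.fst ℝ ℝ E ∘ₗ ((T : ℝ × E →ₗ[ℝ] ℝ × E) ∘ₗ LinearMap.inl ℝ ℝ E)
      = (T (1, 0)).1 • LinearMap.id := by
    ext; simp
  rw [h2, map_smul, LinearMap.trace_id]
  simp

theorem traceCLM_eq_sum (A : E →L[ℝ] E) :
    traceCLM E A = ∑ i, (Module.finBasis ℝ E).coord i (A (Module.finBasis ℝ E i)) := by
  rw [traceCLM_apply, LinearMap.trace_eq_matrix_trace ℝ (Module.finBasis ℝ E), Matrix.trace]
  simp [LinearMap.toMatrix_apply]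

theorem curvatureOp_add_left (h : E → E →L[ℝ] E →L[ℝ] ℝ) (y v v' w : E) :
    curvatureOp h y (v + v') w = curvatureOp h y v w + curvatureOp h y v' w := by
  ext u; simp only [curvatureOp_apply, map_add, add_apply]; abel

theorem curvatureOp_smul_left (h : E → E →L[ℝ] E →L[ℝ] ℝ) (y : E) (c : ℝ) (v w : E) :
    curvatureOp h y (c • v) w = c • curvatureOp h y v w := by
  ext u; simp only [curvatureOp_apply, map_smul, smul_apply, smul_add, smul_sub]

theorem localRicci_eq (h : E → E →L[ℝ] E →L[ℝ] ℝ) (y v w : E) :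
    localRicci h y v w = traceCLM E (curvatureOp h y v w) := rfl

theorem localRicci_add_left (h : E → E →L[ℝ] E →L[ℝ] ℝ) (y v v' w : E) :
    localRicci h y (v + v') w = localRicci h y v w + localRicci h y v' w := by
  simp only [localRicci_eq, curvatureOp_add_left, map_add]

theorem localRicci_smul_left (h : E → E →L[ℝ] E →L[ℝ] ℝ) (y : E) (c : ℝ) (v w : E) :
    localRicci h y (c • v) w = c * localRicci h y v w := by
  simp only [localRicci_eq, curvatureOp_smul_left, map_smul, smul_eq_mul]

/-- The bilinear form `dt² + h(t, y)` on `ℝ × E`. -/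
def prodBilin (h : ℝ × E → E →L[ℝ] E →L[ℝ] ℝ) (q : ℝ × E) :
    ℝ × E →L[ℝ] ℝ × E →L[ℝ] ℝ :=
  pullBilin (ContinuousLinearMap.fst ℝ ℝ E) (ContinuousLinearMap.mul ℝ ℝ)
    + pullBilin (ContinuousLinearMap.snd ℝ ℝ E) (h q)

theorem prodBilin_apply (h : ℝ × E → E →L[ℝ] E →L[ℝ] ℝ) (q u v : ℝ × E) :
    prodBilin h q u v = u.1 * v.1 + h q u.2 v.2 := rfl

/-- The `1`-form `ξ(t) dt + α(t, y)` on `ℝ × E`. -/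
def prodForm (ξ : ℝ → ℝ) (α : ℝ × E → E →L[ℝ] ℝ) (q : ℝ × E) : ℝ × E →L[ℝ] ℝ :=
  ξ q.1 • ContinuousLinearMap.fst ℝ ℝ E + α q ∘L ContinuousLinearMap.snd ℝ ℝ E

theorem prodForm_apply (ξ : ℝ → ℝ) (α : ℝ × E → E →L[ℝ] ℝ) (q u : ℝ × E) :
    prodForm ξ α q u = ξ q.1 * u.1 + α q u.2 := rfl

/-- `h(t, ·)` is a family of nondegenerate symmetric forms near `q`, with shape operators `ℓ`. -/
structure IsLocalFamily (h : ℝ × E → E →L[ℝ] E →L[ℝ] ℝ) (ℓ : ℝ × E → E →L[ℝ] E) (q : ℝ × E) :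
    Prop where
  contDiffAt : ContDiffAt ℝ 2 h q
  symm : ∀ᶠ r in 𝓝 q, ∀ u v, h r u v = h r v u
  inv : (h q).IsInvertible
  shape : ∀ᶠ r in 𝓝 q, ∀ u v, 2 * h r (ℓ r u) v = fderiv ℝ h r (1, 0) u v

theorem hasFDerivAt_slice {F : Type*} [NormedAddCommGroup F] [NormedSpace ℝ F] {f : ℝ × E → F}
    {f' : ℝ × E →L[ℝ] F} {q : ℝ × E} (hf : HasFDerivAt f f' q) :
    HasFDerivAt (fun y => f (q.1, y)) (f' ∘L ContinuousLinearMap.inr ℝ ℝ E) q.2 :=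
  HasFDerivAt.comp (g := f) q.2 hf (hasFDerivAt_prodMk_right q.1 q.2)

theorem eventually_slice {p : ℝ × E → Prop} {q : ℝ × E} (hp : ∀ᶠ r in 𝓝 q, p r) :
    ∀ᶠ y in 𝓝 q.2, p (q.1, y) :=
  have h : ContinuousAt (fun y => (q.1, y)) q.2 := (Continuous.prodMk_right q.1).continuousAt
  h.eventually hp

namespace IsLocalFamily

variable {h : ℝ × E → E →L[ℝ] E →L[ℝ] ℝ} {ℓ : ℝ × E → E →L[ℝ] E} {q : ℝ × E}

theorem eventually (H : IsLocalFamily h ℓ q) : ∀ᶠ r in 𝓝 q, IsLocalFamily h ℓ r := by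
  filter_upwards [H.contDiffAt.eventually (by simp), H.symm.eventually_nhds,
    H.shape.eventually_nhds,
    eventually_isInvertible H.contDiffAt.continuousAt H.inv] with z h1 h2 h3 h4
  exact ⟨h1, h2, h4, h3⟩

theorem hasFDerivAt (H : IsLocalFamily h ℓ q) : HasFDerivAt h (fderiv ℝ h q) q :=
  (H.contDiffAt.differentiableAt (by simp)).hasFDerivAt

theorem slice (H : IsLocalFamily h ℓ q) : IsLocalMetric (fun y => h (q.1, y)) q.2 where
  contDiffAt := ContDiffAt.comp (g := h) q.2 H.contDiffAt (contDiffAt_const.prodMk contDiffAt_id)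
  symm := eventually_slice H.symm
  inv := H.inv

theorem fderiv_slice (H : IsLocalFamily h ℓ q) (x : E) :
    fderiv ℝ (fun y => h (q.1, y)) q.2 x = fderiv ℝ h q (0, x) := by
  rw [(hasFDerivAt_slice H.hasFDerivAt).fderiv]; rfl

theorem shape_symm (H : IsLocalFamily h ℓ q) (u v : E) : h q (ℓ q u) v = h q u (ℓ q v) := by
  have h1 := H.shape.self_of_nhds u v
  have h2 := H.shape.self_of_nhds v u
  have e : (fun z => h z u v) =ᶠ[𝓝 q] fun z => h z v u := H.symm.mono fun z hz => hz u v
  have h3 := congrArg (fun T => T (1, 0)) (((H.hasFDerivAt.clm_apply_const v).clm_apply_const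
    u).congr_of_eventuallyEq e |>.unique ((H.hasFDerivAt.clm_apply_const u).clm_apply_const v))
  simp only [ContinuousLinearMap.flip_apply] at h3
  rw [H.symm.self_of_nhds u]
  linarith

theorem differentiableAt_shape (H : IsLocalFamily h ℓ q) : DifferentiableAt ℝ ℓ q := by
  have e : ℓ =ᶠ[𝓝 q] fun r => (h r).inverse ∘L ((1 / 2 : ℝ) • fderiv ℝ h r (1, 0)) := by
    filter_upwards [H.eventually] with r hr
    ext u
    apply hr.inv.injective
    ext v
    have := hr.shape.self_of_nhds u v
    simp only [ContinuousLinearMap.comp_apply, hr.inv.self_apply_inverse, smul_apply, smul_eq_mul]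
    linarith
  have h1 : ContDiffAt ℝ 1 (fun r => (h r).inverse) q :=
    H.inv.contDiffAt_map_inverse.comp q (H.contDiffAt.of_le (by norm_num))
  have h2 : ContDiffAt ℝ 1 (fderiv ℝ h) q := H.contDiffAt.fderiv_right (by norm_num)
  exact ((h1.clm_comp ((h2.clm_apply contDiffAt_const).const_smul _)).congr_of_eventuallyEq
    e).differentiableAt (by simp)

theorem hasFDerivAt_shape (H : IsLocalFamily h ℓ q) : HasFDerivAt ℓ (fderiv ℝ ℓ q) q :=
  H.differentiableAt_shape.hasFDerivAt

theorem fderiv_shape_slice (H : IsLocalFamily h ℓ q) (x : E) :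
    fderiv ℝ (fun y => ℓ (q.1, y)) q.2 x = fderiv ℝ ℓ q (0, x) := by
  rw [(hasFDerivAt_slice H.hasFDerivAt_shape).fderiv]; rfl

theorem prod (H : IsLocalFamily h ℓ q) : IsLocalMetric (prodBilin h) q := by
  refine ⟨?_, ?_, ?_⟩
  · refine contDiffAt_clm_of_apply fun u => contDiffAt_clm_of_apply fun v => ?_
    simp only [prodBilin_apply]
    exact contDiffAt_const.add ((H.contDiffAt.clm_apply contDiffAt_const).clm_apply
      contDiffAt_const)
  · filter_upwards [H.symm] with r hr u v
    rw [prodBilin_apply, prodBilin_apply, hr, mul_comm]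
  · refine ⟨(LinearEquiv.ofBijective ((prodBilin h q : ℝ × E →L[ℝ] ℝ × E →L[ℝ] ℝ) :
      ℝ × E →ₗ[ℝ] ℝ × E →L[ℝ] ℝ) ⟨?_, ?_⟩).toContinuousLinearEquiv, ?_⟩
    · rw [injective_iff_map_eq_zero]
      intro u hu
      have h1 := congrArg (fun T : ℝ × E →L[ℝ] ℝ => T (1, 0)) hu
      have h2 : h q u.2 = 0 := by
        ext v
        have := congrArg (fun T : ℝ × E →L[ℝ] ℝ => T (0, v)) hu
        simpa [prodBilin_apply] using this
      have h3 : u.2 = 0 := H.inv.injective (by rw [h2, map_zero])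
      ext
      · simpa [prodBilin_apply] using h1
      · exact h3
    · intro φ
      refine ⟨(φ (1, 0), (h q).inverse (φ ∘L ContinuousLinearMap.inr ℝ ℝ E)), ?_⟩
      ext <;> simp [prodBilin_apply, H.inv.self_apply_inverse]
      exact map_zero φ
    · rfl

theorem fderiv_prod (H : IsLocalFamily h ℓ q) (w u v : ℝ × E) :
    fderiv ℝ (prodBilin h) q w u v = fderiv ℝ h q w u.2 v.2 := by
  have d1 := (H.prod.differentiableAt.hasFDerivAt.clm_apply_const u).clm_apply_const v
  have d2 := ((H.hasFDerivAt.clm_apply_const u.2).clm_apply_const v.2).const_add (u.1 * v.1)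
  simpa using congrArg (fun T => T w) (d1.unique d2)

theorem christoffel_prod (H : IsLocalFamily h ℓ q) (u v : ℝ × E) :
    christoffel (prodBilin h) q u v = (- h q (ℓ q u.2) v.2,
      christoffel (fun y => h (q.1, y)) q.2 u.2 v.2 + u.1 • ℓ q v.2 + v.1 • ℓ q u.2) := by
  refine H.prod.eq_christoffel fun w => ?_
  have key : ∀ w u v : ℝ × E, fderiv ℝ h q w u.2 v.2
      = w.1 * (2 * h q (ℓ q u.2) v.2) + fderiv ℝ (fun y => h (q.1, y)) q.2 w.2 u.2 v.2 := by
    intro w u v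
    have : w = w.1 • ((1, 0) : ℝ × E) + (0, w.2) := by ext <;> simp
    conv_lhs => rw [this]
    rw [map_add, map_smul, H.fderiv_slice, H.shape.self_of_nhds]
    rfl
  have h1 := H.slice.apply_christoffel u.2 v.2 w.2
  simp only [prodBilin_apply, H.fderiv_prod, key, map_add, map_smul, add_apply, smul_apply,
    smul_eq_mul]
  rw [h1]
  ring

theorem hasFDerivAt_christoffel_prod (H : IsLocalFamily h ℓ q) (u v : ℝ × E) :
    HasFDerivAt (fun r : ℝ × E => (- h r (ℓ r u.2) v.2,
      christoffel (fun y => h (r.1, y)) r.2 u.2 v.2 + u.1 • ℓ r v.2 + v.1 • ℓ r u.2))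
      (((fderiv ℝ (christoffel (prodBilin h)) q).flip u).flip v) q :=
  (H.prod.hasFDerivAt_christoffel_apply u v).congr_of_eventuallyEq
    (H.eventually.mono fun _ hr => (hr.christoffel_prod u v).symm)

theorem fderiv_shape_apply (H : IsLocalFamily h ℓ q) (r : ℝ × E) (u v : E) :
    fderiv ℝ (fun r => h r (ℓ r u) v) q r
      = fderiv ℝ h q r (ℓ q u) v + h q (fderiv ℝ ℓ q r u) v := by
  rw [((H.hasFDerivAt.clm_apply (H.hasFDerivAt_shape.clm_apply_const u)).clm_apply_const
    v).fderiv]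
  simp only [add_apply, ContinuousLinearMap.comp_apply, ContinuousLinearMap.flip_apply]
  rw [add_comm]

theorem fderiv_christoffel_prod_fst (H : IsLocalFamily h ℓ q) (r u v : ℝ × E) :
    (fderiv ℝ (christoffel (prodBilin h)) q r u v).1
      = - (fderiv ℝ h q r (ℓ q u.2) v.2 + h q (fderiv ℝ ℓ q r u.2) v.2) := by
  have d1 := (H.hasFDerivAt_christoffel_prod u v).fst
  rw [← H.fderiv_shape_apply, ← neg_apply, ← fderiv_fun_neg, d1.fderiv]
  rfl

theorem fderiv_christoffel_prod_normal (H : IsLocalFamily h ℓ q) (r u : ℝ × E) :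
    fderiv ℝ (christoffel (prodBilin h)) q r u (1, 0) = (0, fderiv ℝ ℓ q r u.2) := by
  have d1 := H.hasFDerivAt_christoffel_prod u (1, 0)
  have d2 := (hasFDerivAt_const (0 : ℝ) q).prodMk (H.hasFDerivAt_shape.clm_apply_const u.2)
  have e : (fun r : ℝ × E => (- h r (ℓ r u.2) ((1, 0) : ℝ × E).2,
      christoffel (fun y => h (r.1, y)) r.2 u.2 ((1, 0) : ℝ × E).2
        + u.1 • ℓ r ((1, 0) : ℝ × E).2 + ((1, 0) : ℝ × E).1 • ℓ r u.2))
      = fun r => ((0 : ℝ), ℓ r u.2) := by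
    ext r <;> simp
  rw [e] at d1
  simpa using congrArg (fun T => T r) (d1.unique d2)

theorem fderiv_christoffel_prod_tangent (H : IsLocalFamily h ℓ q) (x z w : E) :
    (fderiv ℝ (christoffel (prodBilin h)) q (0, x) (0, z) (0, w)).2
      = fderiv ℝ (christoffel fun y => h (q.1, y)) q.2 x z w := by
  have d1 := hasFDerivAt_slice (H.hasFDerivAt_christoffel_prod (0, z) (0, w)).snd
  have d2 := H.slice.hasFDerivAt_christoffel_apply z w
  simp only [zero_smul, add_zero] at d1
  simpa using congrArg (fun T => T x) (d1.unique d2)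

/-- The covariant derivative `∇_x ℓ` of the shape operator along a slice. -/
def covShape (h : ℝ × E → E →L[ℝ] E →L[ℝ] ℝ) (ℓ : ℝ × E → E →L[ℝ] E) (q : ℝ × E) (x : E) :
    E →L[ℝ] E :=
  fderiv ℝ ℓ q (0, x) + christoffel (fun y => h (q.1, y)) q.2 x ∘L ℓ q
    - ℓ q ∘L christoffel (fun y => h (q.1, y)) q.2 x

theorem traceCLM_covShape (h : ℝ × E → E →L[ℝ] E →L[ℝ] ℝ) (ℓ : ℝ × E → E →L[ℝ] E) (q : ℝ × E)
    (x : E) : traceCLM E (covShape h ℓ q x) = traceCLM E (fderiv ℝ ℓ q (0, x)) := by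
  rw [covShape, map_sub, map_add, traceCLM_comp_comm]
  ring

theorem covShape_symm (H : IsLocalFamily h ℓ q) (x u v : E) :
    h q (covShape h ℓ q x u) v = h q u (covShape h ℓ q x v) := by
  have e : (fun z => h z (ℓ z u) v) =ᶠ[𝓝 q] fun z => h z u (ℓ z v) :=
    H.eventually.mono fun z hz => hz.shape_symm u v
  have d1 := (H.hasFDerivAt.clm_apply (H.hasFDerivAt_shape.clm_apply_const u)).clm_apply_const v
  have d2 := (H.hasFDerivAt.clm_apply_const u).clm_apply (H.hasFDerivAt_shape.clm_apply_const v)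
  have := congrArg (fun T => T (0, x)) (d1.unique (d2.congr_of_eventuallyEq e))
  simp only [add_apply, ContinuousLinearMap.comp_apply, ContinuousLinearMap.flip_apply] at this
  have c1 := H.slice.compat x (ℓ q u) v
  have c2 := H.slice.compat x u (ℓ q v)
  rw [H.fderiv_slice] at c1 c2
  have s1 := H.shape_symm (christoffel (fun y => h (q.1, y)) q.2 x u) v
  have s2 := H.shape_symm u (christoffel (fun y => h (q.1, y)) q.2 x v)
  simp only [covShape, add_apply, sub_apply, ContinuousLinearMap.comp_apply, map_add, map_sub]
  simp only [Prod.mk.eta] at c1 c2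
  linarith

theorem apply_localCodiff (H : IsLocalFamily h ℓ q) (z : E) :
    - h q (localCodiff (fun y => h (q.1, y)) (fun y => ℓ (q.1, y)) q.2) z
      = ∑ i, (Module.finBasis ℝ E).coord i (covShape h ℓ q (Module.finBasis ℝ E i) z) := by
  simp only [localCodiff, map_neg, neg_apply, neg_neg, map_sum, sum_apply]
  refine Finset.sum_congr rfl fun i _ => ?_
  have h1 := H.covShape_symm (Module.finBasis ℝ E i)
    ((h q).inverse (LinearMap.toContinuousLinearMap ((Module.finBasis ℝ E).coord i))) z
  rw [H.inv.self_apply_inverse] at h1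
  rw [H.fderiv_shape_slice]
  exact h1

theorem localRicci_prod_tangent (H : IsLocalFamily h ℓ q) (z w : E) :
    localRicci (prodBilin h) q (0, z) (0, w)
      = localRicci (fun y => h (q.1, y)) q.2 z w - traceCLM E (ℓ q) * h q (ℓ q z) w
        - h q (fderiv ℝ ℓ q (1, 0) z) w := by
  have h2 : ContinuousLinearMap.snd ℝ ℝ E ∘L curvatureOp (prodBilin h) q (0, z) (0, w)
        ∘L ContinuousLinearMap.inr ℝ ℝ E
      = curvatureOp (fun y => h (q.1, y)) q.2 z w - h q (ℓ q z) w • ℓ q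
        + (h q (ℓ q w)).smulRight (ℓ q z) := by
    ext x
    simp only [ContinuousLinearMap.comp_apply, ContinuousLinearMap.inr_apply,
      ContinuousLinearMap.coe_snd', curvatureOp_apply, Prod.snd_add, Prod.snd_sub,
      H.fderiv_christoffel_prod_tangent, H.christoffel_prod, zero_smul, add_zero, add_apply,
      sub_apply, smul_apply, ContinuousLinearMap.smulRight_apply, neg_smul]
    rw [H.shape_symm x w, H.symm.self_of_nhds x]
    abel
  rw [localRicci, traceCLM_prod, h2]
  simp only [curvatureOp_apply, Prod.fst_add, Prod.fst_sub, H.fderiv_christoffel_prod_fst,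
    H.christoffel_prod, map_add, map_sub, map_smul, map_zero, zero_apply, smul_eq_mul,
    traceCLM_smulRight, localRicci_eq, one_smul, zero_smul, add_zero, zero_add]
  have e1 := H.shape.self_of_nhds (ℓ q z) w
  have e2 := H.shape_symm (ℓ q z) w
  have e3 := H.symm.self_of_nhds (ℓ q w) (ℓ q z)
  linarith

theorem localRicci_prod_mixed (H : IsLocalFamily h ℓ q) (z : E) :
    localRicci (prodBilin h) q (0, z) (1, 0)
      = - h q (localCodiff (fun y => h (q.1, y)) (fun y => ℓ (q.1, y)) q.2) z
        - traceCLM E (fderiv ℝ ℓ q (0, z)) := by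
  rw [H.apply_localCodiff, ← traceCLM_covShape h ℓ q z, localRicci, traceCLM_prod,
    traceCLM_eq_sum, traceCLM_eq_sum, ← Finset.sum_sub_distrib]
  have h1 : (curvatureOp (prodBilin h) q (0, z) (1, 0) (1, 0)).1 = 0 := by
    simp [curvatureOp_apply, H.fderiv_christoffel_prod_normal, H.christoffel_prod]
  rw [h1, zero_add]
  refine Finset.sum_congr rfl fun i _ => ?_
  rw [← map_sub]
  congr 1
  simp only [ContinuousLinearMap.comp_apply, ContinuousLinearMap.inr_apply,
    ContinuousLinearMap.coe_snd', curvatureOp_apply, Prod.snd_add, Prod.snd_sub,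
    H.fderiv_christoffel_prod_normal, H.christoffel_prod, covShape, add_apply, sub_apply,
    map_zero, one_smul, zero_smul, add_zero, zero_add]
  rw [H.slice.christoffel_symm z (Module.finBasis ℝ E i)]
  module

theorem localRicci_prod_normal (H : IsLocalFamily h ℓ q) :
    localRicci (prodBilin h) q (1, 0) (1, 0)
      = - traceCLM E (fderiv ℝ ℓ q (1, 0)) - traceCLM E (ℓ q ∘L ℓ q) := by
  have h2 : ContinuousLinearMap.snd ℝ ℝ E ∘L curvatureOp (prodBilin h) q (1, 0) (1, 0)
        ∘L ContinuousLinearMap.inr ℝ ℝ E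
      = - fderiv ℝ ℓ q (1, 0) - ℓ q ∘L ℓ q := by
    ext x
    simp [curvatureOp_apply, H.fderiv_christoffel_prod_normal, H.christoffel_prod]
  rw [localRicci, traceCLM_prod, h2]
  simp [curvatureOp_apply]

theorem localSymCovDeriv_prod (H : IsLocalFamily h ℓ q) {ξ : ℝ → ℝ} {α : ℝ × E → E →L[ℝ] ℝ}
    (hξ : DifferentiableAt ℝ ξ q.1) (hα : DifferentiableAt ℝ α q) (u v : ℝ × E) :
    localSymCovDeriv (prodBilin h) (prodForm ξ α) q u v
      = localSymCovDeriv (fun y => h (q.1, y)) (fun y => α (q.1, y)) q.2 u.2 v.2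
        + ξ q.1 * h q (ℓ q u.2) v.2 + u.1 * v.1 * deriv ξ q.1
        + u.1 * ((1 / 2) * fderiv ℝ α q (1, 0) v.2 - α q (ℓ q v.2))
        + v.1 * ((1 / 2) * fderiv ℝ α q (1, 0) u.2 - α q (ℓ q u.2)) := by
  have hs : ∀ x, fderiv ℝ (fun y => α (q.1, y)) q.2 x = fderiv ℝ α q (0, x) := fun x => by
    rw [(hasFDerivAt_slice hα.hasFDerivAt).fderiv]; rfl
  have hd : DifferentiableAt ℝ (prodForm ξ α) q := by
    unfold prodForm
    exact ((hξ.comp q differentiableAt_fst).smul_const _).add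
      (hα.clm_comp (differentiableAt_const _))
  have key : ∀ u v, fderiv ℝ (prodForm ξ α) q u v
      = u.1 * v.1 * deriv ξ q.1 + u.1 * fderiv ℝ α q (1, 0) v.2
        + fderiv ℝ (fun y => α (q.1, y)) q.2 u.2 v.2 := by
    intro u v
    have d1 : HasFDerivAt (fun r : ℝ × E => ξ r.1 * v.1) _ q :=
      ((hξ.hasDerivAt.hasFDerivAt.comp q hasFDerivAt_fst).mul_const v.1)
    have d2 := d1.add (hα.hasFDerivAt.clm_apply_const v.2)
    have := congrArg (fun T => T u) ((hd.hasFDerivAt.clm_apply_const v).unique d2)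
    have hu : u = u.1 • ((1, 0) : ℝ × E) + (0, u.2) := by ext <;> simp
    have h3 : fderiv ℝ α q u = u.1 • fderiv ℝ α q (1, 0) + fderiv ℝ α q (0, u.2) := by
      conv_lhs => rw [hu]
      rw [map_add, map_smul]
    simp only [add_apply, ContinuousLinearMap.flip_apply, h3, smul_apply] at this
    rw [this, hs]
    simp
    ring
  simp only [localSymCovDeriv, key, H.christoffel_prod, prodForm_apply, map_add, map_smul,
    smul_eq_mul]
  rw [H.shape_symm v.2 u.2, H.symm.self_of_nhds v.2]
  ring

theorem soliton_expr_prod (H : IsLocalFamily h ℓ q) {ξ : ℝ → ℝ} {α : ℝ × E → E →L[ℝ] ℝ}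
    (hξ : DifferentiableAt ℝ ξ q.1) (hα : DifferentiableAt ℝ α q) (ε : ℝ) (u v : ℝ × E) :
    localRicci (prodBilin h) q u v + localSymCovDeriv (prodBilin h) (prodForm ξ α) q u v
        + ε / 2 * prodBilin h q u v
      = (localRicci (fun y => h (q.1, y)) q.2 u.2 v.2 - traceCLM E (ℓ q) * h q (ℓ q u.2) v.2
          - h q (fderiv ℝ ℓ q (1, 0) u.2) v.2 + ξ q.1 * h q (ℓ q u.2) v.2
          + localSymCovDeriv (fun y => h (q.1, y)) (fun y => α (q.1, y)) q.2 u.2 v.2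
          + ε / 2 * h q u.2 v.2)
        + u.1 * (- h q (localCodiff (fun y => h (q.1, y)) (fun y => ℓ (q.1, y)) q.2) v.2
          - traceCLM E (fderiv ℝ ℓ q (0, v.2)) + (1 / 2) * fderiv ℝ α q (1, 0) v.2
          - α q (ℓ q v.2))
        + v.1 * (- h q (localCodiff (fun y => h (q.1, y)) (fun y => ℓ (q.1, y)) q.2) u.2
          - traceCLM E (fderiv ℝ ℓ q (0, u.2)) + (1 / 2) * fderiv ℝ α q (1, 0) u.2
          - α q (ℓ q u.2))
        + u.1 * v.1 * (- traceCLM E (fderiv ℝ ℓ q (1, 0)) - traceCLM E (ℓ q ∘L ℓ q)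
          + deriv ξ q.1 + ε / 2) := by
  have hu : ∀ u : ℝ × E, u = u.1 • ((1, 0) : ℝ × E) + (0, u.2) := fun u => by ext <;> simp
  have hR : localRicci (prodBilin h) q u v
      = u.1 * v.1 * localRicci (prodBilin h) q (1, 0) (1, 0)
        + u.1 * localRicci (prodBilin h) q (0, v.2) (1, 0)
        + v.1 * localRicci (prodBilin h) q (0, u.2) (1, 0)
        + localRicci (prodBilin h) q (0, u.2) (0, v.2) := by
    have hL : ∀ u w, localRicci (prodBilin h) q u w = u.1 * localRicci (prodBilin h) q (1, 0) w
        + localRicci (prodBilin h) q (0, u.2) w := fun u w => by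
      conv_lhs => rw [hu u]
      rw [localRicci_add_left, localRicci_smul_left]
    rw [hL, H.prod.localRicci_symm _ v, H.prod.localRicci_symm _ v, hL v (1, 0), hL v,
      H.prod.localRicci_symm (1, 0) (0, u.2), H.prod.localRicci_symm (0, v.2) (0, u.2)]
    ring
  rw [hR, H.localRicci_prod_tangent, H.localRicci_prod_mixed, H.localRicci_prod_mixed,
    H.localRicci_prod_normal, H.localSymCovDeriv_prod hξ hα, prodBilin_apply]
  ring

end IsLocalFamily
end LocalProduct

section SmoothSections

variable {E : Type*} [NormedAddCommGroup E] [NormedSpace ℝ E] [FiniteDimensional ℝ E]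
  {H : Type*} [TopologicalSpace H] {I : ModelWithCorners ℝ E H}
  {M : Type*} [TopologicalSpace M] [ChartedSpace H M] [IsManifold I ∞ M]
  {EN : Type*} [NormedAddCommGroup EN] [NormedSpace ℝ EN]
  {HN : Type*} [TopologicalSpace HN] {IN : ModelWithCorners ℝ EN HN}
  {N : Type*} [TopologicalSpace N] [ChartedSpace HN N]
  {D : Type*} [NormedAddCommGroup D] [NormedSpace ℝ D]

theorem contMDiffAt_clm_of_apply {F F₂ : Type*}
    [NormedAddCommGroup F] [NormedSpace ℝ F] [FiniteDimensional ℝ F] [NormedAddCommGroup F₂]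
    [NormedSpace ℝ F₂] {n : WithTop ℕ∞} {f : N → F →L[ℝ] F₂} {x : N}
    (hf : ∀ v, ContMDiffAt IN 𝓘(ℝ, F₂) n (fun z => f z v) x) :
    ContMDiffAt IN 𝓘(ℝ, F →L[ℝ] F₂) n f x := by
  let d := Module.finrank ℝ F
  have hd : d = Module.finrank ℝ (Fin d → ℝ) := (Module.finrank_fin_fun ℝ).symm
  let e₁ := ContinuousLinearEquiv.ofFinrankEq hd
  let e₂ := (e₁.arrowCongr (1 : F₂ ≃L[ℝ] F₂)).trans (ContinuousLinearEquiv.piRing (Fin d))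
  rw [← id_comp f, ← e₂.symm_comp_self]
  exact e₂.symm.contDiff.comp_contMDiffAt (contMDiffAt_pi_space.mpr fun i => hf _)

theorem contMDiffAt_bilin_apply {n : WithTop ℕ∞} {b : N → M}
    {B : ∀ z, TangentSpace I (b z) →L[ℝ] TangentSpace I (b z) →L[ℝ] ℝ}
    {V W : ∀ z, TangentSpace I (b z)} {z₀ : N}
    (hB : ContMDiffAt IN (I.prod 𝓘(ℝ, E →L[ℝ] E →L[ℝ] ℝ)) n
      (fun z ↦ TotalSpace.mk' (E →L[ℝ] E →L[ℝ] ℝ)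
        (E := fun x : M => TangentSpace I x →L[ℝ] TangentSpace I x →L[ℝ] ℝ) (b z) (B z)) z₀)
    (hV : ContMDiffAt IN I.tangent n (fun z => (⟨b z, V z⟩ : TangentBundle I M)) z₀)
    (hW : ContMDiffAt IN I.tangent n (fun z => (⟨b z, W z⟩ : TangentBundle I M)) z₀) :
    ContMDiffAt IN 𝓘(ℝ, ℝ) n (fun z => B z (V z) (W z)) z₀ := by
  have : ContMDiffAt IN (I.prod 𝓘(ℝ)) n
      (fun m ↦ TotalSpace.mk' ℝ (E := Bundle.Trivial M ℝ) (b m) (B m (V m) (W m))) z₀ := by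
    apply ContMDiffAt.clm_bundle_apply₂ (F₁ := E) (F₂ := E)
    · exact hB
    · exact hV
    · exact hW
  simp only [contMDiffAt_totalSpace] at this
  exact this.2

theorem contMDiffAt_form_apply {n : WithTop ℕ∞} {b : N → M}
    {B : ∀ z, TangentSpace I (b z) →L[ℝ] ℝ} {V : ∀ z, TangentSpace I (b z)} {z₀ : N}
    (hB : ContMDiffAt IN (I.prod 𝓘(ℝ, E →L[ℝ] ℝ)) n
      (fun z ↦ TotalSpace.mk' (E →L[ℝ] ℝ) (E := fun x : M => TangentSpace I x →L[ℝ] ℝ)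
        (b z) (B z)) z₀)
    (hV : ContMDiffAt IN I.tangent n (fun z => (⟨b z, V z⟩ : TangentBundle I M)) z₀) :
    ContMDiffAt IN 𝓘(ℝ, ℝ) n (fun z => B z (V z)) z₀ := by
  have : ContMDiffAt IN (I.prod 𝓘(ℝ)) n
      (fun m ↦ TotalSpace.mk' ℝ (E := Bundle.Trivial M ℝ) (b m) (B m (V m))) z₀ := by
    apply ContMDiffAt.clm_bundle_apply (F₁ := E)
    · exact hB
    · exact hV
  simp only [contMDiffAt_totalSpace] at this
  exact this.2

theorem contMDiffAt_mfderiv_const {m n : WithTop ℕ∞} {f : D → M} {y : D}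
    (hf : ContMDiffAt 𝓘(ℝ, D) I n f y) (hmn : m + 1 ≤ n) (u : D) :
    ContMDiffAt 𝓘(ℝ, D) I.tangent m
      (fun z => (⟨f z, mfderiv 𝓘(ℝ, D) I f z u⟩ : TangentBundle I M)) y := by
  have h1 := hf.mfderiv_const hmn
  have hv : ContMDiffAt 𝓘(ℝ, D) 𝓘(ℝ, D).tangent m
      (fun z => (⟨z, u⟩ : TangentBundle 𝓘(ℝ, D) D)) y := by
    rw [contMDiffAt_totalSpace]
    refine ⟨contMDiffAt_id, ?_⟩
    simp
    exact contMDiffAt_const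
  exact h1.clm_apply_of_inCoordinates hv (hf.of_le (le_self_add.trans hmn))

theorem eventually_mem_chart_source {b : N → M} {z₀ : N} (hb : ContinuousAt b z₀) :
    ∀ᶠ z in 𝓝 z₀, b z ∈ (chartAt H (b z₀)).source :=
  hb.eventually ((chartAt H (b z₀)).open_source.mem_nhds (mem_chart_source H _))

theorem trivializationAt_symm_eq_mfderiv [I.Boundaryless] {x₀ x : M}
    (hx : x ∈ (chartAt H x₀).source) (u : E) :
    (trivializationAt E (fun x : M => TangentSpace I x) x₀).symm x u
      = mfderiv 𝓘(ℝ, E) I (extChartAt I x₀).symm (extChartAt I x₀ x) u := by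
  have h2 := TangentBundle.symmL_trivializationAt (I := I) (𝕜 := ℝ) hx
  rw [I.range_eq_univ, mfderivWithin_univ] at h2
  exact ((trivializationAt E (fun x : M => TangentSpace I x) x₀).symmL_apply
    (by simpa using hx) u).symm.trans (congrArg (fun T => T u) h2)

theorem contMDiffAt_bilin_of_chart [I.Boundaryless] {n : WithTop ℕ∞} {b : N → M}
    {B : ∀ z, TangentSpace I (b z) →L[ℝ] TangentSpace I (b z) →L[ℝ] ℝ} {z₀ : N}
    (hb : ContMDiffAt IN I n b z₀)
    (hB : ∀ u v : E, ContMDiffAt IN 𝓘(ℝ, ℝ) n (fun z => B z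
      (mfderiv 𝓘(ℝ, E) I (extChartAt I (b z₀)).symm (extChartAt I (b z₀) (b z)) u)
      (mfderiv 𝓘(ℝ, E) I (extChartAt I (b z₀)).symm (extChartAt I (b z₀) (b z)) v)) z₀) :
    ContMDiffAt IN (I.prod 𝓘(ℝ, E →L[ℝ] E →L[ℝ] ℝ)) n
      (fun z ↦ TotalSpace.mk' (E →L[ℝ] E →L[ℝ] ℝ)
        (E := fun x : M => TangentSpace I x →L[ℝ] TangentSpace I x →L[ℝ] ℝ) (b z) (B z)) z₀ := by
  rw [contMDiffAt_hom_bundle]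
  refine ⟨hb, contMDiffAt_clm_of_apply fun u => contMDiffAt_clm_of_apply fun v => ?_⟩
  refine (hB u v).congr_of_eventuallyEq ?_
  filter_upwards [eventually_mem_chart_source (H := H) hb.continuousAt] with z hz
  have h4 : ∀ c : ℝ, (trivializationAt ℝ (Bundle.Trivial M ℝ) (b z₀)).linearMapAt ℝ (b z) c = c :=
    fun c => by simp
  have h1 := inCoordinates_apply_eq₂ (F₁ := E) (F₂ := E) (F₃ := ℝ) (E₁ := fun x : M => TangentSpace I x)
    (E₂ := fun x : M => TangentSpace I x) (E₃ := Bundle.Trivial M ℝ) (𝕜 := ℝ) (x₀ := b z₀)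
    (x := b z) (ϕ := B z) (v := u) (w := v) (by simpa using hz) (by simpa using hz) (by simp)
  exact (h1.trans (h4 _)).trans (congrArg₂ (fun a c => B z a c) (trivializationAt_symm_eq_mfderiv hz u)
    (trivializationAt_symm_eq_mfderiv hz v))

theorem contMDiffAt_form_of_chart [I.Boundaryless] {n : WithTop ℕ∞} {b : N → M}
    {B : ∀ z, TangentSpace I (b z) →L[ℝ] ℝ} {z₀ : N} (hb : ContMDiffAt IN I n b z₀)
    (hB : ∀ u : E, ContMDiffAt IN 𝓘(ℝ, ℝ) n (fun z => B z
      (mfderiv 𝓘(ℝ, E) I (extChartAt I (b z₀)).symm (extChartAt I (b z₀) (b z)) u)) z₀) :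
    ContMDiffAt IN (I.prod 𝓘(ℝ, E →L[ℝ] ℝ)) n
      (fun z ↦ TotalSpace.mk' (E →L[ℝ] ℝ) (E := fun x : M => TangentSpace I x →L[ℝ] ℝ)
        (b z) (B z)) z₀ := by
  rw [contMDiffAt_hom_bundle]
  refine ⟨hb, contMDiffAt_clm_of_apply fun u => ?_⟩
  refine (hB u).congr_of_eventuallyEq ?_
  filter_upwards [eventually_mem_chart_source (H := H) hb.continuousAt] with z hz
  have h1 := ContinuousLinearMap.inCoordinates_eq (σ := RingHom.id ℝ) (F := E) (F' := ℝ)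
    (E := fun x : M => TangentSpace I x) (E' := Bundle.Trivial M ℝ) (x₀ := b z₀) (x := b z)
    (y₀ := b z₀) (y := b z) (ϕ := B z) (by simpa using hz) (by simp)
  refine (congrArg (fun T => T u) h1).trans ?_
  simp only [ContinuousLinearMap.comp_apply]
  refine Eq.trans ?_ (congrArg (fun a => B z a) (trivializationAt_symm_eq_mfderiv hz u))
  simp

end SmoothSections

section Pullback

variable {V W : Type*} [NormedAddCommGroup V] [NormedSpace ℝ V] [NormedAddCommGroup W]
  [NormedSpace ℝ W]

theorem isInvertible_pullBilin {A : V →L[ℝ] W} {B : W →L[ℝ] W →L[ℝ] ℝ} (hA : A.IsInvertible)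
    (hB : B.IsInvertible) : (pullBilin A B).IsInvertible := by
  have h : (ContinuousLinearMap.precomp ℝ A : (W →L[ℝ] ℝ) →L[ℝ] (V →L[ℝ] ℝ)).IsInvertible := by
    obtain ⟨e, rfl⟩ := hA
    exact ⟨e.symm.arrowCongr (ContinuousLinearEquiv.refl ℝ ℝ), by ext; simp⟩
  exact h.comp (hB.comp hA)

theorem inverse_pullBilin_apply {A : V →L[ℝ] W} {B : W →L[ℝ] W →L[ℝ] ℝ} (hA : A.IsInvertible)
    (hB : B.IsInvertible) (φ : W →L[ℝ] ℝ) :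
    (pullBilin A B).inverse (φ ∘L A) = A.inverse (B.inverse φ) := by
  rw [(isInvertible_pullBilin hA hB).inverse_apply_eq]
  ext v
  simp [pullBilin_apply, hA.self_apply_inverse, hB.self_apply_inverse]

end Pullback

section Parametrization

variable {E : Type*} [NormedAddCommGroup E] [NormedSpace ℝ E] [FiniteDimensional ℝ E]
  {H : Type*} [TopologicalSpace H] {I : ModelWithCorners ℝ E H} [I.Boundaryless]
  {M : Type*} [TopologicalSpace M] [ChartedSpace H M] [IsManifold I ∞ M]
  {D : Type*} [NormedAddCommGroup D] [NormedSpace ℝ D] [FiniteDimensional ℝ D]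

variable (I) in
/-- `g` is a nondegenerate symmetric bilinear field of class `C²` near `x`. -/
structure IsMetricAt (g : BilinField I M) (x : M) : Prop where
  contMDiffAt : ContMDiffAt I (I.prod 𝓘(ℝ, E →L[ℝ] E →L[ℝ] ℝ)) 2
    (fun x ↦ TotalSpace.mk' (E →L[ℝ] E →L[ℝ] ℝ)
      (E := fun x : M => TangentSpace I x →L[ℝ] TangentSpace I x →L[ℝ] ℝ) x (g x)) x
  symm : ∀ᶠ z in 𝓝 x, ∀ u v : TangentSpace I z, g z u v = g z v u
  inv : ∀ᶠ z in 𝓝 x, (g z).IsInvertible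

variable (I) in
/-- `α` is a `1`-form of class `C¹` at `x`. -/
def IsFormAt (α : OneForm I M) (x : M) : Prop :=
  ContMDiffAt I (I.prod 𝓘(ℝ, E →L[ℝ] ℝ)) 1
    (fun x ↦ TotalSpace.mk' (E →L[ℝ] ℝ) (E := fun x : M => TangentSpace I x →L[ℝ] ℝ) x (α x)) x

variable (I) in
/-- The pullback of a field of bilinear forms by a map from a vector space. -/
def pullMetric (ψ : D → M) (g : BilinField I M) (y : D) : D →L[ℝ] D →L[ℝ] ℝ :=
  pullBilin (V := D) (mfderiv 𝓘(ℝ, D) I ψ y) (g (ψ y))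

variable (I) in
/-- The pullback of a `1`-form by a map from a vector space. -/
def pullForm (ψ : D → M) (α : OneForm I M) (y : D) : D →L[ℝ] ℝ :=
  (α (ψ y)) ∘L (mfderiv 𝓘(ℝ, D) I ψ y)

theorem contDiffAt_pullMetric {m n : WithTop ℕ∞} {ψ : D → M} {y : D} {g : BilinField I M}
    (hψ : ContMDiffAt 𝓘(ℝ, D) I n ψ y) (hmn : m + 1 ≤ n)
    (hg : ContMDiffAt I (I.prod 𝓘(ℝ, E →L[ℝ] E →L[ℝ] ℝ)) m
      (fun x ↦ TotalSpace.mk' (E →L[ℝ] E →L[ℝ] ℝ)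
        (E := fun x : M => TangentSpace I x →L[ℝ] TangentSpace I x →L[ℝ] ℝ) x (g x)) (ψ y)) :
    ContDiffAt ℝ m (pullMetric I ψ g) y := by
  refine contDiffAt_clm_of_apply fun u => contDiffAt_clm_of_apply fun v => ?_
  rw [← contMDiffAt_iff_contDiffAt]
  exact contMDiffAt_bilin_apply (b := ψ) (B := fun z => g (ψ z))
    (V := fun z => mfderiv 𝓘(ℝ, D) I ψ z u) (W := fun z => mfderiv 𝓘(ℝ, D) I ψ z v)
    (hg.comp y (hψ.of_le (le_self_add.trans hmn)))
    (contMDiffAt_mfderiv_const hψ hmn u) (contMDiffAt_mfderiv_const hψ hmn v)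

theorem contDiffAt_pullForm {m n : WithTop ℕ∞} {ψ : D → M} {y : D} {α : OneForm I M}
    (hψ : ContMDiffAt 𝓘(ℝ, D) I n ψ y) (hmn : m + 1 ≤ n)
    (hα : ContMDiffAt I (I.prod 𝓘(ℝ, E →L[ℝ] ℝ)) m
      (fun x ↦ TotalSpace.mk' (E →L[ℝ] ℝ) (E := fun x : M => TangentSpace I x →L[ℝ] ℝ) x (α x))
      (ψ y)) :
    ContDiffAt ℝ m (pullForm I ψ α) y := by
  refine contDiffAt_clm_of_apply fun u => ?_
  rw [← contMDiffAt_iff_contDiffAt]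
  exact contMDiffAt_form_apply (b := ψ) (B := fun z => α (ψ z))
    (V := fun z => mfderiv 𝓘(ℝ, D) I ψ z u) (hα.comp y (hψ.of_le (le_self_add.trans hmn)))
    (contMDiffAt_mfderiv_const hψ hmn u)

theorem contMDiffAt_extChartAt_symm_of_mem {n : WithTop ℕ∞} [IsManifold I n M] {x : M} {z : E}
    (hz : z ∈ (extChartAt I x).target) :
    ContMDiffAt 𝓘(ℝ, E) I n (extChartAt I x).symm z :=
  (contMDiffOn_extChartAt_symm x).contMDiffAt
    ((isOpen_extChartAt_target x).mem_nhds hz)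

theorem mfderiv_extChartAt_symm_comp {x w : M} (hw : w ∈ (extChartAt I x).source) :
    (mfderiv 𝓘(ℝ, E) I (extChartAt I x).symm (extChartAt I x w))
      ∘L (mfderiv I 𝓘(ℝ, E) (extChartAt I x) w) = ContinuousLinearMap.id ℝ _ := by
  have := mfderivWithin_extChartAt_symm_comp_mfderiv_extChartAt' (I := I) (x := x) hw
  rwa [I.range_eq_univ, mfderivWithin_univ] at this

theorem isInvertible_mfderiv_extChartAt_symm {x : M} {z : E} (hz : z ∈ (extChartAt I x).target) :
    (mfderiv 𝓘(ℝ, E) I (extChartAt I x).symm z).IsInvertible := by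
  have := isInvertible_mfderivWithin_extChartAt_symm (I := I) hz
  rwa [I.range_eq_univ, mfderivWithin_univ] at this

/-- `ψ` is a `C³` local diffeomorphism near `y`. -/
structure IsParam (I : ModelWithCorners ℝ E H) (ψ : D → M) (y : D) : Prop where
  contMDiffAt : ContMDiffAt 𝓘(ℝ, D) I 3 ψ y
  inv : (mfderiv 𝓘(ℝ, D) I ψ y).IsInvertible

theorem isParam_extChartAt_symm {x : M} {z : E} (hz : z ∈ (extChartAt I x).target) :
    IsParam I (extChartAt I x).symm z where
  contMDiffAt := (contMDiffAt_extChartAt_symm_of_mem (n := ∞) hz).of_le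
    ENat.LEInfty.out
  inv := isInvertible_mfderiv_extChartAt_symm hz

theorem eventually_extChartAt_symm {p : M → Prop} {x : M} (hp : ∀ᶠ z in 𝓝 x, p z) :
    ∀ᶠ z in 𝓝 (extChartAt I x x), p ((extChartAt I x).symm z) := by
  refine (continuousAt_extChartAt_symm x).eventually ?_
  rwa [extChartAt_to_inv]

theorem IsMetricAt.isLocalMetric {g : BilinField I M} {x : M} (hg : IsMetricAt I g x) :
    IsLocalMetric (chartBilin I g x) (extChartAt I x x) where
  contDiffAt := by
    refine contDiffAt_pullMetric (isParam_extChartAt_symm (mem_extChartAt_target x)).contMDiffAt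
      (by norm_num) ?_
    rw [extChartAt_to_inv]
    exact hg.contMDiffAt
  symm := by
    filter_upwards [eventually_extChartAt_symm hg.symm] with z hz u v
    exact hz _ _
  inv := isInvertible_pullBilin (V := E) (W := E)
      (isInvertible_mfderiv_extChartAt_symm (mem_extChartAt_target x))
      (eventually_extChartAt_symm hg.inv).self_of_nhds

theorem IsFormAt.differentiableAt {α : OneForm I M} {x : M} (hα : IsFormAt I α x) :
    DifferentiableAt ℝ (chartOneForm I α x) (extChartAt I x x) := by
  refine (contDiffAt_pullForm (m := 1)
    (isParam_extChartAt_symm (mem_extChartAt_target x)).contMDiffAt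
    (by norm_num) ?_).differentiableAt (by simp)
  rw [extChartAt_to_inv]
  exact hα

namespace IsParam

variable {ψ : D → M} {y : D}

theorem eventually_contMDiffAt (hψ : IsParam I ψ y) :
    ∀ᶠ z in 𝓝 y, ContMDiffAt 𝓘(ℝ, D) I 3 ψ z :=
  (contMDiffAt_iff_contMDiffAt_nhds (by simp)).1 hψ.contMDiffAt

theorem eventually_fderiv (hψ : IsParam I ψ y) : ∀ᶠ z in 𝓝 y,
    ψ z ∈ (extChartAt I (ψ y)).source ∧
    fderiv ℝ (extChartAt I (ψ y) ∘ ψ) z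
      = (mfderiv I 𝓘(ℝ, E) (extChartAt I (ψ y)) (ψ z)) ∘L (mfderiv 𝓘(ℝ, D) I ψ z) := by
  filter_upwards [hψ.eventually_contMDiffAt, eventually_mem_chart_source (H := H)
    hψ.contMDiffAt.continuousAt] with z hz hz'
  refine ⟨by simpa using hz', ?_⟩
  rw [← mfderiv_eq_fderiv]
  exact mfderiv_comp z (mdifferentiableAt_extChartAt hz') (hz.mdifferentiableAt (by simp))

theorem fderiv_chart (hψ : IsParam I ψ y) (u : D) :
    fderiv ℝ (extChartAt I (ψ y) ∘ ψ) y u = mfderiv 𝓘(ℝ, D) I ψ y u := by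
  rw [hψ.eventually_fderiv.self_of_nhds.2, mfderiv_extChartAt_self]
  rfl

theorem eventually_mfderiv_symm (hψ : IsParam I ψ y) : ∀ᶠ z in 𝓝 y, ∀ u : D,
    mfderiv 𝓘(ℝ, E) I (extChartAt I (ψ y)).symm (extChartAt I (ψ y) (ψ z))
      (fderiv ℝ (extChartAt I (ψ y) ∘ ψ) z u) = mfderiv 𝓘(ℝ, D) I ψ z u := by
  filter_upwards [hψ.eventually_fderiv] with z hz u
  rw [hz.2]
  exact congrArg (fun T => T (mfderiv 𝓘(ℝ, D) I ψ z u)) (mfderiv_extChartAt_symm_comp hz.1)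

theorem isLocalIsometry (hψ : IsParam I ψ y) {g : BilinField I M} (hg : IsMetricAt I g (ψ y)) :
    IsLocalIsometry (extChartAt I (ψ y) ∘ ψ) (pullMetric I ψ g) (chartBilin I g (ψ y)) y where
  contDiffAt := by
    rw [← contMDiffAt_iff_contDiffAt]
    exact contMDiffAt_extChartAt.comp y hψ.contMDiffAt
  inv := by
    have : fderiv ℝ (extChartAt I (ψ y) ∘ ψ) y = mfderiv 𝓘(ℝ, D) I ψ y := by
      ext u; exact hψ.fderiv_chart u
    rw [this]
    exact hψ.inv
  metric := hg.isLocalMetric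
  eq := by
    filter_upwards [hψ.eventually_mfderiv_symm, hψ.eventually_fderiv] with z hz hz' u v
    have h1 : ∀ w : M, w = ψ z → ∀ a b : E, a = mfderiv 𝓘(ℝ, D) I ψ z u →
        b = mfderiv 𝓘(ℝ, D) I ψ z v → pullMetric I ψ g z u v = g w a b := by
      rintro w rfl a b rfl rfl
      rfl
    exact h1 _ ((extChartAt I (ψ y)).left_inv hz'.1) _ _ (hz u) (hz v)

theorem eventually_pullForm (hψ : IsParam I ψ y) (α : OneForm I M) : ∀ᶠ z in 𝓝 y, ∀ u : D,
    pullForm I ψ α z u = chartOneForm I α (ψ y) ((extChartAt I (ψ y) ∘ ψ) z)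
      (fderiv ℝ (extChartAt I (ψ y) ∘ ψ) z u) := by
  filter_upwards [hψ.eventually_mfderiv_symm, hψ.eventually_fderiv] with z hz hz' u
  have h1 : ∀ w : M, w = ψ z → ∀ a : E, a = mfderiv 𝓘(ℝ, D) I ψ z u →
      pullForm I ψ α z u = α w a := by
    rintro w rfl a rfl
    rfl
  exact h1 _ ((extChartAt I (ψ y)).left_inv hz'.1) _ (hz u)

theorem dChart_mfderiv (hψ : IsParam I ψ y) (u : D) :
    dChart I (ψ y) (mfderiv 𝓘(ℝ, D) I ψ y u) = fderiv ℝ (extChartAt I (ψ y) ∘ ψ) y u := by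
  rw [hψ.eventually_fderiv.self_of_nhds.2]
  rfl

/-- Naturality of the Ricci tensor. -/
theorem ricci_eq (hψ : IsParam I ψ y) {g : BilinField I M} (hg : IsMetricAt I g (ψ y)) (u v : D) :
    ricci I g (ψ y) (mfderiv 𝓘(ℝ, D) I ψ y u) (mfderiv 𝓘(ℝ, D) I ψ y v)
      = localRicci (pullMetric I ψ g) y u v := by
  rw [(hψ.isLocalIsometry hg).localRicci_map, ricci]
  exact congrArg₂ _ (hψ.dChart_mfderiv u) (hψ.dChart_mfderiv v)

/-- Naturality of the symmetrized covariant derivative. -/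
theorem symCovDeriv_eq (hψ : IsParam I ψ y) {g : BilinField I M} (hg : IsMetricAt I g (ψ y))
    {α : OneForm I M} (hα : IsFormAt I α (ψ y)) (u v : D) :
    symCovDeriv I g α (ψ y) (mfderiv 𝓘(ℝ, D) I ψ y u) (mfderiv 𝓘(ℝ, D) I ψ y v)
      = localSymCovDeriv (pullMetric I ψ g) (pullForm I ψ α) y u v := by
  rw [(hψ.isLocalIsometry hg).localSymCovDeriv_map hα.differentiableAt (hψ.eventually_pullForm α),
    symCovDeriv]
  exact congrArg₂ _ (hψ.dChart_mfderiv u) (hψ.dChart_mfderiv v)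

end IsParam

theorem lieDeriv_dualField {g : BilinField I M} {x : M} (hg : IsMetricAt I g x)
    {α : OneForm I M} (hα : IsFormAt I α x) (u v : TangentSpace I x) :
    (1 / 2) * lieDeriv I g (dualField I g α) x u v = symCovDeriv I g α x u v := by
  refine hg.isLocalMetric.localLieDeriv_eq hα.differentiableAt ?_ _ _
  filter_upwards [eventually_extChartAt_symm hg.inv,
    (isOpen_extChartAt_target (I := I) x).mem_nhds (mem_extChartAt_target x)] with z hz hz'
  exact (inverse_pullBilin_apply (V := E) (W := E) (isInvertible_mfderiv_extChartAt_symm hz') hz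
    (α ((extChartAt I x).symm z))).symm

/-- Naturality of the Ricci soliton equation. -/
theorem IsParam.soliton_eq {ψ : D → M} {y : D} (hψ : IsParam I ψ y) {g : BilinField I M}
    (hg : IsMetricAt I g (ψ y)) {α : OneForm I M} (hα : IsFormAt I α (ψ y)) (ε : ℝ) :
    (∀ u v : TangentSpace I (ψ y), ricci I g (ψ y) u v
        + (1 / 2) * lieDeriv I g (dualField I g α) (ψ y) u v + (ε / 2) * g (ψ y) u v = 0) ↔
      ∀ u v : D, localRicci (pullMetric I ψ g) y u v
        + localSymCovDeriv (pullMetric I ψ g) (pullForm I ψ α) y u v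
        + ε / 2 * pullMetric I ψ g y u v = 0 := by
  have e : ∀ u v : D, ricci I g (ψ y) (mfderiv 𝓘(ℝ, D) I ψ y u) (mfderiv 𝓘(ℝ, D) I ψ y v)
      + symCovDeriv I g α (ψ y) (mfderiv 𝓘(ℝ, D) I ψ y u) (mfderiv 𝓘(ℝ, D) I ψ y v)
      + (ε / 2) * g (ψ y) (mfderiv 𝓘(ℝ, D) I ψ y u) (mfderiv 𝓘(ℝ, D) I ψ y v)
      = localRicci (pullMetric I ψ g) y u v
        + localSymCovDeriv (pullMetric I ψ g) (pullForm I ψ α) y u v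
        + ε / 2 * pullMetric I ψ g y u v := fun u v => by
    rw [hψ.ricci_eq hg, hψ.symCovDeriv_eq hg hα]
    rfl
  simp only [lieDeriv_dualField hg hα]
  constructor
  · intro h u v
    exact (e u v).symm.trans (h _ _)
  · intro h u v
    obtain ⟨u, rfl⟩ := hψ.inv.surjective u
    obtain ⟨v, rfl⟩ := hψ.inv.surjective v
    exact (e u v).trans (h u v)

end Parametrization

section LocalCongr

variable {E : Type*} [NormedAddCommGroup E] [NormedSpace ℝ E]

theorem christoffel_congr {h h' : E → E →L[ℝ] E →L[ℝ] ℝ} {y : E} (e : h =ᶠ[𝓝 y] h') :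
    christoffel h =ᶠ[𝓝 y] christoffel h' := by
  filter_upwards [e.eventuallyEq_nhds] with z hz
  simp only [christoffel, koszul, hz.fderiv_eq, hz.self_of_nhds]

theorem localRicci_congr {h h' : E → E →L[ℝ] E →L[ℝ] ℝ} {y : E} (e : h =ᶠ[𝓝 y] h') :
    localRicci h y = localRicci h' y := by
  have := christoffel_congr e
  ext v w
  simp only [localRicci, curvatureOp, this.fderiv_eq, this.self_of_nhds]

theorem localSymCovDeriv_congr {h h' : E → E →L[ℝ] E →L[ℝ] ℝ} {α α' : E → E →L[ℝ] ℝ} {y : E}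
    (e : h =ᶠ[𝓝 y] h') (eα : α =ᶠ[𝓝 y] α') :
    localSymCovDeriv h α y = localSymCovDeriv h' α' y := by
  have := christoffel_congr e
  ext v w
  simp only [localSymCovDeriv, eα.fderiv_eq, eα.self_of_nhds, this.self_of_nhds]

end LocalCongr

section Family

variable {E : Type*} [NormedAddCommGroup E] [NormedSpace ℝ E] [FiniteDimensional ℝ E]
  {H : Type*} [TopologicalSpace H] {I : ModelWithCorners ℝ E H} [I.Boundaryless]
  {P : Type*} [TopologicalSpace P] [ChartedSpace H P] [IsManifold I ∞ P]
  {G : Type*} [Group G] [MulAction G P]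

theorem mfderiv_extChartAt_symm_self (x : P) (u : E) :
    mfderiv 𝓘(ℝ, E) I (extChartAt I x).symm (extChartAt I x x) u = u := by
  have := mfderivWithin_range_extChartAt_symm (I := I) (x := x)
  rw [I.range_eq_univ, mfderivWithin_univ] at this
  exact congrArg (fun T : E →L[ℝ] E => T u) this

theorem chartBilin_self (g : BilinField I P) (x : P) :
    chartBilin I g x (extChartAt I x x) = g x := by
  have h1 : ∀ w : P, w = x → ∀ A : E →L[ℝ] E, (∀ u, A u = u) → pullBilin (V := E) A (g w) = g x := by
    rintro w rfl A hA
    ext u v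
    exact congrArg₂ (fun a b => g w a b) (hA u) (hA v)
  exact h1 _ (extChartAt_to_inv x) _ (mfderiv_extChartAt_symm_self x)

theorem chartOneForm_self (α : OneForm I P) (x : P) :
    chartOneForm I α x (extChartAt I x x) = α x := by
  have h1 : ∀ w : P, w = x → ∀ A : E →L[ℝ] E, (∀ u, A u = u) → (α w : E →L[ℝ] ℝ) ∘L A = α x := by
    rintro w rfl A hA
    ext u
    exact congrArg (fun a => α w a) (hA u)
  exact h1 _ (extChartAt_to_inv x) _ (mfderiv_extChartAt_symm_self x)

theorem chartEnd_self (L : EndField I P) (x : P) :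
    chartEnd I L x (extChartAt I x x) = L x := by
  have h1 : ∀ w : P, w = x → ∀ A : E →L[ℝ] E, (∀ u, A u = u) →
      A.inverse ∘L (L w : E →L[ℝ] E) ∘L A = L x := by
    rintro w rfl A hA
    have : A = ContinuousLinearMap.id ℝ E := by ext u; exact hA u
    subst this
    rw [ContinuousLinearMap.inverse_id]
    rfl
  exact h1 _ (extChartAt_to_inv x) _ (mfderiv_extChartAt_symm_self x)

variable (I) in
/-- The expression of a family of bilinear forms in the chart at `p`. -/
def famBilin (g : ℝ → BilinField I P) (p : P) (q : ℝ × E) : E →L[ℝ] E →L[ℝ] ℝ :=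
  chartBilin I (g q.1) p q.2

variable (I) in
/-- The expression of a family of `1`-forms in the chart at `p`. -/
def famForm (α : ℝ → OneForm I P) (p : P) (q : ℝ × E) : E →L[ℝ] ℝ :=
  chartOneForm I (α q.1) p q.2

variable (I) in
/-- The expression of a family of endomorphism fields in the chart at `p`. -/
def famEnd (L : ℝ → EndField I P) (p : P) (q : ℝ × E) : E →L[ℝ] E :=
  chartEnd I (L q.1) p q.2

variable {J : Set ℝ} {g : ℝ → BilinField I P} {α : ℝ → OneForm I P} {L : ℝ → EndField I P}

theorem contMDiffAt_famParam {p : P} {s : ℝ} {y : E} (hy : y ∈ (extChartAt I p).target) :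
    ContMDiffAt 𝓘(ℝ, ℝ × E) (𝓘(ℝ, ℝ).prod I) ∞
      (fun q : ℝ × E => (q.1, (extChartAt I p).symm q.2)) (s, y) := by
  refine ContMDiffAt.prodMk contDiff_fst.contDiffAt.contMDiffAt ?_
  exact ContMDiffAt.comp (g := (extChartAt I p).symm) (s, y)
    (contMDiffAt_extChartAt_symm_of_mem hy) contDiff_snd.contDiffAt.contMDiffAt

theorem contMDiffAt_famField {p : P} {s : ℝ} {y : E} (hy : y ∈ (extChartAt I p).target) (u : E) :
    ContMDiffAt 𝓘(ℝ, ℝ × E) I.tangent ∞ (fun q : ℝ × E =>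
      (⟨(extChartAt I p).symm q.2, mfderiv 𝓘(ℝ, E) I (extChartAt I p).symm q.2 u⟩ :
        TangentBundle I P)) (s, y) :=
  ContMDiffAt.comp (g := fun y : E => (⟨(extChartAt I p).symm y,
      mfderiv 𝓘(ℝ, E) I (extChartAt I p).symm y u⟩ : TangentBundle I P)) (s, y)
    (contMDiffAt_mfderiv_const (n := ∞) (contMDiffAt_extChartAt_symm_of_mem hy) (by simp) u)
    contDiff_snd.contDiffAt.contMDiffAt

theorem contDiffAt_famBilin (hJ : IsOpen J) (hg : IsInvariantMetricFamily I G J g) {p : P}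
    {s : ℝ} (hs : s ∈ J) {y : E} (hy : y ∈ (extChartAt I p).target) :
    ContDiffAt ℝ ∞ (famBilin I g p) (s, y) := by
  refine contDiffAt_clm_of_apply fun u => contDiffAt_clm_of_apply fun v => ?_
  rw [← contMDiffAt_iff_contDiffAt]
  have h1 := (hg.smooth.contMDiffAt ((hJ.prod isOpen_univ).mem_nhds
    (show (s, (extChartAt I p).symm y) ∈ J ×ˢ univ from ⟨hs, mem_univ _⟩))).comp (s, y)
      (contMDiffAt_famParam hy)
  exact contMDiffAt_bilin_apply (b := fun q : ℝ × E => (extChartAt I p).symm q.2)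
    (B := fun q => g q.1 ((extChartAt I p).symm q.2))
    (V := fun q => mfderiv 𝓘(ℝ, E) I (extChartAt I p).symm q.2 u)
    (W := fun q => mfderiv 𝓘(ℝ, E) I (extChartAt I p).symm q.2 v)
    h1 (contMDiffAt_famField hy u) (contMDiffAt_famField hy v)

theorem contDiffAt_famForm (hJ : IsOpen J) (hα : IsInvariantOneFormFamily I G J α) {p : P}
    {s : ℝ} (hs : s ∈ J) {y : E} (hy : y ∈ (extChartAt I p).target) :
    ContDiffAt ℝ ∞ (famForm I α p) (s, y) := by
  refine contDiffAt_clm_of_apply fun u => ?_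
  rw [← contMDiffAt_iff_contDiffAt]
  have h1 := (hα.smooth.contMDiffAt ((hJ.prod isOpen_univ).mem_nhds
    (show (s, (extChartAt I p).symm y) ∈ J ×ˢ univ from ⟨hs, mem_univ _⟩))).comp (s, y)
      (contMDiffAt_famParam hy)
  exact contMDiffAt_form_apply (b := fun q : ℝ × E => (extChartAt I p).symm q.2)
    (B := fun q => α q.1 ((extChartAt I p).symm q.2))
    (V := fun q => mfderiv 𝓘(ℝ, E) I (extChartAt I p).symm q.2 u)
    h1 (contMDiffAt_famField hy u)

theorem isInvertible_of_pos {V : Type*} [NormedAddCommGroup V] [NormedSpace ℝ V]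
    [FiniteDimensional ℝ V] {B : V →L[ℝ] V →L[ℝ] ℝ} (hB : ∀ u, u ≠ 0 → 0 < B u u) :
    B.IsInvertible := by
  have hinj : Function.Injective (B : V →ₗ[ℝ] V →L[ℝ] ℝ) := by
    rw [injective_iff_map_eq_zero]
    intro u hu
    by_contra h
    have := hB u h
    rw [show B u = 0 from hu] at this
    simp at this
  have hd : Module.finrank ℝ V = Module.finrank ℝ (V →L[ℝ] ℝ) := by
    rw [← (LinearMap.toContinuousLinearMap (𝕜 := ℝ) (E := V) (F' := ℝ)).finrank_eq]
    exact (Subspace.dual_finrank_eq (K := ℝ) (V := V)).symm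
  exact ⟨(LinearEquiv.ofInjectiveOfFinrankEq _ hinj hd).toContinuousLinearEquiv, rfl⟩

theorem hasFDerivAt_deriv_fst {F : Type*} [NormedAddCommGroup F] [NormedSpace ℝ F]
    {f : ℝ × E → F} {q : ℝ × E} (hf : DifferentiableAt ℝ f q) :
    fderiv ℝ f q (1, 0) = deriv (fun s => f (s, q.2)) q.1 := by
  have := HasFDerivAt.comp_hasDerivAt (l := f) q.1 (hf.hasFDerivAt)
    ((hasDerivAt_id q.1).prodMk (hasDerivAt_const q.1 q.2))
  exact this.deriv.symm

theorem eventually_famParam (hJ : IsOpen J) {p : P} {t : ℝ} (ht : t ∈ J) :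
    ∀ᶠ q : ℝ × E in 𝓝 (t, extChartAt I p p), q.1 ∈ J ∧ q.2 ∈ (extChartAt I p).target :=
  (hJ.prod (isOpen_extChartAt_target p)).mem_nhds ⟨ht, mem_extChartAt_target p⟩

theorem isLocalFamily (hJ : IsOpen J) (hg : IsInvariantMetricFamily I G J g)
    (hL : ∀ t ∈ J, ∀ (p : P) (X Y : TangentSpace I p),
      deriv (fun s => g s p X Y) t = 2 * g t p (L t p X) Y) {t : ℝ} (ht : t ∈ J) (p : P) :
    IsLocalFamily (famBilin I g p) (famEnd I L p) (t, extChartAt I p p) where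
  contDiffAt := (contDiffAt_famBilin hJ hg ht (mem_extChartAt_target p)).of_le ENat.LEInfty.out
  symm := by
    filter_upwards [eventually_famParam hJ ht] with q hq u v
    exact hg.symm _ hq.1 _ _ _
  inv := isInvertible_pullBilin (V := E) (W := E)
    (isInvertible_mfderiv_extChartAt_symm (mem_extChartAt_target p))
    (isInvertible_of_pos (V := E) (hg.pos t ht _))
  shape := by
    filter_upwards [eventually_famParam hJ ht] with q hq u v
    have hd : DifferentiableAt ℝ (famBilin I g p) q :=
      (contDiffAt_famBilin hJ hg hq.1 hq.2).differentiableAt (by simp)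
    have h1 := hasFDerivAt_deriv_fst (f := fun r => famBilin I g p r u v) (q := q)
      ((hd.hasFDerivAt.clm_apply_const u).clm_apply_const v).differentiableAt
    rw [((hd.hasFDerivAt.clm_apply_const u).clm_apply_const v).fderiv] at h1
    refine Eq.trans ?_ h1.symm
    refine Eq.trans ?_ (hL q.1 hq.1 ((extChartAt I p).symm q.2)
      (mfderiv 𝓘(ℝ, E) I (extChartAt I p).symm q.2 u)
      (mfderiv 𝓘(ℝ, E) I (extChartAt I p).symm q.2 v)).symm
    refine congrArg (fun a => 2 * a) (congrArg (fun a => g q.1 ((extChartAt I p).symm q.2) a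
      (mfderiv 𝓘(ℝ, E) I (extChartAt I p).symm q.2 v)) ?_)
    exact (isInvertible_mfderiv_extChartAt_symm hq.2).self_apply_inverse _

theorem mvfderiv_tr {t : ℝ} {p : P}
    (hd : DifferentiableAt ℝ (famEnd I L p) (t, extChartAt I p p)) (X : TangentSpace I p) :
    mvfderiv I (fun q : P => tr I (L t q)) p X
      = traceCLM E (fderiv ℝ (famEnd I L p) (t, extChartAt I p p) (0, X)) := by
  have hs := hasFDerivAt_slice hd.hasFDerivAt
  have h1 : HasFDerivAt (fun y => traceCLM E (famEnd I L p (t, y))) _ (extChartAt I p p) :=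
    (traceCLM E).hasFDerivAt.comp (extChartAt I p p) hs
  have h2 : ∀ y ∈ (extChartAt I p).target,
      tr I (L t ((extChartAt I p).symm y)) = traceCLM E (famEnd I L p (t, y)) := by
    intro y hy
    have h3 : ∀ A B : E →L[ℝ] E, A.IsInvertible →
        traceCLM E B = traceCLM E (A.inverse ∘L B ∘L A) := by
      rintro A B hA
      rw [traceCLM_comp_comm, ContinuousLinearMap.comp_assoc, hA.self_comp_inverse]
      rfl
    exact h3 _ (L t ((extChartAt I p).symm y)) (isInvertible_mfderiv_extChartAt_symm hy)
  have h4 : (fun q : P => tr I (L t q)) =ᶠ[𝓝 p]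
      (fun y => traceCLM E (famEnd I L p (t, y))) ∘ extChartAt I p := by
    filter_upwards [extChartAt_source_mem_nhds (I := I) p] with q hq
    rw [comp_apply, ← h2 _ ((extChartAt I p).map_source hq), (extChartAt I p).left_inv hq]
  have h5 : MDifferentiableAt I 𝓘(ℝ, ℝ) (fun q : P => tr I (L t q)) p :=
    (h1.differentiableAt.comp_mdifferentiableAt
      (mdifferentiableAt_extChartAt (mem_chart_source H p))).congr_of_eventuallyEq h4
  have h6 := h5.mvfderiv
  rw [I.range_eq_univ, fderivWithin_univ] at h6
  have h7 : writtenInExtChartAt I 𝓘(ℝ, ℝ) p (fun q : P => tr I (L t q))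
      =ᶠ[𝓝 (extChartAt I p p)] fun y => traceCLM E (famEnd I L p (t, y)) := by
    filter_upwards [(isOpen_extChartAt_target (I := I) p).mem_nhds (mem_extChartAt_target p)]
      with y hy
    rw [← h2 y hy]
    rfl
  rw [h7.fderiv_eq, h1.fderiv] at h6
  exact congrArg (fun T : E →L[ℝ] ℝ => T X) h6

theorem dChart_apply (p : P) (u : TangentSpace I p) : dChart I p u = (u : E) :=
  congrArg (fun T : E →L[ℝ] E => T u) (mfderiv_extChartAt_self (I := I) (x := p))

theorem dChart_inverse_apply (p : P) (u : E) : (dChart I p).inverse u = (u : E) := by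
  have h1 : ∀ A : E →L[ℝ] E, (∀ u, A u = u) → A.inverse u = u := by
    intro A hA
    have : A = ContinuousLinearMap.id ℝ E := by ext u; exact hA u
    rw [this, ContinuousLinearMap.inverse_id]
    rfl
  exact h1 _ (dChart_apply p)

end Family

section System

variable {E : Type*} [NormedAddCommGroup E] [NormedSpace ℝ E] [FiniteDimensional ℝ E]
  {H : Type*} [TopologicalSpace H] {I : ModelWithCorners ℝ E H} [I.Boundaryless]
  {P : Type*} [TopologicalSpace P] [ChartedSpace H P] [IsManifold I ∞ P]
  {G : Type*} [Group G] [MulAction G P]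
  {J : Set ℝ} {g : ℝ → BilinField I P} {α : ℝ → OneForm I P} {L : ℝ → EndField I P}

theorem forall_quadratic_eq_zero_iff {V : Type*} [Zero V] {A : V → V → ℝ} {B : V → ℝ} {c : ℝ} :
    (∀ u v : ℝ × V, A u.2 v.2 + u.1 * B v.2 + v.1 * B u.2 + u.1 * v.1 * c = 0) ↔
      (∀ x, B x = 0) ∧ c = 0 ∧ ∀ x y, A x y = 0 := by
  constructor
  · intro h
    have hA : ∀ x y, A x y = 0 := fun x y => by simpa using h (0, x) (0, y)
    have hB : ∀ x, B x = 0 := fun x => by simpa [hA] using h (1, 0) (0, x)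
    exact ⟨hB, by simpa [hA, hB] using h (1, 0) (1, 0), hA⟩
  · rintro ⟨h1, h2, h3⟩ u v
    simp [h1, h2, h3]

theorem deriv_famForm {t : ℝ} {p : P}
    (hα : DifferentiableAt ℝ (famForm I α p) (t, extChartAt I p p)) (X : TangentSpace I p) :
    deriv (fun s => α s p X) t = fderiv ℝ (famForm I α p) (t, extChartAt I p p) (1, 0) X := by
  have h := hα.hasFDerivAt.clm_apply_const (X : E)
  have h1 := hasFDerivAt_deriv_fst h.differentiableAt
  rw [h.fderiv] at h1
  refine Eq.trans ?_ h1.symm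
  congr 1
  ext s
  exact congrArg (fun T : E →L[ℝ] ℝ => T X) (chartOneForm_self (α s) p).symm

theorem dotEnd_eq {t : ℝ} {p : P}
    (hL : DifferentiableAt ℝ (famEnd I L p) (t, extChartAt I p p)) :
    dotEnd I L t p = fderiv ℝ (famEnd I L p) (t, extChartAt I p p) (1, 0) := by
  rw [hasFDerivAt_deriv_fst hL]
  have : (fun s => famEnd I L p (s, extChartAt I p p)) = fun s => L s p := by
    ext1 s
    exact chartEnd_self (L s) p
  exact (congrArg (fun f : ℝ → E →L[ℝ] E => deriv f t) this).symm

/-- In the chart at `p`, the soliton equation of `dt² + g_t` and `ξ dt + α_t` is the soliton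
system. -/
theorem local_soliton_iff (hJ : IsOpen J) (hg : IsInvariantMetricFamily I G J g)
    (hα : IsInvariantOneFormFamily I G J α) {ξ : ℝ → ℝ} (hξ : ContDiffOn ℝ ∞ ξ J)
    (hL : ∀ t ∈ J, ∀ (p : P) (X Y : TangentSpace I p),
      deriv (fun s => g s p X Y) t = 2 * g t p (L t p X) Y) (ε : ℝ) {t : ℝ} (ht : t ∈ J) (p : P) :
    (∀ u v : ℝ × E, localRicci (prodBilin (famBilin I g p)) (t, extChartAt I p p) u v
        + localSymCovDeriv (prodBilin (famBilin I g p)) (prodForm ξ (famForm I α p))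
            (t, extChartAt I p p) u v
        + ε / 2 * prodBilin (famBilin I g p) (t, extChartAt I p p) u v = 0) ↔
      (∀ X : TangentSpace I p, - g t p (codiff I (g t) (L t) p) X
        - mvfderiv I (fun q : P => tr I (L t q)) p X
        + (1 / 2) * deriv (fun s => α s p X) t - α t p (L t p X) = 0) ∧
      (- tr I (dotEnd I L t p) - tr I (L t p ∘L L t p) + deriv ξ t + ε / 2 = 0) ∧
      (∀ X Y : TangentSpace I p,
        ricci I (g t) p X Y - tr I (L t p) * g t p (L t p X) Y - g t p (dotEnd I L t p X) Y
          + ξ t * g t p (L t p X) Y + symCovDeriv I (g t) (α t) p X Y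
          + (ε / 2) * g t p X Y = 0) := by
  have HF := isLocalFamily hJ hg hL ht p
  have hξ' : DifferentiableAt ℝ ξ t :=
    (hξ.contDiffAt (hJ.mem_nhds ht)).differentiableAt (by simp)
  have hα' : DifferentiableAt ℝ (famForm I α p) (t, extChartAt I p p) :=
    (contDiffAt_famForm hJ hα ht (mem_extChartAt_target p)).differentiableAt (by simp)
  have hL' := HF.differentiableAt_shape
  simp only [HF.soliton_expr_prod hξ' hα']
  rw [forall_quadratic_eq_zero_iff (V := E)
    (A := fun x y => localRicci (fun y => famBilin I g p (t, y)) (extChartAt I p p) x y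
          - traceCLM E (famEnd I L p (t, extChartAt I p p))
            * famBilin I g p (t, extChartAt I p p) (famEnd I L p (t, extChartAt I p p) x) y
          - famBilin I g p (t, extChartAt I p p)
            (fderiv ℝ (famEnd I L p) (t, extChartAt I p p) (1, 0) x) y
          + ξ t * famBilin I g p (t, extChartAt I p p) (famEnd I L p (t, extChartAt I p p) x) y
          + localSymCovDeriv (fun y => famBilin I g p (t, y)) (fun y => famForm I α p (t, y))
            (extChartAt I p p) x y
          + ε / 2 * famBilin I g p (t, extChartAt I p p) x y)
    (B := fun x => - famBilin I g p (t, extChartAt I p p)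
          (localCodiff (fun y => famBilin I g p (t, y)) (fun y => famEnd I L p (t, y))
            (extChartAt I p p)) x
          - traceCLM E (fderiv ℝ (famEnd I L p) (t, extChartAt I p p) (0, x))
          + (1 / 2) * fderiv ℝ (famForm I α p) (t, extChartAt I p p) (1, 0) x
          - famForm I α p (t, extChartAt I p p) (famEnd I L p (t, extChartAt I p p) x))]
  have eg : famBilin I g p (t, extChartAt I p p) = g t p := chartBilin_self (g t) p
  have eα : famForm I α p (t, extChartAt I p p) = α t p := chartOneForm_self (α t) p
  have eL : famEnd I L p (t, extChartAt I p p) = L t p := chartEnd_self (L t) p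
  have ed := dotEnd_eq hL'
  have ebil : ∀ (A A' : E →L[ℝ] E) (_ : A = A') (X Y : E), famBilin I g p (t, extChartAt I p p)
      (A X) Y = (g t p : E →L[ℝ] E →L[ℝ] ℝ) (A' X) Y := by
    rintro A _ rfl X Y
    exact congrArg (fun B : E →L[ℝ] E →L[ℝ] ℝ => B (A X) Y) eg
  have etr : traceCLM E (famEnd I L p (t, extChartAt I p p)) = tr I (L t p) :=
    congrArg (traceCLM E) eL
  refine and_congr (forall_congr' fun X => iff_of_eq (congrArg (fun r : ℝ => r = 0) ?_))
    (and_congr (iff_of_eq (congrArg (fun r : ℝ => r = 0) ?_)) (forall_congr' fun X =>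
    forall_congr' fun Y => iff_of_eq (congrArg (fun r : ℝ => r = 0) ?_)))
  · refine congrArg₂ HSub.hSub (congrArg₂ HAdd.hAdd (congrArg₂ HSub.hSub (congrArg Neg.neg ?_)
      (mvfderiv_tr hL' X).symm) (congrArg (fun r : ℝ => 1 / 2 * r) (deriv_famForm hα' X).symm)) ?_
    · exact congrArg₂ (fun (B : E →L[ℝ] E →L[ℝ] ℝ) z => B z X) eg
        (dChart_inverse_apply (I := I) p _).symm
    · exact congrArg₂ (fun (a : E →L[ℝ] ℝ) (A : E →L[ℝ] E) => a (A X)) eα eL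
  · refine congrArg (fun r : ℝ => r + deriv ξ t + ε / 2) (congrArg₂ HSub.hSub
      (congrArg Neg.neg (congrArg (traceCLM E) ed.symm)) ?_)
    exact congrArg (fun A : E →L[ℝ] E => traceCLM E (A ∘L A)) eL
  · have er : localRicci (fun y => famBilin I g p (t, y)) (extChartAt I p p) X Y
        = ricci I (g t) p X Y := congrArg₂ _ (dChart_apply p X).symm (dChart_apply p Y).symm
    have es : localSymCovDeriv (fun y => famBilin I g p (t, y)) (fun y => famForm I α p (t, y))
        (extChartAt I p p) X Y = symCovDeriv I (g t) (α t) p X Y :=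
      congrArg₂ _ (dChart_apply p X).symm (dChart_apply p Y).symm
    refine congrArg₂ HAdd.hAdd (congrArg₂ HAdd.hAdd (congrArg₂ HAdd.hAdd (congrArg₂ HSub.hSub
      (congrArg₂ HSub.hSub er (congrArg₂ HMul.hMul etr (ebil _ _ eL X Y))) (ebil _ _ ed.symm X Y))
      (congrArg (fun r : ℝ => ξ t * r) (ebil _ _ eL X Y))) es)
      (congrArg (fun r : ℝ => ε / 2 * r) ?_)
    exact congrArg (fun B : E →L[ℝ] E →L[ℝ] ℝ => B X Y) eg

end System

section ProductManifold

variable {E : Type*} [NormedAddCommGroup E] [NormedSpace ℝ E] [FiniteDimensional ℝ E]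
  {H : Type*} [TopologicalSpace H] {I : ModelWithCorners ℝ E H} [I.Boundaryless]
  {P : Type*} [TopologicalSpace P] [ChartedSpace H P] [IsManifold I ∞ P]
  {G : Type*} [Group G] [MulAction G P]
  {J : Set ℝ} {g : ℝ → BilinField I P} {α : ℝ → OneForm I P} {L : ℝ → EndField I P}

theorem productMetric_apply (g : ℝ → BilinField I P) (q : ℝ × P) (u v : ℝ × E) :
    productMetric I g q u v = u.1 * v.1 + (g q.1 q.2 : E →L[ℝ] E →L[ℝ] ℝ) u.2 v.2 := by
  have h1 : (mfderiv (𝓘(ℝ, ℝ).prod I) 𝓘(ℝ, ℝ) (Prod.fst : ℝ × P → ℝ) q : ℝ × E →L[ℝ] ℝ)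
      = ContinuousLinearMap.fst ℝ ℝ E := mfderiv_fst
  have h2 : (mfderiv (𝓘(ℝ, ℝ).prod I) I (Prod.snd : ℝ × P → P) q : ℝ × E →L[ℝ] E)
      = ContinuousLinearMap.snd ℝ ℝ E := mfderiv_snd
  refine congrArg₂ HAdd.hAdd (congrArg₂ HMul.hMul (congrArg (fun T : ℝ × E →L[ℝ] ℝ => T u) h1)
    (congrArg (fun T : ℝ × E →L[ℝ] ℝ => T v) h1)) ?_
  exact congrArg (fun T : ℝ × E →L[ℝ] E => (g q.1 q.2 : E →L[ℝ] E →L[ℝ] ℝ) (T u) (T v)) h2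

theorem productOneForm_apply (ξ : ℝ → ℝ) (α : ℝ → OneForm I P) (q : ℝ × P) (u : ℝ × E) :
    productOneForm I ξ α q u = ξ q.1 * u.1 + (α q.1 q.2 : E →L[ℝ] ℝ) u.2 := by
  have h1 : (mfderiv (𝓘(ℝ, ℝ).prod I) 𝓘(ℝ, ℝ) (Prod.fst : ℝ × P → ℝ) q : ℝ × E →L[ℝ] ℝ)
      = ContinuousLinearMap.fst ℝ ℝ E := mfderiv_fst
  have h2 : (mfderiv (𝓘(ℝ, ℝ).prod I) I (Prod.snd : ℝ × P → P) q : ℝ × E →L[ℝ] E)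
      = ContinuousLinearMap.snd ℝ ℝ E := mfderiv_snd
  refine congrArg₂ HAdd.hAdd (congrArg (fun T : ℝ × E →L[ℝ] ℝ => ξ q.1 * T u) h1) ?_
  exact congrArg (fun T : ℝ × E →L[ℝ] E => (α q.1 q.2 : E →L[ℝ] ℝ) (T u)) h2

variable (I) in
/-- The parametrization of `ℝ × P` given by the chart at `p`. -/
def famParam (p : P) (q : ℝ × E) : ℝ × P := (q.1, (extChartAt I p).symm q.2)

theorem famParam_self (t : ℝ) (p : P) : famParam I p (t, extChartAt I p p) = (t, p) := by
  rw [famParam, extChartAt_to_inv]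

theorem mfderiv_famParam {p : P} {q : ℝ × E} (hq : q.2 ∈ (extChartAt I p).target) (u : ℝ × E) :
    mfderiv 𝓘(ℝ, ℝ × E) (𝓘(ℝ, ℝ).prod I) (famParam I p) q u
      = (u.1, (mfderiv 𝓘(ℝ, E) I (extChartAt I p).symm q.2 : E →L[ℝ] E) u.2) := by
  have hs : MDifferentiableAt 𝓘(ℝ, E) I (extChartAt I p).symm q.2 :=
    (contMDiffAt_extChartAt_symm_of_mem (n := ∞) hq).mdifferentiableAt (by simp)
  have h1 : MDifferentiableAt 𝓘(ℝ, ℝ × E) 𝓘(ℝ, ℝ) (Prod.fst : ℝ × E → ℝ) q :=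
    differentiableAt_fst.mdifferentiableAt
  have h2 : MDifferentiableAt 𝓘(ℝ, ℝ × E) 𝓘(ℝ, E) (Prod.snd : ℝ × E → E) q :=
    differentiableAt_snd.mdifferentiableAt
  have h3 := mfderiv_comp (g := (extChartAt I p).symm) q hs h2
  have h4 := mfderiv_prodMk (f := (Prod.fst : ℝ × E → ℝ))
    (g := (extChartAt I p).symm ∘ (Prod.snd : ℝ × E → E)) h1 (hs.comp q h2)
  refine (congrArg (fun T : ℝ × E →L[ℝ] ℝ × E => T u) h4).trans (Prod.ext ?_ ?_)
  · refine congrArg (fun T : ℝ × E →L[ℝ] ℝ => T u)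
      (mfderiv_eq_fderiv.trans (fderiv_fst (𝕜 := ℝ) (E := ℝ) (F := E)))
  · refine (congrArg (fun T : ℝ × E →L[ℝ] E => T u) h3).trans ?_
    exact congrArg (fun T : ℝ × E →L[ℝ] E =>
      (mfderiv 𝓘(ℝ, E) I (extChartAt I p).symm q.2 : E →L[ℝ] E) (T u))
      (mfderiv_eq_fderiv.trans (fderiv_snd (𝕜 := ℝ) (E := ℝ) (F := E)))

theorem isParam_famParam {p : P} {q : ℝ × E} (hq : q.2 ∈ (extChartAt I p).target) :
    IsParam (𝓘(ℝ, ℝ).prod I) (famParam I p) q where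
  contMDiffAt := (contMDiffAt_famParam (s := q.1) hq).of_le ENat.LEInfty.out
  inv := by
    obtain ⟨e, he⟩ := isInvertible_mfderiv_extChartAt_symm hq
    refine ⟨(ContinuousLinearEquiv.refl ℝ ℝ).prodCongr e, ?_⟩
    refine ContinuousLinearMap.ext fun u => ?_
    refine Eq.trans ?_ (mfderiv_famParam hq u).symm
    exact Prod.ext rfl (congrArg (fun T : E →L[ℝ] E => T u.2) he)

theorem pullMetric_famParam (g : ℝ → BilinField I P) {p : P} {q : ℝ × E}
    (hq : q.2 ∈ (extChartAt I p).target) :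
    pullMetric (𝓘(ℝ, ℝ).prod I) (famParam I p) (productMetric I g) q
      = prodBilin (famBilin I g p) q := by
  refine ContinuousLinearMap.ext fun u => ContinuousLinearMap.ext fun v => ?_
  refine Eq.trans ?_ (productMetric_apply g (famParam I p q) (u.1, (mfderiv 𝓘(ℝ, E) I
    (extChartAt I p).symm q.2 : E →L[ℝ] E) u.2) (v.1, (mfderiv 𝓘(ℝ, E) I
    (extChartAt I p).symm q.2 : E →L[ℝ] E) v.2))
  exact congrArg₂ (fun a b => productMetric I g (famParam I p q) a b) (mfderiv_famParam hq u)
    (mfderiv_famParam hq v)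

theorem pullForm_famParam (ξ : ℝ → ℝ) (α : ℝ → OneForm I P) {p : P} {q : ℝ × E}
    (hq : q.2 ∈ (extChartAt I p).target) :
    pullForm (𝓘(ℝ, ℝ).prod I) (famParam I p) (productOneForm I ξ α) q
      = prodForm ξ (famForm I α p) q := by
  refine ContinuousLinearMap.ext fun u => ?_
  refine Eq.trans ?_ (productOneForm_apply ξ α (famParam I p q) (u.1, (mfderiv 𝓘(ℝ, E) I
    (extChartAt I p).symm q.2 : E →L[ℝ] E) u.2))
  exact congrArg (fun a => productOneForm I ξ α (famParam I p q) a) (mfderiv_famParam hq u)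

variable {EM : Type*} [NormedAddCommGroup EM] [NormedSpace ℝ EM] [FiniteDimensional ℝ EM]
  {HM : Type*} [TopologicalSpace HM] {IM : ModelWithCorners ℝ EM HM} [IM.Boundaryless]
  {M : Type*} [TopologicalSpace M] [ChartedSpace HM M] [IsManifold IM ∞ M]

theorem pullMetric_comp_famParam {F : ℝ × P → M} {gM : BilinField IM M} {p : P} {q : ℝ × E}
    (hq : q.2 ∈ (extChartAt I p).target)
    (hF : MDifferentiableAt (𝓘(ℝ, ℝ).prod I) IM F (famParam I p q))
    (hFg : pullBilin (mfderiv (𝓘(ℝ, ℝ).prod I) IM F (famParam I p q)) (gM (F (famParam I p q)))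
      = productMetric I g (famParam I p q)) :
    pullMetric IM (F ∘ famParam I p) gM q = prodBilin (famBilin I g p) q := by
  rw [← pullMetric_famParam g hq]
  have h1 := mfderiv_comp (g := F) q hF
    ((isParam_famParam hq).contMDiffAt.mdifferentiableAt (by simp))
  refine (congrArg (fun T : ℝ × E →L[ℝ] EM =>
    pullBilin T (gM (F (famParam I p q)) : EM →L[ℝ] EM →L[ℝ] ℝ)) h1).trans ?_
  exact congrArg (fun B => pullBilin (V := ℝ × E) (W := ℝ × E) (mfderiv 𝓘(ℝ, ℝ × E)
    (𝓘(ℝ, ℝ).prod I) (famParam I p) q) B) hFg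

theorem pullForm_comp_famParam {F : ℝ × P → M} {αM : OneForm IM M} {ξ : ℝ → ℝ} {p : P}
    {q : ℝ × E} (hq : q.2 ∈ (extChartAt I p).target)
    (hF : MDifferentiableAt (𝓘(ℝ, ℝ).prod I) IM F (famParam I p q))
    (hFα : (αM (F (famParam I p q))) ∘L (mfderiv (𝓘(ℝ, ℝ).prod I) IM F (famParam I p q))
      = productOneForm I ξ α (famParam I p q)) :
    pullForm IM (F ∘ famParam I p) αM q = prodForm ξ (famForm I α p) q := by
  rw [← pullForm_famParam ξ α hq]
  have h1 := mfderiv_comp (g := F) q hF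
    ((isParam_famParam hq).contMDiffAt.mdifferentiableAt (by simp))
  refine (congrArg (fun T : ℝ × E →L[ℝ] EM =>
    (αM (F (famParam I p q)) : EM →L[ℝ] ℝ) ∘L T) h1).trans ?_
  exact congrArg (fun B : ℝ × E →L[ℝ] ℝ => B ∘L (mfderiv 𝓘(ℝ, ℝ × E)
    (𝓘(ℝ, ℝ).prod I) (famParam I p) q : ℝ × E →L[ℝ] ℝ × E)) hFα

theorem isParam_comp_famParam {F : ℝ × P → M} {p : P} {q : ℝ × E}
    (hq : q.2 ∈ (extChartAt I p).target)
    (hF : ContMDiffAt (𝓘(ℝ, ℝ).prod I) IM ∞ F (famParam I p q))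
    (hinv : (mfderiv (𝓘(ℝ, ℝ).prod I) IM F (famParam I p q)).IsInvertible) :
    IsParam IM (F ∘ famParam I p) q where
  contMDiffAt := ContMDiffAt.comp (g := F) q (hF.of_le ENat.LEInfty.out)
    (isParam_famParam hq).contMDiffAt
  inv := by
    rw [mfderiv_comp (g := F) q (hF.mdifferentiableAt (by simp))
      ((isParam_famParam hq).contMDiffAt.mdifferentiableAt (by simp))]
    exact hinv.comp (isParam_famParam hq).inv

/-- If `F^* gM = dt² + g_t` and `F^* αM = ξ dt + α_t`, then the Ricci soliton equation of `gM` and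
the dual of `αM` at `F (t, p)` is the soliton system at `(t, p)`. -/
theorem soliton_iff (hJ : IsOpen J) (hg : IsInvariantMetricFamily I G J g)
    (hα : IsInvariantOneFormFamily I G J α) {ξ : ℝ → ℝ} (hξ : ContDiffOn ℝ ∞ ξ J)
    (hL : ∀ t ∈ J, ∀ (p : P) (X Y : TangentSpace I p),
      deriv (fun s => g s p X Y) t = 2 * g t p (L t p X) Y) (ε : ℝ)
    {F : ℝ × P → M} {gM : BilinField IM M} {αM : OneForm IM M}
    (hF : ∀ q ∈ J ×ˢ (univ : Set P), ContMDiffAt (𝓘(ℝ, ℝ).prod I) IM ∞ F q)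
    (hinv : ∀ q ∈ J ×ˢ (univ : Set P), (mfderiv (𝓘(ℝ, ℝ).prod I) IM F q).IsInvertible)
    (hFg : ∀ q ∈ J ×ˢ (univ : Set P),
      pullBilin (mfderiv (𝓘(ℝ, ℝ).prod I) IM F q) (gM (F q)) = productMetric I g q)
    (hFα : ∀ q ∈ J ×ˢ (univ : Set P),
      (αM (F q)) ∘L (mfderiv (𝓘(ℝ, ℝ).prod I) IM F q) = productOneForm I ξ α q)
    {t : ℝ} (ht : t ∈ J) (p : P) (hgM : IsMetricAt IM gM (F (t, p)))
    (hαM : IsFormAt IM αM (F (t, p))) :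
    (∀ u v : TangentSpace IM (F (t, p)), ricci IM gM (F (t, p)) u v
        + (1 / 2) * lieDeriv IM gM (dualField IM gM αM) (F (t, p)) u v
        + (ε / 2) * gM (F (t, p)) u v = 0) ↔
      (∀ X : TangentSpace I p, - g t p (codiff I (g t) (L t) p) X
        - mvfderiv I (fun q : P => tr I (L t q)) p X
        + (1 / 2) * deriv (fun s => α s p X) t - α t p (L t p X) = 0) ∧
      (- tr I (dotEnd I L t p) - tr I (L t p ∘L L t p) + deriv ξ t + ε / 2 = 0) ∧
      (∀ X Y : TangentSpace I p,
        ricci I (g t) p X Y - tr I (L t p) * g t p (L t p X) Y - g t p (dotEnd I L t p X) Y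
          + ξ t * g t p (L t p X) Y + symCovDeriv I (g t) (α t) p X Y
          + (ε / 2) * g t p X Y = 0) := by
  rw [← local_soliton_iff hJ hg hα hξ hL ε ht p]
  have hmem : ∀ q : ℝ × E, q.1 ∈ J → famParam I p q ∈ J ×ˢ (univ : Set P) :=
    fun q hq => ⟨hq, mem_univ _⟩
  have e1 : pullMetric IM (F ∘ famParam I p) gM =ᶠ[𝓝 (t, extChartAt I p p)]
      prodBilin (famBilin I g p) := by
    filter_upwards [eventually_famParam hJ ht] with q hq
    exact pullMetric_comp_famParam hq.2 ((hF _ (hmem q hq.1)).mdifferentiableAt (by simp))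
      (hFg _ (hmem q hq.1))
  have e2 : pullForm IM (F ∘ famParam I p) αM =ᶠ[𝓝 (t, extChartAt I p p)]
      prodForm ξ (famForm I α p) := by
    filter_upwards [eventually_famParam hJ ht] with q hq
    exact pullForm_comp_famParam hq.2 ((hF _ (hmem q hq.1)).mdifferentiableAt (by simp))
      (hFα _ (hmem q hq.1))
  have h0 : (t, extChartAt I p p).2 ∈ (extChartAt I p).target := mem_extChartAt_target p
  have hψ : IsParam IM (F ∘ famParam I p) (t, extChartAt I p p) :=
    isParam_comp_famParam h0 (hF _ (hmem _ ht)) (hinv _ (hmem _ ht))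
  have h1 : F (t, p) = (F ∘ famParam I p) (t, extChartAt I p p) := by
    rw [comp_apply, famParam_self]
  rw [h1] at hgM hαM ⊢
  rw [hψ.soliton_eq hgM hαM ε, localRicci_congr e1, localSymCovDeriv_congr e1 e2,
    e1.self_of_nhds]

end ProductManifold

section SmoothFields

variable {E : Type*} [NormedAddCommGroup E] [NormedSpace ℝ E] [FiniteDimensional ℝ E]
  {H : Type*} [TopologicalSpace H] {I : ModelWithCorners ℝ E H} [I.Boundaryless]
  {M : Type*} [TopologicalSpace M] [ChartedSpace H M] [IsManifold I ∞ M]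

theorem IsRiemannianMetricOn.isMetricAt {U : Set M} {g : BilinField I M}
    (hg : IsRiemannianMetricOn I U g) (hU : IsOpen U) {x : M} (hx : x ∈ U) :
    IsMetricAt I g x where
  contMDiffAt := (hg.smooth.contMDiffAt (hU.mem_nhds hx)).of_le ENat.LEInfty.out
  symm := by
    filter_upwards [hU.mem_nhds hx] with z hz
    exact hg.symm z hz
  inv := by
    filter_upwards [hU.mem_nhds hx] with z hz
    exact isInvertible_of_pos (V := E) (hg.pos z hz)

theorem IsSmoothOneFormOn.isFormAt {U : Set M} {α : OneForm I M} (hα : IsSmoothOneFormOn I U α)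
    (hU : IsOpen U) {x : M} (hx : x ∈ U) : IsFormAt I α x :=
  (hα.contMDiffAt (hU.mem_nhds hx)).of_le ENat.LEInfty.out

theorem contMDiffAt_of_chartBilin {n : WithTop ℕ∞} [IsManifold I n M] {g : BilinField I M} {x : M}
    (h : ContDiffAt ℝ n (chartBilin I g x) (extChartAt I x x)) :
    ContMDiffAt I (I.prod 𝓘(ℝ, E →L[ℝ] E →L[ℝ] ℝ)) n
      (fun x ↦ TotalSpace.mk' (E →L[ℝ] E →L[ℝ] ℝ)
        (E := fun x : M => TangentSpace I x →L[ℝ] TangentSpace I x →L[ℝ] ℝ) x (g x)) x := by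
  refine contMDiffAt_bilin_of_chart (b := fun z => z) contMDiffAt_id fun u v => ?_
  have h1 : ContDiffAt ℝ n (fun y => chartBilin I g x y u v) (extChartAt I x x) :=
    (h.clm_apply contDiffAt_const).clm_apply contDiffAt_const
  refine (ContMDiffAt.comp (g := fun y => chartBilin I g x y u v) x h1.contMDiffAt
    contMDiffAt_extChartAt).congr_of_eventuallyEq ?_
  filter_upwards [extChartAt_source_mem_nhds (I := I) x] with z hz
  have h2 : ∀ w, w = z → ∀ a b : E, (g z : E →L[ℝ] E →L[ℝ] ℝ) a b = g w a b := by
    rintro w rfl a b; rfl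
  exact h2 _ ((extChartAt I x).left_inv hz) _ _

theorem contMDiffAt_of_chartOneForm {n : WithTop ℕ∞} [IsManifold I n M] {α : OneForm I M} {x : M}
    (h : ContDiffAt ℝ n (chartOneForm I α x) (extChartAt I x x)) :
    ContMDiffAt I (I.prod 𝓘(ℝ, E →L[ℝ] ℝ)) n
      (fun x ↦ TotalSpace.mk' (E →L[ℝ] ℝ)
        (E := fun x : M => TangentSpace I x →L[ℝ] ℝ) x (α x)) x := by
  refine contMDiffAt_form_of_chart (b := fun z => z) contMDiffAt_id fun u => ?_
  have h1 : ContDiffAt ℝ n (fun y => chartOneForm I α x y u) (extChartAt I x x) :=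
    h.clm_apply contDiffAt_const
  refine (ContMDiffAt.comp (g := fun y => chartOneForm I α x y u) x h1.contMDiffAt
    contMDiffAt_extChartAt).congr_of_eventuallyEq ?_
  filter_upwards [extChartAt_source_mem_nhds (I := I) x] with z hz
  have h2 : ∀ w, w = z → ∀ a : E, (α z : E →L[ℝ] ℝ) a = α w a := by
    rintro w rfl a; rfl
  exact h2 _ ((extChartAt I x).left_inv hz) _

end SmoothFields

section ProductSmooth

variable {E : Type*} [NormedAddCommGroup E] [NormedSpace ℝ E] [FiniteDimensional ℝ E]
  {H : Type*} [TopologicalSpace H] {I : ModelWithCorners ℝ E H} [I.Boundaryless]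
  {P : Type*} [TopologicalSpace P] [ChartedSpace H P] [IsManifold I ∞ P]
  {G : Type*} [Group G] [MulAction G P]
  {J : Set ℝ} {g : ℝ → BilinField I P} {α : ℝ → OneForm I P} {L : ℝ → EndField I P}

theorem extChartAt_prod_symm (t : ℝ) (p : P) :
    ⇑(extChartAt (𝓘(ℝ, ℝ).prod I) (t, p)).symm = famParam I p := by
  rw [extChartAt_prod]
  rfl

theorem extChartAt_prod_self (t : ℝ) (p : P) :
    extChartAt (𝓘(ℝ, ℝ).prod I) (t, p) (t, p) = (t, extChartAt I p p) := by
  rw [extChartAt_prod]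
  rfl

theorem isRiemannianMetricOn_productMetric (hJ : IsOpen J) (hg : IsInvariantMetricFamily I G J g) :
    IsRiemannianMetricOn (𝓘(ℝ, ℝ).prod I) (J ×ˢ univ) (productMetric I g) where
  symm := by
    rintro ⟨t, p⟩ ⟨ht, -⟩ u v
    have h := hg.symm t ht p u.2 v.2
    exact (productMetric_apply g (t, p) u v).trans ((congrArg₂ HAdd.hAdd (mul_comm _ _) h).trans
      (productMetric_apply g (t, p) v u).symm)
  pos := by
    rintro ⟨t, p⟩ ⟨ht, -⟩ u hu
    refine lt_of_lt_of_eq ?_ (productMetric_apply g (t, p) u u).symm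
    have h0 : 0 ≤ (g t p : E →L[ℝ] E →L[ℝ] ℝ) u.2 u.2 := by
      rcases eq_or_ne (u.2 : E) 0 with h | h
      · have h1 : ∀ (B : E →L[ℝ] E →L[ℝ] ℝ) (x : E), x = 0 → 0 ≤ B x x := by
          rintro B x rfl; simp
        exact h1 _ _ h
      · exact (hg.pos t ht p u.2 h).le
    rcases eq_or_ne (u.2 : E) 0 with h | h
    · have h1 : u.1 ≠ (0 : ℝ) := fun h1 => hu (Prod.ext h1 h)
      exact add_pos_of_pos_of_nonneg (mul_self_pos.2 h1) h0
    · exact add_pos_of_nonneg_of_pos (mul_self_nonneg (u.1 : ℝ)) (hg.pos t ht p u.2 h)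
  smooth := by
    rintro ⟨t, p⟩ ⟨ht, -⟩
    refine (contMDiffAt_of_chartBilin ?_).contMDiffWithinAt
    rw [extChartAt_prod_self]
    have h1 : ContDiffAt ℝ ∞ (prodBilin (famBilin I g p)) (t, extChartAt I p p) := by
      have := contDiffAt_famBilin hJ hg ht (mem_extChartAt_target (I := I) p)
      refine contDiffAt_clm_of_apply fun u => contDiffAt_clm_of_apply fun v => ?_
      simp only [prodBilin_apply]
      exact contDiffAt_const.add ((this.clm_apply contDiffAt_const).clm_apply contDiffAt_const)
    refine h1.congr_of_eventuallyEq ?_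
    filter_upwards [eventually_famParam hJ ht] with q hq
    rw [← pullMetric_famParam g hq.2, ← extChartAt_prod_symm t p]
    rfl

theorem isSmoothOneFormOn_productOneForm (hJ : IsOpen J) (hα : IsInvariantOneFormFamily I G J α)
    {ξ : ℝ → ℝ} (hξ : ContDiffOn ℝ ∞ ξ J) :
    IsSmoothOneFormOn (𝓘(ℝ, ℝ).prod I) (J ×ˢ univ) (productOneForm I ξ α) := by
  rintro ⟨t, p⟩ ⟨ht, -⟩
  refine (contMDiffAt_of_chartOneForm ?_).contMDiffWithinAt
  rw [extChartAt_prod_self]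
  have h1 : ContDiffAt ℝ ∞ (prodForm ξ (famForm I α p)) (t, extChartAt I p p) := by
    have := contDiffAt_famForm hJ hα ht (mem_extChartAt_target (I := I) p)
    have h2 : ContDiffAt ℝ ∞ (fun q : ℝ × E => ξ q.1) (t, extChartAt I p p) :=
      ContDiffAt.comp (g := ξ) _ (hξ.contDiffAt (hJ.mem_nhds ht)) contDiffAt_fst
    refine contDiffAt_clm_of_apply fun u => ?_
    simp only [prodForm_apply]
    exact (h2.mul contDiffAt_const).add (this.clm_apply contDiffAt_const)
  refine h1.congr_of_eventuallyEq ?_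
  filter_upwards [eventually_famParam hJ ht] with q hq
  rw [← pullForm_famParam ξ α hq.2, ← extChartAt_prod_symm t p]
  rfl

theorem ricciSolitonEqOn_product (hJ : IsOpen J) (hg : IsInvariantMetricFamily I G J g)
    (hα : IsInvariantOneFormFamily I G J α) {ξ : ℝ → ℝ} (hξ : ContDiffOn ℝ ∞ ξ J)
    (hL : ∀ t ∈ J, ∀ (p : P) (X Y : TangentSpace I p),
      deriv (fun s => g s p X Y) t = 2 * g t p (L t p X) Y) {ε : ℝ}
    (h : SolitonSystem I J g L α ξ ε) :
    RicciSolitonEqOn (𝓘(ℝ, ℝ).prod I) (J ×ˢ univ) (productMetric I g)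
      (dualField (𝓘(ℝ, ℝ).prod I) (productMetric I g) (productOneForm I ξ α)) ε := by
  rintro ⟨t, p⟩ ⟨ht, -⟩
  have hU : IsOpen (J ×ˢ (univ : Set P)) := hJ.prod isOpen_univ
  refine (soliton_iff (F := fun q => q) hJ hg hα hξ hL ε (fun q _ => contMDiffAt_id) ?_ ?_ ?_ ht p
    ((isRiemannianMetricOn_productMetric hJ hg).isMetricAt hU ⟨ht, mem_univ _⟩)
    ((isSmoothOneFormOn_productOneForm hJ hα hξ).isFormAt hU ⟨ht, mem_univ _⟩)).2
    ⟨h.mixed t ht p, h.normal t ht p, h.orbit t ht p⟩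
  · intro q _
    exact ⟨ContinuousLinearEquiv.refl ℝ _, mfderiv_id.symm⟩
  · intro q _
    exact congrArg (fun T : ℝ × E →L[ℝ] ℝ × E => pullBilin (V := ℝ × E) (W := ℝ × E) T
      (productMetric I g q)) (mfderiv_id (I := 𝓘(ℝ, ℝ).prod I) (x := q))
  · intro q _
    exact congrArg (fun T : ℝ × E →L[ℝ] ℝ × E => (productOneForm I ξ α q : ℝ × E →L[ℝ] ℝ) ∘L T)
      (mfderiv_id (I := 𝓘(ℝ, ℝ).prod I) (x := q))

end ProductSmooth

section Naturality

variable {E : Type*} [NormedAddCommGroup E] [NormedSpace ℝ E] [FiniteDimensional ℝ E]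
  {H : Type*} [TopologicalSpace H] {I : ModelWithCorners ℝ E H} [I.Boundaryless]
  {M : Type*} [TopologicalSpace M] [ChartedSpace H M] [IsManifold I ∞ M]
  {D : Type*} [NormedAddCommGroup D] [NormedSpace ℝ D] [FiniteDimensional ℝ D]

/-- A vector field related to a differentiable one by a local diffeomorphism is differentiable. -/
theorem differentiableAt_of_related {f : D → E} {y : D} (hf : ContDiffAt ℝ 2 f y)
    (hinv : (fderiv ℝ f y).IsInvertible) {V : E → E} {V' : D → D}
    (hV' : DifferentiableAt ℝ V' y) (hVV : ∀ᶠ z in 𝓝 y, V (f z) = fderiv ℝ f z (V' z)) :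
    DifferentiableAt ℝ V (f y) := by
  have : CompleteSpace D := FiniteDimensional.complete ℝ D
  obtain ⟨e, he⟩ := hinv
  have hs : HasStrictFDerivAt f (e : D →L[ℝ] E) y := by
    rw [he]; exact hf.hasStrictFDerivAt (by simp)
  have h1 : HasFDerivAt (hs.localInverse f e y) (e.symm : E →L[ℝ] D) (f y) :=
    hs.to_localInverse.hasFDerivAt
  have h0 : hs.localInverse f e y (f y) = y := hs.localInverse_apply_image
  have hc : Tendsto (hs.localInverse f e y) (𝓝 (f y)) (𝓝 y) := by
    simpa only [ContinuousAt, h0] using h1.continuousAt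
  have h2 : V =ᶠ[𝓝 (f y)] fun w => fderiv ℝ f (hs.localInverse f e y w)
      (V' (hs.localInverse f e y w)) := by
    filter_upwards [hs.eventually_right_inverse, hc.eventually hVV] with w hw hw'
    rw [hw] at hw'
    exact hw'
  refine DifferentiableAt.congr_of_eventuallyEq ?_ h2
  have h3 : DifferentiableAt ℝ (fderiv ℝ f) y :=
    (hf.fderiv_right (m := 1) (by norm_num)).differentiableAt (by simp)
  rw [← h0] at h3 hV'
  exact (h3.comp (f y) h1.differentiableAt).clm_apply (hV'.comp (f y) h1.differentiableAt)

/-- Naturality of the covariant derivative. -/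
theorem IsParam.covDeriv_eq {ψ : D → M} {y : D} (hψ : IsParam I ψ y) {g : BilinField I M}
    (hg : IsMetricAt I g (ψ y)) {V : (x : M) → TangentSpace I x} {V' : D → D}
    (hV' : DifferentiableAt ℝ V' y)
    (hVV : ∀ᶠ z in 𝓝 y, V (ψ z) = mfderiv 𝓘(ℝ, D) I ψ z (V' z)) (u : D) :
    covDeriv I g V (ψ y) (mfderiv 𝓘(ℝ, D) I ψ y u)
      = mfderiv 𝓘(ℝ, D) I ψ y (localCovDeriv (pullMetric I ψ g) V' y u) := by
  have hi := hψ.isLocalIsometry hg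
  have h1 : ∀ᶠ z in 𝓝 y, chartVec I V (ψ y) ((extChartAt I (ψ y) ∘ ψ) z)
      = fderiv ℝ (extChartAt I (ψ y) ∘ ψ) z (V' z) := by
    filter_upwards [hVV, hψ.eventually_mfderiv_symm, hψ.eventually_fderiv] with z h2 h3 h4
    have h5 : ∀ w, w = ψ z → ∀ (A : E →L[ℝ] E) (x : E), A.IsInvertible →
        (A x : E) = mfderiv 𝓘(ℝ, D) I ψ z (V' z) → A.inverse (V w) = x := by
      rintro w rfl A x hA h6
      have h7 : ∀ b : E, A x = b → A.inverse b = x := fun b hb => hA.inverse_apply_eq.2 hb.symm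
      exact h7 _ (h6.trans h2.symm)
    exact h5 _ ((extChartAt I (ψ y)).left_inv h4.1) _ _ (isInvertible_mfderiv_extChartAt_symm
      ((extChartAt I (ψ y)).map_source h4.1)) (h3 (V' z))
  have h2 := hi.localCovDeriv_map (differentiableAt_of_related
    (hi.contDiffAt.of_le (by norm_num)) hi.inv hV' h1) hV' h1 u
  have h3 : ∀ (A : E →L[ℝ] E) (_ : ∀ x, A.inverse x = x) (a b c d : E), a = b →
      d = c → d = localCovDeriv (chartBilin I g (ψ y)) (chartVec I V (ψ y))
        (extChartAt I (ψ y) (ψ y)) b → A.inverse (localCovDeriv (chartBilin I g (ψ y))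
          (chartVec I V (ψ y)) (extChartAt I (ψ y) (ψ y)) a) = c := by
    rintro A hA a _ c _ rfl rfl h
    rw [hA, h]
  exact h3 _ (dChart_inverse_apply (ψ y)) _ _ _ _ (hψ.dChart_mfderiv u) (hψ.fderiv_chart _) h2

theorem continuousAt_localRicci {h : D → D →L[ℝ] D →L[ℝ] ℝ} {y : D} (H : IsLocalMetric h y)
    (u v : D) : ContinuousAt (fun z => localRicci h z u v) y := by
  have h1 : ContinuousAt (christoffel h) y := H.contDiffAt_christoffel.continuousAt
  have h2 : ContinuousAt (fderiv ℝ (christoffel h)) y :=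
    (H.contDiffAt_christoffel.fderiv_right (m := 0) (by norm_num)).continuousAt
  have h3 : ContinuousAt (fun z => curvatureOp h z u v) y := by
    refine continuousAt_clm_apply.2 fun w => ?_
    simp only [curvatureOp_apply]
    have hc : ∀ a b : D, ContinuousAt (fun z => christoffel h z a b) y := fun a b =>
      (h1.clm_apply continuousAt_const).clm_apply continuousAt_const
    have hd : ∀ a b c : D, ContinuousAt (fun z => fderiv ℝ (christoffel h) z a b c) y :=
      fun a b c => ((h2.clm_apply continuousAt_const).clm_apply continuousAt_const).clm_apply
        continuousAt_const
    exact (((hd _ _ _).sub (hd _ _ _)).add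
      ((h1.clm_apply continuousAt_const).clm_apply (hc _ _))).sub
      ((h1.clm_apply continuousAt_const).clm_apply (hc _ _))
  exact (traceCLM D).continuous.continuousAt.comp h3

theorem continuousAt_localSymCovDeriv {h : D → D →L[ℝ] D →L[ℝ] ℝ} {α : D → D →L[ℝ] ℝ} {y : D}
    (H : IsLocalMetric h y) (hα : ContDiffAt ℝ 1 α y) (u v : D) :
    ContinuousAt (fun z => localSymCovDeriv h α z u v) y := by
  have h1 : ContinuousAt (christoffel h) y := H.contDiffAt_christoffel.continuousAt
  have h2 : ContinuousAt (fderiv ℝ α) y :=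
    (hα.fderiv_right (m := 0) (by norm_num)).continuousAt
  have hc : ∀ a b : D, ContinuousAt (fun z => α z (christoffel h z a b)) y := fun a b =>
    hα.continuousAt.clm_apply ((h1.clm_apply continuousAt_const).clm_apply continuousAt_const)
  have hd : ∀ a b : D, ContinuousAt (fun z => fderiv ℝ α z a b) y :=
    fun a b => (h2.clm_apply continuousAt_const).clm_apply continuousAt_const
  exact continuousAt_const.mul (((hd _ _).sub (hc _ _)).add ((hd _ _).sub (hc _ _)))

/-- The Ricci soliton equation extends from a dense set. -/
theorem RicciSolitonEqOn.of_dense {S : Set M} (hS : Dense S) {g : BilinField I M}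
    (hg : IsRiemannianMetricOn I univ g) {α : OneForm I M} (hα : IsSmoothOneFormOn I univ α)
    {ε : ℝ} (h : RicciSolitonEqOn I S g (dualField I g α) ε) :
    RicciSolitonEqOn I univ g (dualField I g α) ε := by
  intro x _
  let ψ := (extChartAt I x).symm
  let F : E → E → E → ℝ := fun u v y => localRicci (pullMetric I ψ g) y u v
    + localSymCovDeriv (pullMetric I ψ g) (pullForm I ψ α) y u v
    + ε / 2 * pullMetric I ψ g y u v
  have hm : ∀ z, IsMetricAt I g z := fun z => hg.isMetricAt isOpen_univ (mem_univ z)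
  have hf : ∀ z, IsFormAt I α z := fun z => hα.isFormAt isOpen_univ (mem_univ z)
  have hiff : ∀ z ∈ (extChartAt I x).source, (∀ u v : TangentSpace I z, ricci I g z u v
      + (1 / 2) * lieDeriv I g (dualField I g α) z u v + (ε / 2) * g z u v = 0) ↔
      ∀ u v : E, F u v (extChartAt I x z) = 0 := by
    intro z hz
    have h1 := (isParam_extChartAt_symm ((extChartAt I x).map_source hz)).soliton_eq
      (hm _) (hf _) ε
    rwa [(extChartAt I x).left_inv hz] at h1
  have hcont : ∀ u v, ContinuousAt (F u v) (extChartAt I x x) := by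
    intro u v
    have hH : IsLocalMetric (pullMetric I ψ g) (extChartAt I x x) := (hm x).isLocalMetric
    have hα' : ContDiffAt ℝ 1 (pullForm I ψ α) (extChartAt I x x) :=
      contDiffAt_pullForm (isParam_extChartAt_symm (mem_extChartAt_target x)).contMDiffAt
        (by norm_num) (hf _)
    exact ((continuousAt_localRicci hH u v).add (continuousAt_localSymCovDeriv hH hα' u v)).add
      (continuousAt_const.mul ((hH.contDiffAt.continuousAt.clm_apply
        continuousAt_const).clm_apply continuousAt_const))
  refine (hiff x (mem_extChartAt_source x)).2 fun u v => ?_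
  by_contra hne
  have h2 : ∀ᶠ z in 𝓝 x, F u v (extChartAt I x z) ≠ 0 :=
    ((hcont u v).comp (continuousAt_extChartAt x)).eventually_ne hne
  obtain ⟨z, ⟨hz1, hz2⟩, hz3⟩ := mem_closure_iff_nhds.1 (hS x) _
    (h2.and (extChartAt_source_mem_nhds (I := I) x))
  exact hz1 ((hiff z hz2).1 (h z hz3) u v)

end Naturality

section CohomogeneityOne

variable {E : Type*} [NormedAddCommGroup E] [NormedSpace ℝ E] [FiniteDimensional ℝ E]
  {H : Type*} [TopologicalSpace H] {I : ModelWithCorners ℝ E H} [I.Boundaryless]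
  {M : Type*} [TopologicalSpace M] [ChartedSpace H M] [IsManifold I ∞ M]
  {E' : Type*} [NormedAddCommGroup E'] [NormedSpace ℝ E'] [FiniteDimensional ℝ E']
  {H' : Type*} [TopologicalSpace H'] {I' : ModelWithCorners ℝ E' H'} [I'.Boundaryless]
  {G : Type*} [Group G] [MulAction G M] {K : Subgroup G}
  [TopologicalSpace (G ⧸ K)] [ChartedSpace H' (G ⧸ K)] [IsManifold I' ∞ (G ⧸ K)]
  {gM : BilinField I M} {αM : OneForm I M} {J : Set ℝ} {γ : ℝ → M}
  {Φ : OpenPartialHomeomorph (ℝ × (G ⧸ K)) M}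

namespace IsCohomOneDiffeo

theorem isOpen_source (hJ : IsOpen J) : IsOpen (J ×ˢ (univ : Set (G ⧸ K))) :=
  hJ.prod isOpen_univ

variable (h : IsCohomOneDiffeo I I' K gM J γ Φ)
include h

theorem contMDiffAt {q : ℝ × (G ⧸ K)} (hq : q.1 ∈ J) :
    ContMDiffAt (𝓘(ℝ, ℝ).prod I') I ∞ Φ q :=
  h.smooth.contMDiffAt (Φ.open_source.mem_nhds (by rw [h.source_eq]; exact ⟨hq, mem_univ _⟩))

theorem mem_source {q : ℝ × (G ⧸ K)} (hq : q.1 ∈ J) : q ∈ Φ.source := by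
  rw [h.source_eq]; exact ⟨hq, mem_univ _⟩

theorem mdifferentiableAt {q : ℝ × (G ⧸ K)} (hq : q.1 ∈ J) :
    MDifferentiableAt (𝓘(ℝ, ℝ).prod I') I Φ q :=
  (h.contMDiffAt hq).mdifferentiableAt (by simp)

theorem mdifferentiableAt_symm {q : ℝ × (G ⧸ K)} (hq : q.1 ∈ J) :
    MDifferentiableAt I (𝓘(ℝ, ℝ).prod I') Φ.symm (Φ q) :=
  (h.smooth_symm.contMDiffAt (Φ.open_target.mem_nhds
    (Φ.map_source (h.mem_source hq)))).mdifferentiableAt (by simp)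

theorem mfderiv_symm_comp {q : ℝ × (G ⧸ K)} (hq : q.1 ∈ J) (u : ℝ × E') :
    mfderiv I (𝓘(ℝ, ℝ).prod I') Φ.symm (Φ q) (mfderiv (𝓘(ℝ, ℝ).prod I') I Φ q u) = u := by
  have h1 := mfderiv_comp (g := Φ.symm) q (h.mdifferentiableAt_symm hq)
    (h.mdifferentiableAt hq)
  have h2 : Φ.symm ∘ Φ =ᶠ[𝓝 q] fun q => q := by
    filter_upwards [Φ.open_source.mem_nhds (h.mem_source hq)] with z hz
    exact Φ.left_inv hz
  have h3 := h2.mfderiv_eq (I := 𝓘(ℝ, ℝ).prod I') (I' := 𝓘(ℝ, ℝ).prod I')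
  have h4 := mfderiv_id (I := 𝓘(ℝ, ℝ).prod I') (x := q)
  refine (congrArg (fun T : ℝ × E' →L[ℝ] ℝ × E' => T u) h1).symm.trans ?_
  exact congrArg (fun T : ℝ × E' →L[ℝ] ℝ × E' => T u) (h3.trans h4)

theorem mfderiv_comp_symm {q : ℝ × (G ⧸ K)} (hq : q.1 ∈ J) (u : E) :
    mfderiv (𝓘(ℝ, ℝ).prod I') I Φ q (mfderiv I (𝓘(ℝ, ℝ).prod I') Φ.symm (Φ q) u) = u := by
  have hs := Φ.left_inv (h.mem_source hq)
  have h1 := mfderiv_comp (I := I) (I' := 𝓘(ℝ, ℝ).prod I') (I'' := I) (f := Φ.symm) (g := Φ) (Φ q)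
    (by rw [hs]; exact h.mdifferentiableAt hq) (h.mdifferentiableAt_symm hq)
  have h2 : Φ ∘ Φ.symm =ᶠ[𝓝 (Φ q)] fun q => q := by
    filter_upwards [Φ.open_target.mem_nhds (Φ.map_source (h.mem_source hq))] with z hz
    exact Φ.right_inv hz
  have h3 := h2.mfderiv_eq (I := I) (I' := I)
  have h4 := mfderiv_id (I := I) (x := Φ q)
  have h5 : ∀ z, z = q → ∀ w : ℝ × E', (mfderiv (𝓘(ℝ, ℝ).prod I') I Φ q w : E)
      = mfderiv (𝓘(ℝ, ℝ).prod I') I Φ z w := by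
    rintro z rfl w; rfl
  refine (h5 _ hs _).trans ((congrArg (fun T : E →L[ℝ] E => T u) h1).symm.trans ?_)
  exact congrArg (fun T : E →L[ℝ] E => T u) (h3.trans h4)

theorem isInvertible_mfderiv {q : ℝ × (G ⧸ K)} (hq : q.1 ∈ J) :
    (mfderiv (𝓘(ℝ, ℝ).prod I') I Φ q).IsInvertible := by
  refine ContinuousLinearMap.IsInvertible.of_inverse (M := ℝ × E') (M₂ := E)
    (g := mfderiv I (𝓘(ℝ, ℝ).prod I') Φ.symm (Φ q)) ?_ ?_
  · exact ContinuousLinearMap.ext fun u => h.mfderiv_comp_symm hq u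
  · exact ContinuousLinearMap.ext fun u => h.mfderiv_symm_comp hq u

theorem mfderiv_orbit {t : ℝ} (ht : t ∈ J) (p : G ⧸ K) (X : E') :
    mfderiv I' I (fun q => Φ (t, q)) p X = mfderiv (𝓘(ℝ, ℝ).prod I') I Φ (t, p) ((0, X) : ℝ × E') := by
  have h0 : MDifferentiableAt I' (𝓘(ℝ, ℝ).prod I') (fun q : G ⧸ K => (t, q)) p :=
    mdifferentiableAt_const.prodMk mdifferentiableAt_id
  have h1 := mfderiv_comp (f := fun q : G ⧸ K => (t, q)) (g := Φ) p
    (h.mdifferentiableAt (q := (t, p)) ht) h0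
  refine (congrArg (fun T : E' →L[ℝ] E => T X) h1).trans ?_
  exact congrArg (fun T : E' →L[ℝ] ℝ × E' => (mfderiv (𝓘(ℝ, ℝ).prod I') I Φ (t, p) :
    ℝ × E' →L[ℝ] E) (T X)) (mfderiv_prod_right (I := 𝓘(ℝ, ℝ)) (I' := I') (x₀ := t) (y₀ := p))

theorem apply_one {t : ℝ} (ht : t ∈ J) : Φ (t, ((1 : G) : G ⧸ K)) = γ t := by
  rw [h.apply_eq t ht, one_smul]

theorem velocity_eq (hJ : IsOpen J) {t : ℝ} (ht : t ∈ J) :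
    (velocity I γ t : E)
      = mfderiv (𝓘(ℝ, ℝ).prod I') I Φ (t, ((1 : G) : G ⧸ K)) ((1, 0) : ℝ × E') := by
  have h0 : MDifferentiableAt 𝓘(ℝ, ℝ) (𝓘(ℝ, ℝ).prod I') (fun s : ℝ => (s, ((1 : G) : G ⧸ K))) t :=
    mdifferentiableAt_id.prodMk mdifferentiableAt_const
  have h1 := mfderiv_comp (f := fun s : ℝ => (s, ((1 : G) : G ⧸ K))) (g := Φ) t
    (h.mdifferentiableAt (q := (t, ((1 : G) : G ⧸ K))) ht) h0
  have h2 : γ =ᶠ[𝓝 t] Φ ∘ fun s : ℝ => (s, ((1 : G) : G ⧸ K)) := by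
    filter_upwards [hJ.mem_nhds ht] with s hs
    exact (h.apply_one hs).symm
  have h3 := h2.mfderiv_eq (I := 𝓘(ℝ, ℝ)) (I' := I)
  refine (congrArg (fun T : ℝ →L[ℝ] E => T 1) (h3.trans h1)).trans ?_
  exact congrArg (fun T : ℝ →L[ℝ] ℝ × E' => (mfderiv (𝓘(ℝ, ℝ).prod I') I Φ
    (t, ((1 : G) : G ⧸ K)) : ℝ × E' →L[ℝ] E) (T 1))
    (mfderiv_prod_left (I := 𝓘(ℝ, ℝ)) (I' := I') (x₀ := t) (y₀ := ((1 : G) : G ⧸ K)))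

theorem apply_smul {t : ℝ} (ht : t ∈ J) (a : G) (p : G ⧸ K) : Φ (t, a • p) = a • Φ (t, p) := by
  induction p using QuotientGroup.induction_on with
  | H b =>
    rw [h.apply_eq t ht, smul_smul]
    exact h.apply_eq t ht (a * b)

variable (hM : ∀ a : G, MDifferentiable I I (fun z : M => a • z))
  (hP : ∀ a : G, MDifferentiable I' I' (fun z : G ⧸ K => a • z))
include hM hP

theorem mfderiv_smul (hJ : IsOpen J) {t : ℝ} (ht : t ∈ J) (a : G) (p : G ⧸ K) (u : ℝ × E') :
    (mfderiv I I (fun z : M => a • z) (Φ (t, p)) (mfderiv (𝓘(ℝ, ℝ).prod I') I Φ (t, p) u) : E)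
      = mfderiv (𝓘(ℝ, ℝ).prod I') I Φ (t, a • p)
        ((u.1, (mfderiv I' I' (fun z : G ⧸ K => a • z) p : E' →L[ℝ] E') u.2) : ℝ × E') := by
  have h0 : MDifferentiableAt (𝓘(ℝ, ℝ).prod I') (𝓘(ℝ, ℝ).prod I')
      (Prod.map (fun s : ℝ => s) (fun z : G ⧸ K => a • z)) (t, p) :=
    mdifferentiableAt_id.prodMap (hP a p)
  have h1 := mfderiv_comp (f := Φ) (g := fun z : M => a • z) (t, p) (hM a _)
    (h.mdifferentiableAt (q := (t, p)) ht)
  have h2 := mfderiv_comp (f := Prod.map (fun s : ℝ => s) (fun z : G ⧸ K => a • z)) (g := Φ) (t, p)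
    (h.mdifferentiableAt (q := (t, a • p)) ht) h0
  have h3 : (fun z : M => a • z) ∘ Φ =ᶠ[𝓝 (t, p)]
      Φ ∘ Prod.map (fun s : ℝ => s) (fun z : G ⧸ K => a • z) := by
    filter_upwards [(isOpen_source hJ).mem_nhds (show (t, p) ∈ J ×ˢ univ from ⟨ht, mem_univ _⟩)]
      with z hz
    exact (h.apply_smul hz.1 a z.2).symm
  have h4 := h3.mfderiv_eq (I := 𝓘(ℝ, ℝ).prod I') (I' := I)
  have h5 := mfderiv_prodMap (I := 𝓘(ℝ, ℝ)) (I' := I') (J := 𝓘(ℝ, ℝ)) (J' := I')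
    (f := fun s : ℝ => s) (g := fun z : G ⧸ K => a • z) (p := (t, p)) mdifferentiableAt_id (hP a p)
  refine (congrArg (fun T : ℝ × E' →L[ℝ] E => T u) (h1.symm.trans (h4.trans h2))).trans ?_
  refine congrArg (mfderiv (𝓘(ℝ, ℝ).prod I') I Φ (t, a • p) : ℝ × E' →L[ℝ] E) ?_
  refine (congrArg (fun T : ℝ × E' →L[ℝ] ℝ × E' => T u) h5).trans (Prod.ext ?_ rfl)
  exact congrArg (fun T : ℝ →L[ℝ] ℝ => T u.1) (mfderiv_id (I := 𝓘(ℝ, ℝ)) (x := t))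

theorem pullBilin_smul (hJ : IsOpen J) {t : ℝ} (ht : t ∈ J) (a : G) (p : G ⧸ K) (u v : ℝ × E') :
    pullBilin (mfderiv (𝓘(ℝ, ℝ).prod I') I Φ (t, p)) (gM (Φ (t, p))) u v
      = pullBilin (mfderiv (𝓘(ℝ, ℝ).prod I') I Φ (t, a • p)) (gM (Φ (t, a • p)))
        ((u.1, (mfderiv I' I' (fun z : G ⧸ K => a • z) p : E' →L[ℝ] E') u.2) : ℝ × E')
        ((v.1, (mfderiv I' I' (fun z : G ⧸ K => a • z) p : E' →L[ℝ] E') v.2) : ℝ × E') := by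
  have h1 := h.isometric a (Φ (t, p)) (mfderiv (𝓘(ℝ, ℝ).prod I') I Φ (t, p) u)
    (mfderiv (𝓘(ℝ, ℝ).prod I') I Φ (t, p) v)
  have h2 : ∀ z, z = a • Φ (t, p) → ∀ x y x' y' : E, x = x' → y = y' →
      (gM z : E →L[ℝ] E →L[ℝ] ℝ) x' y' = (gM (a • Φ (t, p)) : E →L[ℝ] E →L[ℝ] ℝ) x y := by
    rintro z rfl x y _ _ rfl rfl; rfl
  exact h1.symm.trans (h2 _ (h.apply_smul ht a p) _ _ _ _ (h.mfderiv_smul hM hP hJ ht a p u)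
    (h.mfderiv_smul hM hP hJ ht a p v)).symm

theorem pullForm_smul (hJ : IsOpen J) (hα : IsInvariantOneForm I G αM) {t : ℝ} (ht : t ∈ J)
    (a : G) (p : G ⧸ K) (u : ℝ × E') :
    ((αM (Φ (t, p))) ∘L (mfderiv (𝓘(ℝ, ℝ).prod I') I Φ (t, p))) u
      = ((αM (Φ (t, a • p))) ∘L (mfderiv (𝓘(ℝ, ℝ).prod I') I Φ (t, a • p)))
        ((u.1, (mfderiv I' I' (fun z : G ⧸ K => a • z) p : E' →L[ℝ] E') u.2) : ℝ × E') := by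
  have h1 := hα a (Φ (t, p)) (mfderiv (𝓘(ℝ, ℝ).prod I') I Φ (t, p) u)
  have h2 : ∀ z, z = a • Φ (t, p) → ∀ x x' : E, x = x' →
      (αM z : E →L[ℝ] ℝ) x' = (αM (a • Φ (t, p)) : E →L[ℝ] ℝ) x := by
    rintro z rfl x _ rfl; rfl
  exact h1.symm.trans (h2 _ (h.apply_smul ht a p) _ _ (h.mfderiv_smul hM hP hJ ht a p u)).symm

end IsCohomOneDiffeo

end CohomogeneityOne

section CohomogeneityOne

variable {E : Type*} [NormedAddCommGroup E] [NormedSpace ℝ E] [FiniteDimensional ℝ E]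
  {H : Type*} [TopologicalSpace H] {I : ModelWithCorners ℝ E H} [I.Boundaryless]
  {M : Type*} [TopologicalSpace M] [ChartedSpace H M] [IsManifold I ∞ M]
  {E' : Type*} [NormedAddCommGroup E'] [NormedSpace ℝ E'] [FiniteDimensional ℝ E']
  {H' : Type*} [TopologicalSpace H'] {I' : ModelWithCorners ℝ E' H'} [I'.Boundaryless]

theorem mfderiv_comp_famParam {P : Type*} [TopologicalSpace P] [ChartedSpace H' P]
    [IsManifold I' ∞ P] {F : ℝ × P → M} {p : P} {q : ℝ × E'}
    (hq : q.2 ∈ (extChartAt I' p).target)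
    (hF : MDifferentiableAt (𝓘(ℝ, ℝ).prod I') I F (famParam I' p q)) (u : ℝ × E') :
    (mfderiv 𝓘(ℝ, ℝ × E') I (F ∘ famParam I' p) q u : E)
      = mfderiv (𝓘(ℝ, ℝ).prod I') I F (famParam I' p q)
        ((u.1, (mfderiv 𝓘(ℝ, E') I' (extChartAt I' p).symm q.2 : E' →L[ℝ] E') u.2) : ℝ × E') := by
  have h1 := mfderiv_comp (g := F) q hF
    ((isParam_famParam hq).contMDiffAt.mdifferentiableAt (by simp))
  refine (congrArg (fun T : ℝ × E' →L[ℝ] E => T u) h1).trans ?_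
  exact congrArg (mfderiv (𝓘(ℝ, ℝ).prod I') I F (famParam I' p q) : ℝ × E' →L[ℝ] E)
    (mfderiv_famParam hq u)

theorem mfderiv_comp_famParam_self {P : Type*} [TopologicalSpace P] [ChartedSpace H' P]
    [IsManifold I' ∞ P] {F : ℝ × P → M} {t : ℝ} {p : P}
    (hF : MDifferentiableAt (𝓘(ℝ, ℝ).prod I') I F (t, p)) (u : ℝ × E') :
    (mfderiv 𝓘(ℝ, ℝ × E') I (F ∘ famParam I' p) (t, extChartAt I' p p) u : E)
      = mfderiv (𝓘(ℝ, ℝ).prod I') I F (t, p) u := by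
  have hF' := hF
  rw [← famParam_self (I := I') t p] at hF'
  have h1 := mfderiv_comp_famParam (q := (t, extChartAt I' p p)) (mem_extChartAt_target p) hF' u
  have h2 : ∀ z, z = (t, p) → ∀ w, w = u → (mfderiv (𝓘(ℝ, ℝ).prod I') I F z w : E)
      = mfderiv (𝓘(ℝ, ℝ).prod I') I F (t, p) u := by
    rintro _ rfl _ rfl; rfl
  exact h1.trans (h2 _ (famParam_self t p) _
    (Prod.ext rfl (mfderiv_extChartAt_symm_self p u.2)))

variable {G : Type*} [Group G] [MulAction G M] {K : Subgroup G}
  [TopologicalSpace (G ⧸ K)] [ChartedSpace H' (G ⧸ K)] [IsManifold I' ∞ (G ⧸ K)]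
  {gM : BilinField I M} {αM : OneForm I M} {J : Set ℝ} {γ : ℝ → M}
  {Φ : OpenPartialHomeomorph (ℝ × (G ⧸ K)) M}

namespace IsCohomOneDiffeo

variable (h : IsCohomOneDiffeo I I' K gM J γ Φ)
include h

theorem isTangentTo {t : ℝ} (ht : t ∈ J) (X : E') :
    IsTangentTo I (MulAction.orbit G (γ t)) (γ t)
      (mfderiv (𝓘(ℝ, ℝ).prod I') I Φ (t, ((1 : G) : G ⧸ K)) ((0, X) : ℝ × E') : E) := by
  let p : G ⧸ K := ((1 : G) : G ⧸ K)
  let l : ℝ → ℝ × E' := fun s => (t, extChartAt I' p p + s • X)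
  have hl : l 0 = (t, extChartAt I' p p) := by simp [l]
  have hl' : HasDerivAt l ((0, X) : ℝ × E') 0 := by
    refine (hasDerivAt_const 0 t).prodMk ?_
    simpa using ((hasDerivAt_id (0 : ℝ)).smul_const X).const_add (extChartAt I' p p)
  have hls : ContDiff ℝ ∞ l := contDiff_const.prodMk
    (contDiff_const.add (contDiff_id.smul contDiff_const))
  have h0 : (l 0).2 ∈ (extChartAt I' p).target := by rw [hl]; exact mem_extChartAt_target p
  have hψ : ContMDiffAt 𝓘(ℝ, ℝ × E') I ∞ (Φ ∘ famParam I' p) (l 0) :=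
    ContMDiffAt.comp (g := Φ) (l 0) (h.contMDiffAt ht)
      (contMDiffAt_famParam (s := (l 0).1) h0)
  refine ⟨fun s => Φ (famParam I' p (l s)), ?_, Eventually.of_forall fun s => ?_, ?_⟩
  · exact ContMDiffAt.comp (g := Φ ∘ famParam I' p) 0 hψ hls.contDiffAt.contMDiffAt
  · have h1 : ∀ z : G ⧸ K, Φ (t, z) ∈ MulAction.orbit G (γ t) := by
      intro z
      induction z using QuotientGroup.induction_on with
      | H b => exact ⟨b, (h.apply_eq t ht b).symm⟩
    exact h1 _
  · have h1 : ∀ x y : M, x = y → ∀ a b : E, a = b →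
        (⟨x, a⟩ : TangentBundle I M) = ⟨y, b⟩ := by
      rintro x _ rfl a _ rfl; rfl
    refine h1 _ _ ?_ _ _ ?_
    · change Φ (famParam I' p (l 0)) = γ t
      rw [hl, famParam_self]
      exact h.apply_one ht
    · have h2 := mfderiv_comp (I := 𝓘(ℝ, ℝ)) (f := l) (g := Φ ∘ famParam I' p) 0
        (hψ.mdifferentiableAt (by simp)) hl'.differentiableAt.mdifferentiableAt
      have h3 : (mfderiv 𝓘(ℝ, ℝ) 𝓘(ℝ, ℝ × E') l 0 : ℝ →L[ℝ] ℝ × E') 1 = (0, X) := by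
        rw [mfderiv_eq_fderiv]
        exact hl'.hasFDerivAt.fderiv ▸ one_smul ℝ ((0, X) : ℝ × E')
      have h4 : ∀ z, z = (t, extChartAt I' p p) → ∀ w : ℝ × E', w = (0, X) →
          (mfderiv 𝓘(ℝ, ℝ × E') I (Φ ∘ famParam I' p) z w : E)
            = mfderiv (𝓘(ℝ, ℝ).prod I') I Φ (t, p) ((0, X) : ℝ × E') := by
        rintro _ rfl _ rfl
        exact mfderiv_comp_famParam_self (h.mdifferentiableAt (q := (t, p)) ht) _
      exact (congrArg (fun T : ℝ →L[ℝ] E => T 1) h2).trans (h4 _ hl _ h3)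

theorem pullBilin_one_normal (hJ : IsOpen J) {t : ℝ} (ht : t ∈ J) :
    pullBilin (mfderiv (𝓘(ℝ, ℝ).prod I') I Φ (t, ((1 : G) : G ⧸ K)))
      (gM (Φ (t, ((1 : G) : G ⧸ K)))) ((1, 0) : ℝ × E') ((1, 0) : ℝ × E') = 1 := by
  have h2 : ∀ z, z = γ t → ∀ x y : E, x = velocity I γ t → y = velocity I γ t →
      (gM z : E →L[ℝ] E →L[ℝ] ℝ) x y = 1 := by
    rintro z rfl x y rfl rfl
    exact h.unit_speed t ht
  exact h2 _ (h.apply_one ht) _ _ (h.velocity_eq hJ ht).symm (h.velocity_eq hJ ht).symm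

theorem pullBilin_one_mixed (hJ : IsOpen J) {t : ℝ} (ht : t ∈ J) (X : E') :
    pullBilin (mfderiv (𝓘(ℝ, ℝ).prod I') I Φ (t, ((1 : G) : G ⧸ K)))
      (gM (Φ (t, ((1 : G) : G ⧸ K)))) ((1, 0) : ℝ × E') ((0, X) : ℝ × E') = 0 := by
  have h2 : ∀ z, z = γ t → ∀ x y : E, x = velocity I γ t →
      IsTangentTo I (MulAction.orbit G (γ t)) (γ t) y →
      (gM z : E →L[ℝ] E →L[ℝ] ℝ) x y = 0 := by
    rintro z rfl x y rfl hy
    exact h.orthogonal t ht y hy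
  exact h2 _ (h.apply_one ht) _ _ (h.velocity_eq hJ ht).symm (h.isTangentTo ht X)

theorem inducedMetric_apply {t : ℝ} (ht : t ∈ J) (p : G ⧸ K) (X Y : E') :
    inducedMetric I I' Φ gM t p X Y
      = pullBilin (mfderiv (𝓘(ℝ, ℝ).prod I') I Φ (t, p)) (gM (Φ (t, p)))
        ((0, X) : ℝ × E') ((0, Y) : ℝ × E') :=
  congrArg₂ (fun a b : E => (gM (Φ (t, p)) : E →L[ℝ] E →L[ℝ] ℝ) a b) (h.mfderiv_orbit ht p X)
    (h.mfderiv_orbit ht p Y)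

theorem inducedOneForm_apply {t : ℝ} (ht : t ∈ J) (p : G ⧸ K) (X : E') :
    inducedOneForm I I' Φ αM t p X
      = ((αM (Φ (t, p))) ∘L (mfderiv (𝓘(ℝ, ℝ).prod I') I Φ (t, p))) ((0, X) : ℝ × E') :=
  congrArg (fun a : E => (αM (Φ (t, p)) : E →L[ℝ] ℝ) a) (h.mfderiv_orbit ht p X)

theorem contDiffOn_normalComponent (hJ : IsOpen J) (hα : IsSmoothOneFormOn I univ αM) :
    ContDiffOn ℝ ∞ (normalComponent I αM γ) J := by
  intro t ht
  have hγ : ContMDiffAt 𝓘(ℝ, ℝ) I ∞ γ t := h.geodesic.1.contMDiffAt (hJ.mem_nhds ht)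
  have h1 := (hα.contMDiffAt (x := γ t) univ_mem).comp t hγ
  have h2 : ContMDiffAt 𝓘(ℝ, ℝ) 𝓘(ℝ, ℝ) ∞ (normalComponent I αM γ) t :=
    contMDiffAt_form_apply (b := γ) (B := fun t => αM (γ t)) (V := fun t => velocity I γ t)
      h1 (contMDiffAt_mfderiv_const hγ (by simp) (1 : ℝ))
  exact h2.contDiffAt.contDiffWithinAt

variable (hM : ∀ a : G, MDifferentiable I I (fun z : M => a • z))
  (hP : ∀ a : G, MDifferentiable I' I' (fun z : G ⧸ K => a • z))
include hM hP

theorem isInvariant_inducedMetric (hJ : IsOpen J) {t : ℝ} (ht : t ∈ J) :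
    IsInvariantBilin I' G (inducedMetric I I' Φ gM t) := fun a p u v =>
  (h.inducedMetric_apply ht (a • p) _ _).trans
    ((h.pullBilin_smul hM hP hJ ht a p ((0, u) : ℝ × E') ((0, v) : ℝ × E')).symm.trans
      (h.inducedMetric_apply ht p u v).symm)

theorem isInvariant_inducedOneForm (hJ : IsOpen J) (hα : IsInvariantOneForm I G αM) {t : ℝ}
    (ht : t ∈ J) : IsInvariantOneForm I' G (inducedOneForm I I' Φ αM t) := fun a p u =>
  (h.inducedOneForm_apply ht (a • p) _).trans
    ((h.pullForm_smul hM hP hJ hα ht a p ((0, u) : ℝ × E')).symm.trans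
      (h.inducedOneForm_apply ht p u).symm)

/-- `Φ^* gM = dt² + g_t`. -/
theorem pullBilin_eq (hJ : IsOpen J) (hg : ∀ x, ∀ u v : TangentSpace I x, gM x u v = gM x v u)
    {q : ℝ × (G ⧸ K)} (hq : q.1 ∈ J) :
    pullBilin (mfderiv (𝓘(ℝ, ℝ).prod I') I Φ q) (gM (Φ q))
      = productMetric I' (inducedMetric I I' Φ gM) q := by
  obtain ⟨t, p⟩ := q
  obtain ⟨a, ha⟩ : ∃ a : G, a • p = ((1 : G) : G ⧸ K) := by
    induction p using QuotientGroup.induction_on with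
    | H b => exact ⟨b⁻¹, congrArg QuotientGroup.mk (inv_mul_cancel b)⟩
  let R : G ⧸ K → ℝ × E' →L[ℝ] ℝ × E' →L[ℝ] ℝ := fun r =>
    pullBilin (V := ℝ × E') (W := E) (mfderiv (𝓘(ℝ, ℝ).prod I') I Φ (t, r)) (gM (Φ (t, r)))
  let Q : ℝ × E' →L[ℝ] ℝ × E' →L[ℝ] ℝ := R p
  let A : E' →L[ℝ] E' := mfderiv I' I' (fun z : G ⧸ K => a • z) p
  have hQ : ∀ r, r = a • p → ∀ u v : ℝ × E', Q u v
      = R r (u.1, A u.2) (v.1, A v.2) := by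
    rintro _ rfl u v
    exact h.pullBilin_smul hM hP hJ hq a p u v
  have h1 : Q (1, 0) (1, 0) = 1 := by
    rw [hQ _ ha.symm, map_zero]
    exact h.pullBilin_one_normal hJ hq
  have h2 : ∀ X, Q (1, 0) (0, X) = 0 := by
    intro X
    rw [hQ _ ha.symm, map_zero]
    exact h.pullBilin_one_mixed hJ hq (A X)
  have hs : ∀ u v, Q u v = Q v u := fun u v => hg _ _ _
  have h3 : ∀ u : ℝ × E', u = u.1 • ((1, 0) : ℝ × E') + (0, u.2) := fun u => by simp
  refine ContinuousLinearMap.ext fun u => ContinuousLinearMap.ext fun v => ?_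
  refine Eq.trans ?_ (productMetric_apply _ (t, p) u v).symm
  have h4 : Q u v = u.1 * v.1 + Q (0, u.2) (0, v.2) := by
    conv_lhs => rw [h3 u, h3 v]
    simp only [map_add, map_smul, add_apply, smul_apply, h1, h2, hs _ (1, 0), smul_eq_mul]
    ring
  exact h4.trans (congrArg (fun r : ℝ => u.1 * v.1 + r) (h.inducedMetric_apply hq p u.2 v.2).symm)

/-- `Φ^* αM = ξ dt + α_t`. -/
theorem pullForm_eq (hJ : IsOpen J) (hα : IsInvariantOneForm I G αM)
    {q : ℝ × (G ⧸ K)} (hq : q.1 ∈ J) :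
    (αM (Φ q)) ∘L (mfderiv (𝓘(ℝ, ℝ).prod I') I Φ q)
      = productOneForm I' (normalComponent I αM γ) (inducedOneForm I I' Φ αM) q := by
  obtain ⟨t, p⟩ := q
  obtain ⟨a, ha⟩ : ∃ a : G, a • p = ((1 : G) : G ⧸ K) := by
    induction p using QuotientGroup.induction_on with
    | H b => exact ⟨b⁻¹, congrArg QuotientGroup.mk (inv_mul_cancel b)⟩
  let Q : ℝ × E' →L[ℝ] ℝ :=
    (αM (Φ (t, p)) : E →L[ℝ] ℝ) ∘L (mfderiv (𝓘(ℝ, ℝ).prod I') I Φ (t, p) : ℝ × E' →L[ℝ] E)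
  have h1 : Q (1, 0) = normalComponent I αM γ t := by
    have h2 : ∀ r, r = a • p → ∀ X : E', X = 0 → (αM (Φ (t, r)) : E →L[ℝ] ℝ)
        ((mfderiv (𝓘(ℝ, ℝ).prod I') I Φ (t, r) : ℝ × E' →L[ℝ] E) (1, X)) = Q (1, 0) := by
      rintro _ rfl _ rfl
      refine Eq.trans ?_ (h.pullForm_smul hM hP hJ hα hq a p ((1, 0) : ℝ × E')).symm
      exact congrArg (fun X : E' => (αM (Φ (t, a • p)) : E →L[ℝ] ℝ)
        ((mfderiv (𝓘(ℝ, ℝ).prod I') I Φ (t, a • p) : ℝ × E' →L[ℝ] E) (1, X)))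
        (map_zero (mfderiv I' I' (fun z : G ⧸ K => a • z) p : E' →L[ℝ] E')).symm
    rw [← h2 _ ha.symm 0 rfl]
    have h3 : ∀ z, z = γ t → ∀ x : E, x = velocity I γ t →
        (αM z : E →L[ℝ] ℝ) x = normalComponent I αM γ t := by
      rintro z rfl x rfl; rfl
    exact h3 _ (h.apply_one hq) _ (h.velocity_eq hJ hq).symm
  have h3 : ∀ u : ℝ × E', u = u.1 • ((1, 0) : ℝ × E') + (0, u.2) := fun u => by simp
  refine ContinuousLinearMap.ext fun u => ?_
  refine Eq.trans ?_ (productOneForm_apply _ _ (t, p) u).symm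
  have h4 : Q u = normalComponent I αM γ t * u.1 + Q (0, u.2) := by
    conv_lhs => rw [h3 u]
    rw [map_add, map_smul, h1, smul_eq_mul, mul_comm]
  exact h4.trans (congrArg (fun r : ℝ => normalComponent I αM γ t * u.1 + r)
    (h.inducedOneForm_apply hq p u.2).symm)

end IsCohomOneDiffeo

end CohomogeneityOne

section Family

variable {E : Type*} [NormedAddCommGroup E] [NormedSpace ℝ E] [FiniteDimensional ℝ E]
  {H : Type*} [TopologicalSpace H] {I : ModelWithCorners ℝ E H} [I.Boundaryless]
  {P : Type*} [TopologicalSpace P] [ChartedSpace H P] [IsManifold I ∞ P]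
  {G : Type*} [Group G] [MulAction G P] {J : Set ℝ} {g : ℝ → BilinField I P}

variable (I) in
/-- The shape operators `(1/2) g_t⁻¹ ġ_t` of a family of metrics, in the chart at `p`. -/
def famShape (g : ℝ → BilinField I P) (p : P) (q : ℝ × E) : E →L[ℝ] E :=
  (famBilin I g p q).inverse ∘L ((1 / 2 : ℝ) • fderiv ℝ (famBilin I g p) q (1, 0))

theorem isLocalFamily_famShape (hJ : IsOpen J) (hg : IsInvariantMetricFamily I G J g) {t : ℝ}
    (ht : t ∈ J) (p : P) :
    IsLocalFamily (famBilin I g p) (famShape I g p) (t, extChartAt I p p) where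
  contDiffAt := (contDiffAt_famBilin hJ hg ht (mem_extChartAt_target p)).of_le ENat.LEInfty.out
  symm := by
    filter_upwards [eventually_famParam hJ ht] with q hq u v
    exact hg.symm _ hq.1 _ _ _
  inv := isInvertible_pullBilin (V := E) (W := E)
    (isInvertible_mfderiv_extChartAt_symm (mem_extChartAt_target p))
    (isInvertible_of_pos (V := E) (hg.pos t ht _))
  shape := by
    filter_upwards [eventually_famParam hJ ht] with q hq u v
    have hi : (famBilin I g p q).IsInvertible := isInvertible_pullBilin (V := E) (W := E)
      (isInvertible_mfderiv_extChartAt_symm hq.2) (isInvertible_of_pos (V := E) (hg.pos _ hq.1 _))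
    rw [famShape, ContinuousLinearMap.comp_apply, hi.self_apply_inverse]
    simp

theorem deriv_famBilin {t : ℝ} {p : P}
    (hd : DifferentiableAt ℝ (famBilin I g p) (t, extChartAt I p p)) (X Y : TangentSpace I p) :
    deriv (fun s => g s p X Y) t
      = fderiv ℝ (famBilin I g p) (t, extChartAt I p p) (1, 0) X Y := by
  have h := (hd.hasFDerivAt.clm_apply_const (X : E)).clm_apply_const (Y : E)
  have h1 := hasFDerivAt_deriv_fst h.differentiableAt
  rw [h.fderiv] at h1
  refine Eq.trans ?_ h1.symm
  congr 1
  ext s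
  exact congrArg (fun T : E →L[ℝ] E →L[ℝ] ℝ => T X Y) (chartBilin_self (g s) p).symm

end Family

section CohomogeneityOne

variable {E : Type*} [NormedAddCommGroup E] [NormedSpace ℝ E] [FiniteDimensional ℝ E]
  {H : Type*} [TopologicalSpace H] {I : ModelWithCorners ℝ E H} [I.Boundaryless]
  {M : Type*} [TopologicalSpace M] [ChartedSpace H M] [IsManifold I ∞ M]
  {E' : Type*} [NormedAddCommGroup E'] [NormedSpace ℝ E'] [FiniteDimensional ℝ E']
  {H' : Type*} [TopologicalSpace H'] {I' : ModelWithCorners ℝ E' H'} [I'.Boundaryless]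
  {G : Type*} [Group G] [MulAction G M] {K : Subgroup G}
  [TopologicalSpace (G ⧸ K)] [ChartedSpace H' (G ⧸ K)] [IsManifold I' ∞ (G ⧸ K)]
  {gM : BilinField I M} {αM : OneForm I M} {J : Set ℝ} {γ : ℝ → M}
  {Φ : OpenPartialHomeomorph (ℝ × (G ⧸ K)) M}

namespace IsCohomOneDiffeo

variable (h : IsCohomOneDiffeo I I' K gM J γ Φ)
include h

theorem contMDiffAt_comp_famParam {t : ℝ} (ht : t ∈ J) (p : G ⧸ K) :
    ContMDiffAt 𝓘(ℝ, ℝ × E') I ∞ (Φ ∘ famParam I' p) (t, extChartAt I' p p) :=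
  ContMDiffAt.comp (g := Φ) _ (h.contMDiffAt ht) (contMDiffAt_famParam (mem_extChartAt_target p))

theorem pullMetric_famParam_apply {p r : G ⧸ K} (hr : r ∈ (extChartAt I' p).source) {s : ℝ}
    (hs : s ∈ J) (u v : E') :
    pullMetric I (Φ ∘ famParam I' p) gM (s, extChartAt I' p r) ((0, u) : ℝ × E')
        ((0, v) : ℝ × E')
      = inducedMetric I I' Φ gM s r
        (mfderiv 𝓘(ℝ, E') I' (extChartAt I' p).symm (extChartAt I' p r) u)
        (mfderiv 𝓘(ℝ, E') I' (extChartAt I' p).symm (extChartAt I' p r) v) := by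
  have hq : (s, extChartAt I' p r).2 ∈ (extChartAt I' p).target := (extChartAt I' p).map_source hr
  have h1 := mfderiv_comp_famParam (I := I) (F := Φ) hq
    (h.mdifferentiableAt (q := famParam I' p (s, extChartAt I' p r)) hs)
  have h2 : ∀ z : ℝ × (G ⧸ K), z = (s, r) → ∀ a b : ℝ × E',
      (gM (Φ z) : E →L[ℝ] E →L[ℝ] ℝ) (mfderiv (𝓘(ℝ, ℝ).prod I') I Φ z a)
        (mfderiv (𝓘(ℝ, ℝ).prod I') I Φ z b)
      = (gM (Φ (s, r)) : E →L[ℝ] E →L[ℝ] ℝ) (mfderiv (𝓘(ℝ, ℝ).prod I') I Φ (s, r) a)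
        (mfderiv (𝓘(ℝ, ℝ).prod I') I Φ (s, r) b) := by
    rintro _ rfl a b; rfl
  have h3 : famParam I' p (s, extChartAt I' p r) = (s, r) :=
    Prod.ext rfl ((extChartAt I' p).left_inv hr)
  refine Eq.trans ?_ ((h2 _ h3 _ _).trans (h.inducedMetric_apply hs r _ _).symm)
  exact congrArg₂ (fun a b : E => (gM (Φ (famParam I' p (s, extChartAt I' p r))) :
    E →L[ℝ] E →L[ℝ] ℝ) a b) (h1 _) (h1 _)

theorem pullForm_famParam_apply {p r : G ⧸ K} (hr : r ∈ (extChartAt I' p).source) {s : ℝ}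
    (hs : s ∈ J) (u : E') :
    pullForm I (Φ ∘ famParam I' p) αM (s, extChartAt I' p r) ((0, u) : ℝ × E')
      = inducedOneForm I I' Φ αM s r
        (mfderiv 𝓘(ℝ, E') I' (extChartAt I' p).symm (extChartAt I' p r) u) := by
  have hq : (s, extChartAt I' p r).2 ∈ (extChartAt I' p).target := (extChartAt I' p).map_source hr
  have h1 := mfderiv_comp_famParam (I := I) (F := Φ) hq
    (h.mdifferentiableAt (q := famParam I' p (s, extChartAt I' p r)) hs)
  have h2 : ∀ z : ℝ × (G ⧸ K), z = (s, r) → ∀ a : ℝ × E',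
      (αM (Φ z) : E →L[ℝ] ℝ) (mfderiv (𝓘(ℝ, ℝ).prod I') I Φ z a)
      = (αM (Φ (s, r)) : E →L[ℝ] ℝ) (mfderiv (𝓘(ℝ, ℝ).prod I') I Φ (s, r) a) := by
    rintro _ rfl a; rfl
  have h3 : famParam I' p (s, extChartAt I' p r) = (s, r) :=
    Prod.ext rfl ((extChartAt I' p).left_inv hr)
  refine Eq.trans ?_ ((h2 _ h3 _).trans (h.inducedOneForm_apply hs r _).symm)
  exact congrArg (fun a : E => (αM (Φ (famParam I' p (s, extChartAt I' p r))) : E →L[ℝ] ℝ) a)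
    (h1 _)

theorem eventually_family (hJ : IsOpen J) {t : ℝ} (ht : t ∈ J) (p : G ⧸ K) :
    ∀ᶠ z : ℝ × (G ⧸ K) in 𝓝 (t, p), z.1 ∈ J ∧ z.2 ∈ (extChartAt I' p).source :=
  (hJ.prod (isOpen_extChartAt_source p)).mem_nhds ⟨ht, mem_extChartAt_source p⟩

omit h in
theorem contMDiffAt_chart_family (t : ℝ) (p : G ⧸ K) :
    ContMDiffAt (𝓘(ℝ, ℝ).prod I') 𝓘(ℝ, ℝ × E') ∞
      (fun z : ℝ × (G ⧸ K) => (z.1, extChartAt I' p z.2)) (t, p) := by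
  rw [modelWithCornersSelf_prod, ← chartedSpaceSelf_prod]
  exact contMDiffAt_fst.prodMk (ContMDiffAt.comp (g := extChartAt I' p) (t, p)
    contMDiffAt_extChartAt contMDiffAt_snd)

theorem contMDiffAt_inducedMetric (hJ : IsOpen J) (hg : IsRiemannianMetricOn I univ gM) {t : ℝ}
    (ht : t ∈ J) (p : G ⧸ K) :
    ContMDiffAt (𝓘(ℝ, ℝ).prod I') (I'.prod 𝓘(ℝ, E' →L[ℝ] E' →L[ℝ] ℝ)) ∞
    (fun q : ℝ × (G ⧸ K) ↦ TotalSpace.mk' (E' →L[ℝ] E' →L[ℝ] ℝ)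
      (E := fun p : G ⧸ K => TangentSpace I' p →L[ℝ] TangentSpace I' p →L[ℝ] ℝ) q.2
      (inducedMetric I I' Φ gM q.1 q.2)) (t, p) := by
  refine contMDiffAt_bilin_of_chart (b := Prod.snd) contMDiffAt_snd fun u v => ?_
  have h1 : ContDiffAt ℝ ∞ (pullMetric I (Φ ∘ famParam I' p) gM) (t, extChartAt I' p p) :=
    contDiffAt_pullMetric (h.contMDiffAt_comp_famParam ht p) (by simp)
      (hg.smooth.contMDiffAt univ_mem)
  have h2 := ((h1.clm_apply (contDiffAt_const (c := ((0, u) : ℝ × E')))).clm_apply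
    (contDiffAt_const (c := ((0, v) : ℝ × E')))).contMDiffAt
  refine (h2.comp (t, p) (contMDiffAt_chart_family t p)).congr_of_eventuallyEq ?_
  filter_upwards [eventually_family h hJ ht p] with z hz
  exact (h.pullMetric_famParam_apply hz.2 hz.1 u v).symm

theorem contMDiffAt_inducedOneForm (hJ : IsOpen J) (hα : IsSmoothOneFormOn I univ αM) {t : ℝ}
    (ht : t ∈ J) (p : G ⧸ K) :
    ContMDiffAt (𝓘(ℝ, ℝ).prod I') (I'.prod 𝓘(ℝ, E' →L[ℝ] ℝ)) ∞
    (fun q : ℝ × (G ⧸ K) ↦ TotalSpace.mk' (E' →L[ℝ] ℝ)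
      (E := fun p : G ⧸ K => TangentSpace I' p →L[ℝ] ℝ) q.2
      (inducedOneForm I I' Φ αM q.1 q.2)) (t, p) := by
  refine contMDiffAt_form_of_chart (b := Prod.snd) contMDiffAt_snd fun u => ?_
  have h1 : ContDiffAt ℝ ∞ (pullForm I (Φ ∘ famParam I' p) αM) (t, extChartAt I' p p) :=
    contDiffAt_pullForm (h.contMDiffAt_comp_famParam ht p) (by simp)
      (hα.contMDiffAt univ_mem)
  have h2 := (h1.clm_apply (contDiffAt_const (c := ((0, u) : ℝ × E')))).contMDiffAt
  refine (h2.comp (t, p) (contMDiffAt_chart_family t p)).congr_of_eventuallyEq ?_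
  filter_upwards [eventually_family h hJ ht p] with z hz
  exact (h.pullForm_famParam_apply hz.2 hz.1 u).symm

theorem normalField_apply {q : ℝ × (G ⧸ K)} (hq : q.1 ∈ J) :
    (normalField I I' Φ (Φ q) : E) = mfderiv (𝓘(ℝ, ℝ).prod I') I Φ q ((1, 0) : ℝ × E') := by
  have h1 : ∀ z : ℝ × (G ⧸ K), (mfderiv 𝓘(ℝ, ℝ) (𝓘(ℝ, ℝ).prod I') (fun s : ℝ => (s, z.2)) z.1 :
      ℝ →L[ℝ] ℝ × E') 1 = (1, 0) := fun z =>
    congrArg (fun T : ℝ →L[ℝ] ℝ × E' => T 1)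
      (mfderiv_prod_left (I := 𝓘(ℝ, ℝ)) (I' := I') (x₀ := z.1) (y₀ := z.2))
  have h2 : ∀ (A : E →L[ℝ] ℝ × E') (B : ℝ × E' →L[ℝ] E), (∀ u, A (B u) = u) → (∀ u, B (A u) = u) →
      ∀ v w, v = w → A.inverse v = B w := by
    rintro A B hAB hBA v _ rfl
    have hA : A.IsInvertible := ContinuousLinearMap.IsInvertible.of_inverse (g := B)
      (ContinuousLinearMap.ext hAB) (ContinuousLinearMap.ext hBA)
    exact hA.inverse_apply_eq.2 (hAB v).symm
  exact h2 _ _ (h.mfderiv_symm_comp hq) (h.mfderiv_comp_symm hq) _ _ (h1 (Φ.symm (Φ q)))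

end IsCohomOneDiffeo

end CohomogeneityOne

section CohomogeneityOne

variable {E : Type*} [NormedAddCommGroup E] [NormedSpace ℝ E] [FiniteDimensional ℝ E]
  {H : Type*} [TopologicalSpace H] {I : ModelWithCorners ℝ E H} [I.Boundaryless]
  {M : Type*} [TopologicalSpace M] [ChartedSpace H M] [IsManifold I ∞ M]
  {E' : Type*} [NormedAddCommGroup E'] [NormedSpace ℝ E'] [FiniteDimensional ℝ E']
  {H' : Type*} [TopologicalSpace H'] {I' : ModelWithCorners ℝ E' H'} [I'.Boundaryless]
  {G : Type*} [Group G] [MulAction G M] {K : Subgroup G}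
  [TopologicalSpace (G ⧸ K)] [ChartedSpace H' (G ⧸ K)] [IsManifold I' ∞ (G ⧸ K)]
  {gM : BilinField I M} {αM : OneForm I M} {J : Set ℝ} {γ : ℝ → M}
  {Φ : OpenPartialHomeomorph (ℝ × (G ⧸ K)) M}

namespace IsCohomOneDiffeo

variable (h : IsCohomOneDiffeo I I' K gM J γ Φ)
  (hM : ∀ a : G, MDifferentiable I I (fun z : M => a • z))
  (hP : ∀ a : G, MDifferentiable I' I' (fun z : G ⧸ K => a • z))
include h hM hP

theorem isInvariantMetricFamily (hJ : IsOpen J) (hg : IsRiemannianMetricOn I univ gM) :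
    IsInvariantMetricFamily I' G J (inducedMetric I I' Φ gM) where
  symm := fun _ _ _ _ _ => hg.symm _ (mem_univ _) _ _
  pos := by
    intro t ht p u hu
    refine lt_of_lt_of_eq (hg.pos (Φ (t, p)) (mem_univ _)
      (mfderiv (𝓘(ℝ, ℝ).prod I') I Φ (t, p) ((0, u) : ℝ × E')) fun h0 => hu ?_)
      (h.inducedMetric_apply ht p u u).symm
    have h1 := (h.isInvertible_mfderiv (q := (t, p)) ht).injective
      (h0.trans (map_zero (mfderiv (𝓘(ℝ, ℝ).prod I') I Φ (t, p))).symm)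
    exact congrArg Prod.snd h1
  smooth := fun q hq => (h.contMDiffAt_inducedMetric hJ hg hq.1 q.2).contMDiffWithinAt
  invariant := fun _ ht => h.isInvariant_inducedMetric hM hP hJ ht

theorem isInvariantOneFormFamily (hJ : IsOpen J) (hα : IsSmoothOneFormOn I univ αM)
    (hi : IsInvariantOneForm I G αM) :
    IsInvariantOneFormFamily I' G J (inducedOneForm I I' Φ αM) where
  smooth := fun q hq => (h.contMDiffAt_inducedOneForm hJ hα hq.1 q.2).contMDiffWithinAt
  invariant := fun _ ht => h.isInvariant_inducedOneForm hM hP hJ hi ht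

theorem shapeOperator_apply (hJ : IsOpen J) (hg : IsRiemannianMetricOn I univ gM) {t : ℝ}
    (ht : t ∈ J) (p : G ⧸ K) (X : E') :
    (shapeOperator I I' Φ gM t p X : E')
      = famShape I' (inducedMetric I I' Φ gM) p (t, extChartAt I' p p) X := by
  set y : ℝ × E' := (t, extChartAt I' p p) with hy
  set ℓ := famShape I' (inducedMetric I I' Φ gM) p with hℓ
  have HF := isLocalFamily_famShape hJ (h.isInvariantMetricFamily hM hP hJ hg) ht p
  have h0 : famParam I' p y = (t, p) := famParam_self t p
  have hψ : IsParam I (Φ ∘ famParam I' p) y :=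
    isParam_comp_famParam (mem_extChartAt_target p) (h.contMDiffAt ht) (h.isInvertible_mfderiv ht)
  have hN : ∀ᶠ z in 𝓝 y, normalField I I' Φ ((Φ ∘ famParam I' p) z)
      = mfderiv 𝓘(ℝ, ℝ × E') I (Φ ∘ famParam I' p) z ((1, 0) : ℝ × E') := by
    filter_upwards [eventually_famParam hJ ht] with z hz
    refine (h.normalField_apply (q := famParam I' p z) hz.1).trans ?_
    refine Eq.trans ?_ (mfderiv_comp_famParam hz.2 (h.mdifferentiableAt hz.1) _).symm
    exact congrArg (fun w : E' => (mfderiv (𝓘(ℝ, ℝ).prod I') I Φ (famParam I' p z) :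
      ℝ × E' →L[ℝ] E) (1, w)) (map_zero _).symm
  have h1 := hψ.covDeriv_eq (hg.isMetricAt isOpen_univ (mem_univ _))
    (V' := fun _ => (1, 0)) (differentiableAt_const _) hN (0, X)
  have e1 : pullMetric I (Φ ∘ famParam I' p) gM =ᶠ[𝓝 y]
      prodBilin (famBilin I' (inducedMetric I I' Φ gM) p) := by
    filter_upwards [eventually_famParam hJ ht] with q hq
    exact pullMetric_comp_famParam hq.2 (h.mdifferentiableAt hq.1)
      (h.pullBilin_eq hM hP hJ (fun x => hg.symm x (mem_univ x)) hq.1)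
  have h2 : localCovDeriv (pullMetric I (Φ ∘ famParam I' p) gM) (fun _ => (1, 0)) y (0, X)
      = (0, ℓ y X) := by
    rw [localCovDeriv, fderiv_fun_const, (christoffel_congr e1).self_of_nhds]
    simp only [Pi.zero_apply, zero_add, ContinuousLinearMap.flip_apply]
    rw [HF.christoffel_prod]
    simp [hℓ, hy]
  rw [h2] at h1
  have h3 : ∀ z, z = Φ (t, p) → ∀ a b : E,
      a = mfderiv (𝓘(ℝ, ℝ).prod I') I Φ (t, p) ((0, X) : ℝ × E') →
      (covDeriv I gM (normalField I I' Φ) z a : E) = b →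
      b = mfderiv (𝓘(ℝ, ℝ).prod I') I Φ (t, p) ((0, ℓ y X) : ℝ × E') →
      (mfderiv (𝓘(ℝ, ℝ).prod I') I Φ (t, p)).inverse
        (covDeriv I gM (normalField I I' Φ) (Φ (t, p))
          (mfderiv (𝓘(ℝ, ℝ).prod I') I Φ (t, p) ((0, X) : ℝ × E'))) = ((0, ℓ y X) : ℝ × E') := by
    rintro _ rfl _ b rfl hb hb'
    exact (h.isInvertible_mfderiv (q := (t, p)) ht).inverse_apply_eq.2 (hb.trans hb')
  have hΦ := h.mdifferentiableAt (q := (t, p)) ht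
  have h4 := h3 _ (congrArg Φ h0) _ _ (mfderiv_comp_famParam_self hΦ _) h1
    (mfderiv_comp_famParam_self hΦ _)
  have h5 : (mfderiv (𝓘(ℝ, ℝ).prod I') I' (Prod.snd : ℝ × (G ⧸ K) → G ⧸ K) (t, p) :
      ℝ × E' →L[ℝ] E') = ContinuousLinearMap.snd ℝ ℝ E' := mfderiv_snd
  have h6 : ∀ (S : ℝ × E' →L[ℝ] E') (T : E →L[ℝ] ℝ × E') (a b : E) (w : ℝ × E'),
      S = ContinuousLinearMap.snd ℝ ℝ E' → a = b → T b = w → S (T a) = w.2 := by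
    rintro _ T a _ _ rfl rfl rfl; rfl
  exact h6 _ (((mfderiv (𝓘(ℝ, ℝ).prod I') I Φ (t, p)).inverse : E →L[ℝ] ℝ × E') ∘L
    (covDeriv I gM (normalField I I' Φ) (Φ (t, p)) : E →L[ℝ] E)) _ _ _ h5
    (h.mfderiv_orbit ht p X) h4

/-- The shape operators are `(1/2) g_t⁻¹ ġ_t`. -/
theorem deriv_inducedMetric (hJ : IsOpen J) (hg : IsRiemannianMetricOn I univ gM) :
    ∀ t ∈ J, ∀ (p : G ⧸ K) (X Y : TangentSpace I' p),
      deriv (fun s => inducedMetric I I' Φ gM s p X Y) t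
        = 2 * inducedMetric I I' Φ gM t p (shapeOperator I I' Φ gM t p X) Y := by
  intro t ht p X Y
  have hfam := h.isInvariantMetricFamily hM hP hJ hg
  have HF := isLocalFamily_famShape hJ hfam ht p
  rw [deriv_famBilin (HF.contDiffAt.differentiableAt (by simp))]
  refine (HF.shape.self_of_nhds X Y).symm.trans (congrArg (fun r : ℝ => 2 * r) ?_)
  refine (congrArg (fun B : E' →L[ℝ] E' →L[ℝ] ℝ => B _ Y)
    (chartBilin_self (inducedMetric I I' Φ gM t) p)).trans ?_
  exact congrArg (fun a : E' => (inducedMetric I I' Φ gM t p : E' →L[ℝ] E' →L[ℝ] ℝ) a Y)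
    (h.shapeOperator_apply hM hP hJ hg ht p X).symm

theorem ricciSolitonEqOn_iff (hJ : IsOpen J) (hg : IsRiemannianMetricOn I univ gM)
    (hα : IsSmoothOneFormOn I univ αM) (hi : IsInvariantOneForm I G αM) (ε : ℝ) :
    RicciSolitonEqOn I (principalPoints G M) gM (dualField I gM αM) ε ↔
      SolitonSystem I' J (inducedMetric I I' Φ gM) (shapeOperator I I' Φ gM)
        (inducedOneForm I I' Φ αM) (normalComponent I αM γ) ε := by
  have key : ∀ t, ∀ ht : t ∈ J, ∀ p : G ⧸ K, _ := fun t ht p =>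
    soliton_iff (F := Φ) (gM := gM) (αM := αM) (ξ := normalComponent I αM γ) hJ
    (h.isInvariantMetricFamily hM hP hJ hg) (h.isInvariantOneFormFamily hM hP hJ hα hi)
    (h.contDiffOn_normalComponent hJ hα) (h.deriv_inducedMetric hM hP hJ hg) ε
    (fun q hq => h.contMDiffAt hq.1) (fun q hq => h.isInvertible_mfderiv hq.1)
    (fun q hq => h.pullBilin_eq hM hP hJ (fun x => hg.symm x (mem_univ x)) hq.1)
    (fun q hq => h.pullForm_eq hM hP hJ hi hq.1) ht p
    (hg.isMetricAt isOpen_univ (mem_univ _)) (hα.isFormAt isOpen_univ (mem_univ _))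
  constructor
  · intro hs
    have h1 : ∀ t, ∀ ht : t ∈ J, ∀ p : G ⧸ K, _ := fun t ht p => (key t ht p).1
      (hs (Φ (t, p)) (h.target_eq ▸ Φ.map_source (h.mem_source ht)))
    exact ⟨fun t ht p => (h1 t ht p).1, fun t ht p => (h1 t ht p).2.1,
      fun t ht p => (h1 t ht p).2.2⟩
  · intro hs x hx
    rw [← h.target_eq] at hx
    have h2 := Φ.map_target hx
    rw [h.source_eq] at h2
    have h3 := (key (Φ.symm x).1 h2.1 (Φ.symm x).2).2
      ⟨hs.mixed _ h2.1 _, hs.normal _ h2.1 _, hs.orbit _ h2.1 _⟩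
    have h4 : ∀ z, z = x → (∀ u v : TangentSpace I z, ricci I gM z u v
        + (1 / 2) * lieDeriv I gM (dualField I gM αM) z u v + (ε / 2) * gM z u v = 0) →
        ∀ u v : TangentSpace I x, ricci I gM x u v
        + (1 / 2) * lieDeriv I gM (dualField I gM αM) x u v + (ε / 2) * gM x u v = 0 := by
      rintro _ rfl h; exact h
    exact h4 _ (Φ.right_inv hx) h3

end IsCohomOneDiffeo

end CohomogeneityOne
end CohomOne

end

open CohomOne in
theorem proposition1p2 {d n : ℕ} {G : Type*} [Group G] [TopologicalSpace G]
    [ChartedSpace (EuclideanSpace ℝ (Fin d)) G] [LieGroup (𝓡 d) ∞ G] [CompactSpace G] [T2Space G]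
    (K : Subgroup G) [ChartedSpace (EuclideanSpace ℝ (Fin n)) (G ⧸ K)]
    [IsManifold (𝓡 n) ∞ (G ⧸ K)] [ContMDiffSMul (𝓡 d) (𝓡 n) ∞ G (G ⧸ K)] [ConnectedSpace (G ⧸ K)]
    (J : Set ℝ) (hJo : IsOpen J) (hJc : J.OrdConnected) (hJn : J.Nonempty) (ε : ℝ) :
    (∀ (M : Type*) [TopologicalSpace M] [ChartedSpace (EuclideanSpace ℝ (Fin (n + 1))) M]
        [IsManifold (𝓡 (n + 1)) ∞ M] [T2Space M] [SecondCountableTopology M] [ConnectedSpace M]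
        [MulAction G M] [ContMDiffSMul (𝓡 d) (𝓡 (n + 1)) ∞ G M]
        (gbar : ContMDiffRiemannianMetric (𝓡 (n + 1)) ∞ (EuclideanSpace ℝ (Fin (n + 1)))
          (fun x : M => TangentSpace (𝓡 (n + 1)) x))
        (αbar : OneForm (𝓡 (n + 1)) M) (γ : ℝ → M) (Φ : OpenPartialHomeomorph (ℝ × (G ⧸ K)) M),
      IsCohomOneDiffeo (𝓡 (n + 1)) (𝓡 n) K gbar.inner J γ Φ →
      IsSmoothOneFormOn (𝓡 (n + 1)) univ αbar →
      IsInvariantOneForm (𝓡 (n + 1)) G αbar →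
      IsInvariantMetricFamily (𝓡 n) G J (inducedMetric (𝓡 (n + 1)) (𝓡 n) Φ gbar.inner) ∧
      IsInvariantOneFormFamily (𝓡 n) G J (inducedOneForm (𝓡 (n + 1)) (𝓡 n) Φ αbar) ∧
      ContDiffOn ℝ ∞ (normalComponent (𝓡 (n + 1)) αbar γ) J ∧
      (∀ q ∈ J ×ˢ (univ : Set (G ⧸ K)),
        pullBilin (mfderiv (𝓘(ℝ, ℝ).prod (𝓡 n)) (𝓡 (n + 1)) Φ q) (gbar.inner (Φ q))
            = productMetric (𝓡 n) (inducedMetric (𝓡 (n + 1)) (𝓡 n) Φ gbar.inner) q ∧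
        (αbar (Φ q)) ∘L (mfderiv (𝓘(ℝ, ℝ).prod (𝓡 n)) (𝓡 (n + 1)) Φ q)
            = productOneForm (𝓡 n) (normalComponent (𝓡 (n + 1)) αbar γ)
                (inducedOneForm (𝓡 (n + 1)) (𝓡 n) Φ αbar) q) ∧
      (RicciSolitonEqOn (𝓡 (n + 1)) (principalPoints G M) gbar.inner
          (dualField (𝓡 (n + 1)) gbar.inner αbar) ε ↔
        SolitonSystem (𝓡 n) J (inducedMetric (𝓡 (n + 1)) (𝓡 n) Φ gbar.inner)
          (shapeOperator (𝓡 (n + 1)) (𝓡 n) Φ gbar.inner)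
          (inducedOneForm (𝓡 (n + 1)) (𝓡 n) Φ αbar)
          (normalComponent (𝓡 (n + 1)) αbar γ) ε) ∧
      (Dense (principalPoints G M) →
        (RicciSolitonEqOn (𝓡 (n + 1)) univ gbar.inner
          (dualField (𝓡 (n + 1)) gbar.inner αbar) ε ↔
        SolitonSystem (𝓡 n) J (inducedMetric (𝓡 (n + 1)) (𝓡 n) Φ gbar.inner)
          (shapeOperator (𝓡 (n + 1)) (𝓡 n) Φ gbar.inner)
          (inducedOneForm (𝓡 (n + 1)) (𝓡 n) Φ αbar)
          (normalComponent (𝓡 (n + 1)) αbar γ) ε))) ∧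
    (∀ (g : ℝ → BilinField (𝓡 n) (G ⧸ K)) (α : ℝ → OneForm (𝓡 n) (G ⧸ K)) (ξ : ℝ → ℝ)
        (L : ℝ → EndField (𝓡 n) (G ⧸ K)),
      IsInvariantMetricFamily (𝓡 n) G J g →
      IsInvariantOneFormFamily (𝓡 n) G J α →
      ContDiffOn ℝ ∞ ξ J →
      (∀ t ∈ J, ∀ (p : G ⧸ K) (X Y : TangentSpace (𝓡 n) p),
        deriv (fun s => g s p X Y) t = 2 * g t p (L t p X) Y) →
      SolitonSystem (𝓡 n) J g L α ξ ε →
      IsRiemannianMetricOn (𝓘(ℝ, ℝ).prod (𝓡 n)) (J ×ˢ univ) (productMetric (𝓡 n) g) ∧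
      IsSmoothOneFormOn (𝓘(ℝ, ℝ).prod (𝓡 n)) (J ×ˢ univ) (productOneForm (𝓡 n) ξ α) ∧
      RicciSolitonEqOn (𝓘(ℝ, ℝ).prod (𝓡 n)) (J ×ˢ univ) (productMetric (𝓡 n) g)
        (dualField (𝓘(ℝ, ℝ).prod (𝓡 n)) (productMetric (𝓡 n) g)
          (productOneForm (𝓡 n) ξ α)) ε) := by
  have hP : ∀ a : G, MDifferentiable (𝓡 n) (𝓡 n) (fun z : G ⧸ K => a • z) := fun a =>
    ((contMDiff_smul (I := 𝓡 d) (I' := 𝓡 n) (n := ∞) (G := G) (M := G ⧸ K)).comp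
      (contMDiff_const.prodMk contMDiff_id)).mdifferentiable (by simp)
  refine ⟨?_, fun g α ξ L hg hα hξ hL h =>
    ⟨isRiemannianMetricOn_productMetric hJo hg, isSmoothOneFormOn_productOneForm hJo hα hξ,
      ricciSolitonEqOn_product hJo hg hα hξ hL h⟩⟩
  intro M _ _ _ _ _ _ _ _ gbar αbar γ Φ h hα hi
  have hM : ∀ a : G, MDifferentiable (𝓡 (n + 1)) (𝓡 (n + 1)) (fun z : M => a • z) := fun a =>
    ((contMDiff_smul (I := 𝓡 d) (I' := 𝓡 (n + 1)) (n := ∞) (G := G) (M := M)).comp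
      (contMDiff_const.prodMk contMDiff_id)).mdifferentiable (by simp)
  have hg : IsRiemannianMetricOn (𝓡 (n + 1)) univ gbar.inner :=
    ⟨fun x _ => gbar.symm x, fun x _ => gbar.pos x, gbar.contMDiff.contMDiffOn⟩
  have hiff := h.ricciSolitonEqOn_iff hM hP hJo hg hα hi ε
  exact ⟨h.isInvariantMetricFamily hM hP hJo hg, h.isInvariantOneFormFamily hM hP hJo hα hi,
    h.contDiffOn_normalComponent hJo hα,
    fun q hq => ⟨h.pullBilin_eq hM hP hJo gbar.symm hq.1, h.pullForm_eq hM hP hJo hi hq.1⟩,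
    hiff, fun hd => ⟨fun hs => hiff.1 fun x _ => hs x (mem_univ x),
      fun hs => (hiff.2 hs).of_dense hd hg hα⟩⟩
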